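/- Let $T\ge 1$ and let $\zeta(j),\theta(j)$, $j\in\mathbb Z$, be complex-valued $T$-periodically correlated ($T$-PC) sequences (zero mean, finite variance, $E\zeta(n+T)\overline{\zeta(m+T)}=E\zeta(n)\overline{\zeta(m)}$ with $T>0$ smallest possible; likewise $\theta$), uncorrelated with each other: $E\zeta(n)\overline{\theta(m)}=0$ for all $n,m$. Let $\vec\zeta(n)=(\zeta(nT+\nu))_{\nu=1}^T$ and $\vec\theta(n)=(\theta(nT+\nu))_{\nu=1}^T$ be the $T$-blocked sequences, and assume that they have spectral density matrices $f=f^{\vec\zeta}$, $g=f^{\vec\theta}$ on $(-\pi,\pi]$ (integrable, positive semidefinite a.e., with $E\zeta_\nu(n)\overline{\zeta_\mu(m)}=\frac1{2\pi}\int_{-\pi}^{\pi}e^{i(n-m)\lambda}f_{\nu\mu}(\lambda)\,d\lambda$, and likewise for $\vec\theta,g$) satisfying the minimality condition: $f+g$ is invertible a.e. and $\int_{-\pi}^{\pi}\mathrm{Tr}\,[(f(\lambda)+g(\lambda))^{-1}]\,d\lambda<\infty$. Let $N_k=T N_k^T$ ($1\le k\le s$) and $K_k=T K_k^T$ ($1\le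 k\le s-1$) be multiples of $T$, where $N_k^T,K_k^T$ are nonnegative integers, $N_0=K_0=N_0^T=K_0^T=0$, $M_l=\sum_{k=0}^l(N_k+K_k)$, $M_l^T=\sum_{k=0}^l(N^T_k+K^T_k)$, and $$S=\bigcup_{l=0}^{s-1}\{M_l+1,\dots,M_l+N_{l+1}\},\qquad \tilde S=\bigcup_{l=0}^{s-1}\{M_l^T,\dots,M_l^T+N_{l+1}^T-1\}.$$ Let the coefficients have the form $a(\nu+\tilde jT)=\alpha(\tilde j)e^{2\pi i\tilde j\nu/T}$, $\nu=1,\dots,T$, $\tilde j\in\tilde S$, for some complex numbers $\alpha(\tilde j)$, and put $\vec a(\tilde j)=(a(\nu+\tilde jT))_{\nu=1}^T$, $A_s\zeta=\sum_{l=0}^{s-1}\sum_{j=M_l+1}^{M_l+N_{l+1}}a(j)\zeta(j)$, $A_s\vec\zeta=\sum_{l=0}^{s-1}\sum_{\tilde j=M_l^T}^{M_l^T+N_{l+1}^T-1}\vec a^{\top}(\tilde j)\vec\zeta(\tilde j)$, $\tilde A_s(e^{i\lambda})=\sum_{\tilde j\in\tilde S}\vec a(\tilde j)e^{i\tilde j\lambda}$.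 For $F=f,g,f+g$ let $L_2(F)$ be the space of measurable $\vec b:(-\pi,\pi]\to\mathbb C^T$ with $\int_{-\pi}^{\pi}\vec b^{\top}F\,\overline{\vec b}\,d\lambda<\infty$, and let $L_2^{s-}(F)$ be the closure in it of the span of $e^{ij\lambda}\delta_\nu$, $j\in\mathbb Z\setminus\tilde S$, $\nu=1,\dots,T$. Let $$\Delta(\vec h;f,g)=\frac1{2\pi}\int_{-\pi}^{\pi}(\tilde A_s-\vec h)^{\top}f\,\overline{(\tilde A_s-\vec h)}\,d\lambda+\frac1{2\pi}\int_{-\pi}^{\pi}\vec h^{\top}g\,\overline{\vec h}\,d\lambda .$$ The spectral characteristic of the optimal estimate is the minimizer of $\Delta(\cdot;f,g)$ over $L_2^{s-}(f+g)$. The optimal linear estimate of $A_s\vec\zeta$ is the element of the closed linear span in $L^2(P)$ of the observations $\zeta_\nu(j)+\theta_\nu(j)$, $j\in\mathbb Z\setminus\tilde S$, $\nu=1,\dots,T$, that minimizes the mean square error. Let $\mathbf B,\mathbf D,\mathbf R$ be the matrices with rows and columns indexed by $\tilde S\times\{1,\dots,T\}$ whose $T\times T$ blocks, for $k,j\in\tilde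 S$, are $$B(k,j)=\frac1{2\pi}\int_{-\pi}^{\pi}[(f+g)^{-1}]^{\top}e^{i(j-k)\lambda}d\lambda,\quad D(k,j)=\frac1{2\pi}\int_{-\pi}^{\pi}[f(f+g)^{-1}]^{\top}e^{i(j-k)\lambda}d\lambda,$$ $$R(k,j)=\frac1{2\pi}\int_{-\pi}^{\pi}[f(f+g)^{-1}g]^{\top}e^{i(j-k)\lambda}d\lambda .$$ Then: 1. $\vec\zeta$ and $\vec\theta$ are $T$-variate stationary sequences, $A_s\zeta=A_s\vec\zeta$, and the closed linear span of $\{\zeta(j)+\theta(j):j\in\mathbb Z\setminus S\}$ equals that of $\{\zeta_\nu(j)+\theta_\nu(j):j\in\mathbb Z\setminus\tilde S,\ 1\le\nu\le T\}$. So the problem of estimating $A_s\zeta$ from $\zeta(j)+\theta(j)$, $j\in\mathbb Z\setminus S$, is that of estimating $A_s\vec\zeta$ from $\vec\zeta(j)+\vec\theta(j)$, $j\in\mathbb Z\setminus\tilde S$. 2. The entries of $(f+g)^{-1}$, $f(f+g)^{-1}$ and $f(f+g)^{-1}g$ are integrable on $(-\pi,\pi]$, and $\mathbf B$ is invertible.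 Put $\vec a_s=(\vec a(\tilde j))_{\tilde j\in\tilde S}$, $\vec c_s=(\vec c(\tilde j))_{\tilde j\in\tilde S}=\mathbf B^{-1}\mathbf D\,\vec a_s$ and $\tilde C_s(e^{i\lambda})=\sum_{\tilde j\in\tilde S}\vec c(\tilde j)e^{i\tilde j\lambda}$. The spectral characteristic exists, is unique up to a.e. equality, and is $$\vec h^{\top}=(\tilde A_s^{\top}f-\tilde C_s^{\top})(f+g)^{-1}=\tilde A_s^{\top}-(\tilde A_s^{\top}g+\tilde C_s^{\top})(f+g)^{-1}\quad\text{a.e.}$$ 3. $\Delta(\vec h;f,g)=\langle\vec a_s,\mathbf R\,\vec a_s\rangle+\langle\vec c_s,\mathbf B\,\vec c_s\rangle$, where $\langle\cdot,\cdot\rangle$ is the standard Hermitian scalar product. 4. The sequences $\vec\zeta,\vec\theta$ have orthogonal random measures $Z^{\vec\zeta},Z^{\vec\theta}$ on $(-\pi,\pi]$: vectors of $L^2(P)$-valued countably additive measures with $\zeta_\nu(n)=\int_{-\pi}^{\pi}e^{in\lambda}Z^{\vec\zeta}_\nu(d\lambda)$ and $E\,Z^{\vec\zeta}_\nu(\Delta_1)\overline{Z^{\vec\zeta}_\mu(\Delta_2)}=\frac1{2\pi}\int_{\Delta_1\cap\Delta_2}f_{\nu\mu}\,d\lambda$,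 and likewise for $\vec\theta,g$. For any such measures the optimal linear estimate of $A_s\vec\zeta$ exists, is unique, and equals $$\widehat{A_s\vec\zeta}=\int_{-\pi}^{\pi}\vec h^{\top}\bigl(Z^{\vec\zeta}(d\lambda)+Z^{\vec\theta}(d\lambda)\bigr),$$ and its mean square error is $E|A_s\vec\zeta-\widehat{A_s\vec\zeta}|^2=\Delta(\vec h;f,g)$. Here the integral is the mean square limit of integrals of simple functions converging to $\vec h$ in $L_2(f+g)$. -/

import Mathlib

open MeasureTheory Filter Topology
open scoped Matrix ComplexConjugate ComplexOrder

namespace PCInterp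

noncomputable section

/-! ### Stochastic sequences -/

/-- `X` is periodically correlated with (smallest) period `T`. -/
structure IsPC {Ω : Type*} [MeasurableSpace Ω] (P : Measure Ω) (T : ℕ) (X : ℤ → Ω → ℂ) :
    Prop where
  period_pos : 0 < T
  memLp : ∀ n, MemLp (X n) 2 P
  mean_zero : ∀ n, ∫ ω, X n ω ∂P = 0
  periodic : ∀ n m : ℤ,
    ∫ ω, X (n + T) ω * conj (X (m + T) ω) ∂P = ∫ ω, X n ω * conj (X m ω) ∂P
  minimal : ∀ T' : ℕ, 0 < T' → T' < T →
    ¬ ∀ n m : ℤ,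
      ∫ ω, X (n + T') ω * conj (X (m + T') ω) ∂P = ∫ ω, X n ω * conj (X m ω) ∂P

/-- `X` is a `T`-variate (wide sense) stationary sequence. -/
structure IsStationary {Ω : Type*} [MeasurableSpace Ω] (P : Measure Ω) {T : ℕ}
    (X : ℤ → Fin T → Ω → ℂ) : Prop where
  memLp : ∀ n ν, MemLp (X n ν) 2 P
  mean_zero : ∀ n ν, ∫ ω, X n ν ω ∂P = 0
  covariance : ∃ R : ℤ → Matrix (Fin T) (Fin T) ℂ, ∀ (n m : ℤ) (ν μ : Fin T),
    ∫ ω, X n ν ω * conj (X m μ ω) ∂P = R (n - m) ν μ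

/-- Two sequences are uncorrelated. -/
def Uncorrelated {Ω : Type*} [MeasurableSpace Ω] (P : Measure Ω) (X Y : ℤ → Ω → ℂ) : Prop :=
  ∀ n m : ℤ, ∫ ω, X n ω * conj (Y m ω) ∂P = 0

/-- The `T`-blocked sequence `[X⃗(n)]_p = X(nT + p)`, `p = 1, …, T`; the element `ν : Fin T`
stands for `p = ν + 1`. -/
def block {Ω : Type*} (T : ℕ) (X : ℤ → Ω → ℂ) : ℤ → Fin T → Ω → ℂ :=
  fun n ν => X (n * T + ((ν : ℕ) + 1))

/-- `f` is the spectral density matrix of `X`, with the normalization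
`E X_ν(n) conj X_μ(m) = (2π)⁻¹ ∫_{-π}^{π} e^{i(n-m)t} f_{νμ}(t) dt`. -/
structure IsSpectralDensity {Ω : Type*} [MeasurableSpace Ω] (P : Measure Ω) {T : ℕ}
    (X : ℤ → Fin T → Ω → ℂ) (f : ℝ → Matrix (Fin T) (Fin T) ℂ) : Prop where
  integrable : ∀ ν μ, IntegrableOn (fun t => f t ν μ) (Set.Ioc (-Real.pi) Real.pi)
  posSemidef : ∀ᵐ t ∂(volume.restrict (Set.Ioc (-Real.pi) Real.pi)), (f t).PosSemidef
  covariance : ∀ (n m : ℤ) (ν μ : Fin T),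
    ∫ ω, X n ν ω * conj (X m μ ω) ∂P =
      (1 / (2 * Real.pi) : ℂ) *
        ∫ t in (-Real.pi)..Real.pi, Complex.exp (Complex.I * ((n : ℂ) - m) * t) * f t ν μ

/-- The minimality condition: `f + g` is invertible almost everywhere and
`∫ Tr (f + g)⁻¹ < ∞`. -/
def Minimality {T : ℕ} (f g : ℝ → Matrix (Fin T) (Fin T) ℂ) : Prop :=
  (∀ᵐ t ∂(volume.restrict (Set.Ioc (-Real.pi) Real.pi)), IsUnit (f t + g t).det) ∧
    IntegrableOn (fun t => ((f t + g t)⁻¹).trace) (Set.Ioc (-Real.pi) Real.pi)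

/-! ### Missed observations and functionals -/

/-- `M_l = ∑_{k=0}^{l} (N_k + K_k)`. -/
def blockStart (N K : ℕ → ℕ) (l : ℕ) : ℕ := ∑ k ∈ Finset.range (l + 1), (N k + K k)

/-- `S = ⋃_{l=0}^{s-1} {M_l + 1, …, M_l + N_{l+1}}`. -/
def missing (N K : ℕ → ℕ) (s : ℕ) : Finset ℤ :=
  (Finset.range s).biUnion fun l =>
    Finset.Icc ((blockStart N K l : ℤ) + 1) ((blockStart N K l : ℤ) + N (l + 1))

/-- `S̃ = ⋃_{l=0}^{s-1} {M_l, …, M_l + N_{l+1} - 1}`, applied to the block lengths divided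
by the period. -/
def missingBlocks (N K : ℕ → ℕ) (s : ℕ) : Finset ℤ :=
  (Finset.range s).biUnion fun l =>
    Finset.Ico (blockStart N K l : ℤ) ((blockStart N K l : ℤ) + N (l + 1))

/-- `A_s X = ∑_{l=0}^{s-1} ∑_{j=M_l+1}^{M_l+N_{l+1}} a(j) X(j)`. -/
def functional {Ω : Type*} (N K : ℕ → ℕ) (s : ℕ) (a : ℤ → ℂ) (X : ℤ → Ω → ℂ) (ω : Ω) : ℂ :=
  ∑ l ∈ Finset.range s,
    ∑ j ∈ Finset.Icc ((blockStart N K l : ℤ) + 1) ((blockStart N K l : ℤ) + N (l + 1)),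
      a j * X j ω

/-- `A_s X⃗ = ∑_{l=0}^{s-1} ∑_{j=M_l}^{M_l+N_{l+1}-1} a⃗(j)ᵀ X⃗(j)`. -/
def blockFunctional {Ω : Type*} {T : ℕ} (N K : ℕ → ℕ) (s : ℕ) (a : ℤ → Fin T → ℂ)
    (X : ℤ → Fin T → Ω → ℂ) (ω : Ω) : ℂ :=
  ∑ l ∈ Finset.range s,
    ∑ j ∈ Finset.Ico (blockStart N K l : ℤ) ((blockStart N K l : ℤ) + N (l + 1)),
      a j ⬝ᵥ fun ν => X j ν ω

/-- `a⃗(j)_ν = α(j) e^{2πi jν/T}`, `ν = 1, …, T`. -/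
def coeffVec (T : ℕ) (α : ℤ → ℂ) (j : ℤ) (ν : Fin T) : ℂ :=
  α j * Complex.exp (2 * Real.pi * Complex.I * j * ((ν : ℕ) + 1) / T)

/-! ### Optimal linear estimates -/

/-- The closed linear span in `L²(P)` of the random variables `X j`, `j ∈ J`. -/
def closedSpan {Ω ι : Type*} [MeasurableSpace Ω] (P : Measure Ω) (X : ι → Ω → ℂ) (J : Set ι) :
    Submodule ℂ (Lp ℂ 2 P) :=
  (Submodule.span ℂ {Y : Lp ℂ 2 P | ∃ j ∈ J, Y =ᵐ[P] X j}).topologicalClosure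

/-- `Y` is an element of `H` that minimizes the mean square error `E|A - Y|²`. -/
def IsOptimalEstimate {Ω : Type*} [MeasurableSpace Ω] {P : Measure Ω}
    (H : Submodule ℂ (Lp ℂ 2 P)) (A : Ω → ℂ) (Y : Lp ℂ 2 P) : Prop :=
  Y ∈ H ∧ ∀ Y' ∈ H, ∫ ω, ‖A ω - Y ω‖ ^ 2 ∂P ≤ ∫ ω, ‖A ω - Y' ω‖ ^ 2 ∂P

/-! ### The spaces `L₂(f)` and `L₂^{s-}(f)` -/

/-- `b ∈ L₂(f)`. -/
def MemL2 {T : ℕ} (f : ℝ → Matrix (Fin T) (Fin T) ℂ) (b : ℝ → Fin T → ℂ) : Prop :=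
  AEStronglyMeasurable b (volume.restrict (Set.Ioc (-Real.pi) Real.pi)) ∧
    IntegrableOn (fun t => b t ⬝ᵥ (f t *ᵥ star (b t))) (Set.Ioc (-Real.pi) Real.pi)

/-- The squared seminorm `∫_{-π}^{π} bᵀ f b̄ dt` of `L₂(f)`; the integrand is real where `f` is
positive semidefinite. -/
def sqNorm {T : ℕ} (f : ℝ → Matrix (Fin T) (Fin T) ℂ) (b : ℝ → Fin T → ℂ) : ℝ :=
  ∫ t in (-Real.pi)..Real.pi, (b t ⬝ᵥ (f t *ᵥ star (b t))).re

/-- The vector trigonometric polynomial `∑_j p(j) e^{ijt}`. -/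
def trigPoly {T : ℕ} (p : ℤ →₀ (Fin T → ℂ)) (t : ℝ) : Fin T → ℂ :=
  p.sum fun j v => Complex.exp (Complex.I * j * t) • v

/-- `b ∈ L₂^{s-}(f)`: the closure in `L₂(f)` of the span of `e^{ijt} δ_ν`, `j ∉ S`. -/
def MemL2Minus {T : ℕ} (S : Finset ℤ) (f : ℝ → Matrix (Fin T) (Fin T) ℂ)
    (b : ℝ → Fin T → ℂ) : Prop :=
  MemL2 f b ∧ ∀ ε > 0, ∃ p : ℤ →₀ (Fin T → ℂ), (∀ j ∈ S, p j = 0) ∧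
    sqNorm f (fun t => b t - trigPoly p t) < ε

/-- The mean square error
`Δ(h; f, g) = (2π)⁻¹ ∫ (A - h)ᵀ f conj(A - h) + (2π)⁻¹ ∫ hᵀ g h̄`. -/
def mse {T : ℕ} (A : ℝ → Fin T → ℂ) (f g : ℝ → Matrix (Fin T) (Fin T) ℂ)
    (h : ℝ → Fin T → ℂ) : ℝ :=
  1 / (2 * Real.pi) * sqNorm f (fun t => A t - h t) + 1 / (2 * Real.pi) * sqNorm g h

/-- `h` is a spectral characteristic of the optimal linear estimate: it minimizes the mean square
error over `L₂^{s-}(f + g)`. -/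
def IsSpectralCharacteristic {T : ℕ} (S : Finset ℤ) (A : ℝ → Fin T → ℂ)
    (f g : ℝ → Matrix (Fin T) (Fin T) ℂ) (h : ℝ → Fin T → ℂ) : Prop :=
  MemL2Minus S (fun t => f t + g t) h ∧
    ∀ b, MemL2Minus S (fun t => f t + g t) b → mse A f g h ≤ mse A f g b

/-! ### Random measures and stochastic integrals -/

/-- The integral `∫ φᵀ(t) Z(dt)` of a simple function against an `L²(P)`-valued vector of
measures. -/
def simpleIntegral {Ω : Type*} [MeasurableSpace Ω] {P : Measure Ω} {T : ℕ}
    (Z : Fin T → VectorMeasure ℝ (Lp ℂ 2 P)) (φ : SimpleFunc ℝ (Fin T → ℂ)) : Lp ℂ 2 P :=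
  ∑ v ∈ φ.range, ∑ ν, v ν • Z ν (φ ⁻¹' {v})

/-- `Y = ∫_{-π}^{π} bᵀ(t) Z(dt)` in mean square, where `f` is the spectral density of `Z`:
`Y` is the limit of integrals of simple functions that converge to `b` in `L₂(f)`. -/
def HasStochIntegral {Ω : Type*} [MeasurableSpace Ω] {P : Measure Ω} {T : ℕ}
    (Z : Fin T → VectorMeasure ℝ (Lp ℂ 2 P)) (f : ℝ → Matrix (Fin T) (Fin T) ℂ)
    (b : ℝ → Fin T → ℂ) (Y : Lp ℂ 2 P) : Prop :=
  MemL2 f b ∧ ∃ φ : ℕ → SimpleFunc ℝ (Fin T → ℂ),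
    Tendsto (fun n => sqNorm f (fun t => b t - φ n t)) atTop (𝓝 0) ∧
    Tendsto (fun n => simpleIntegral Z (φ n)) atTop (𝓝 Y)

/-- `Z` is the orthogonal random measure on `(-π, π]` of the stationary sequence `X` with spectral
density `f`: `E Z_ν(Δ₁) conj Z_μ(Δ₂) = (2π)⁻¹ ∫_{Δ₁ ∩ Δ₂} f_{νμ}` and
`X_ν(n) = ∫ e^{int} Z_ν(dt)`. -/
structure IsOrthogonalMeasureOf {Ω : Type*} [MeasurableSpace Ω] {P : Measure Ω} {T : ℕ}
    (Z : Fin T → VectorMeasure ℝ (Lp ℂ 2 P)) (X : ℤ → Fin T → Ω → ℂ)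
    (f : ℝ → Matrix (Fin T) (Fin T) ℂ) : Prop where
  covariance : ∀ (ν μ : Fin T) (Δ₁ Δ₂ : Set ℝ), MeasurableSet Δ₁ → MeasurableSet Δ₂ →
    ∫ ω, Z ν Δ₁ ω * conj (Z μ Δ₂ ω) ∂P =
      (1 / (2 * Real.pi) : ℂ) * ∫ t in Δ₁ ∩ Δ₂ ∩ Set.Ioc (-Real.pi) Real.pi, f t ν μ
  representation : ∀ (n : ℤ) (ν : Fin T), ∃ Y : Lp ℂ 2 P, Y =ᵐ[P] X n ν ∧
    HasStochIntegral Z f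
      (fun t => Pi.single ν (Complex.exp (Complex.I * n * t))) Y

/-! ### The matrices and the spectral characteristic -/

/-- The matrix, indexed by `S × {1, …, T}`, whose `T × T` blocks are the Fourier coefficients
`(2π)⁻¹ ∫ G(t)ᵀ e^{i(j-k)t} dt`, `k, j ∈ S`. -/
def fourierMatrix {T : ℕ} (S : Finset ℤ) (G : ℝ → Matrix (Fin T) (Fin T) ℂ) :
    Matrix (S × Fin T) (S × Fin T) ℂ :=
  Matrix.of fun p q =>
    (1 / (2 * Real.pi) : ℂ) * ∫ t in (-Real.pi)..Real.pi,
      (G t)ᵀ p.2 q.2 * Complex.exp (Complex.I * (((q.1 : ℤ) : ℂ) - ((p.1 : ℤ) : ℂ)) * t)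

/-- `B`, from `(f + g)⁻¹`. -/
def matB {T : ℕ} (S : Finset ℤ) (f g : ℝ → Matrix (Fin T) (Fin T) ℂ) :
    Matrix (S × Fin T) (S × Fin T) ℂ :=
  fourierMatrix S fun t => (f t + g t)⁻¹

/-- `D`, from `f (f + g)⁻¹`. -/
def matD {T : ℕ} (S : Finset ℤ) (f g : ℝ → Matrix (Fin T) (Fin T) ℂ) :
    Matrix (S × Fin T) (S × Fin T) ℂ :=
  fourierMatrix S fun t => f t * (f t + g t)⁻¹

/-- `R`, from `f (f + g)⁻¹ g`. -/
def matR {T : ℕ} (S : Finset ℤ) (f g : ℝ → Matrix (Fin T) (Fin T) ℂ) :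
    Matrix (S × Fin T) (S × Fin T) ℂ :=
  fourierMatrix S fun t => f t * (f t + g t)⁻¹ * g t

/-- The column vector composed of the vectors `a⃗(j)`, `j ∈ S`. -/
def stack {T : ℕ} (S : Finset ℤ) (a : ℤ → Fin T → ℂ) : S × Fin T → ℂ := fun p => a p.1 p.2

/-- `c = B⁻¹ D a`. -/
def coeffC {T : ℕ} (S : Finset ℤ) (f g : ℝ → Matrix (Fin T) (Fin T) ℂ) (a : ℤ → Fin T → ℂ) :
    S × Fin T → ℂ :=
  (matB S f g)⁻¹ *ᵥ (matD S f g *ᵥ stack S a)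

/-- `∑_{j ∈ S} v⃗(j) e^{ijt}`. -/
def expSum {T : ℕ} (S : Finset ℤ) (v : S × Fin T → ℂ) (t : ℝ) : Fin T → ℂ :=
  fun ν => ∑ j : S, v (j, ν) * Complex.exp (Complex.I * ((j : ℤ) : ℂ) * t)

/-- `hᵀ = (Ãᵀ f - C̃ᵀ) (f + g)⁻¹`. -/
def specChar {T : ℕ} (S : Finset ℤ) (f g : ℝ → Matrix (Fin T) (Fin T) ℂ) (a : ℤ → Fin T → ℂ)
    (t : ℝ) : Fin T → ℂ :=
  (expSum S (stack S a) t ᵥ* f t - expSum S (coeffC S f g a) t) ᵥ* (f t + g t)⁻¹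

end

end PCInterp

namespace PCInterp

/-! Linear interpolation is an orthogonal projection, and the spectral representation turns it into
a quadratic minimization over vector fields on the frequency interval. The signal lives
isometrically in `L₂(f)` and the noise in `L₂(g)`, up to the factor `1/(2π)`; as they are
uncorrelated, the error of the estimate with characteristic `h` is the sum of the two contributions
in `mse` (`norm_sq_sub_eq_mse`).

Minimality makes the constraint explicit. Since `(f + g)⁻¹` has integrable trace, Cauchy–Schwarz
embeds `L₂(f + g)` continuously in `L¹`, so Fourier coefficients are continuous and vanish on `S`
for every element of `L₂^{s-}(f + g)` (`coeff_eq_zero`). Conversely, a field of `L₂(f + g)` with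
these coefficients zero is a limit of admissible polynomials (`exists_trig_sqNorm_sub_lt`): an
annihilator of the admissible exponentials is, by Fourier uniqueness, a trigonometric polynomial
with frequencies in `S`, and it pairs to zero with the field.

The minimizer is therefore characterized by a Lagrange condition: `hᵀ(f + g) = Ãᵀf - C̃ᵀ`, where the
multiplier `C̃` has frequencies in `S`. Requiring the coefficients of `h` on `S` to vanish gives `B
c = D a`. The matrix `B` is the Gram matrix of exponentials in `L₂((f + g)⁻¹)`, hence invertible
(`isUnit_det_matB`). Completing the square gives `mse_eq_add`: a competitor exceeds the error of `h`
by its squared distance from `h` in `L₂(f + g)`, which settles existence and uniqueness together.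
The error formula is a pointwise matrix identity for the parallel sum `f (f + g)⁻¹ g`
(`mse_integrand_eq`).

Random measures and stochastic integrals come from one device, the continuous extension of an
isometry along a dense range (`HasExtension`). Applied to exponentials it constructs the measures;
applied to simple functions it is the stochastic integral. Passing from the periodically correlated
sequences to blocks is a relabelling of indices by division with remainder. -/

/-! ### Measurable factorization of positive semidefinite fields. -/

open scoped Matrix.Norms.L2Operator MatrixOrder in
/-- A measurable field of positive semidefinite matrices has a measurable field of factors
`G = Mᴴ M`. -/
theorem exists_factor_of_posSemidef {n : Type*} [Fintype n] [DecidableEq n]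
    {α : Type*} [MeasurableSpace α] {μ : Measure α} {G : α → Matrix n n ℂ}
    (hG : ∀ i j, AEStronglyMeasurable (fun t => G t i j) μ)
    (hpos : ∀ᵐ t ∂μ, (G t).PosSemidef) :
    ∃ M : α → Matrix n n ℂ, (∀ i j, AEStronglyMeasurable (fun t => M t i j) μ) ∧
      ∀ᵐ t ∂μ, (M t)ᴴ * M t = G t := by
  classical
  borelize (Matrix n n ℂ)
  have hGm : AEMeasurable G μ := by
    have h : ∀ t, G t = ∑ i, ∑ j, G t i j • Matrix.single i j (1 : ℂ) := fun t => by
      conv_lhs => rw [Matrix.matrix_eq_sum_single (G t)]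
      simp [Matrix.smul_single]
    have : AEStronglyMeasurable (fun t => ∑ i, ∑ j, G t i j • Matrix.single i j (1 : ℂ)) μ :=
      Finset.aestronglyMeasurable_fun_sum _ fun i _ =>
        Finset.aestronglyMeasurable_fun_sum _ fun j _ => (hG i j).smul_const _
    rw [funext h]
    exact this.aemeasurable
  -- The square root is continuous only on the closed cone of nonnegative matrices. Its extension by
  -- zero is Borel on all matrices, so composing it with `G` preserves measurability.
  have hc : ContinuousOn (CFC.sqrt (A := Matrix n n ℂ)) {a | 0 ≤ a} :=
    CFC.continuousOn_sqrt
  have hcl : IsClosed {a : Matrix n n ℂ | 0 ≤ a} := by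
    exact CStarAlgebra.isClosed_nonneg
  have hm : Measurable ({a : Matrix n n ℂ | 0 ≤ a}.piecewise CFC.sqrt 0) :=
    hc.measurable_piecewise continuousOn_const hcl.measurableSet
  refine ⟨fun t => ({a : Matrix n n ℂ | 0 ≤ a}.piecewise CFC.sqrt 0) (G t), fun i j => ?_, ?_⟩
  · have h1 : Continuous fun a : Matrix n n ℂ => a i j := continuous_id.matrix_elem i j
    exact (h1.measurable.comp_aemeasurable (hm.comp_aemeasurable hGm)).aestronglyMeasurable
  · filter_upwards [hpos] with t ht
    have h0 : G t ∈ {a : Matrix n n ℂ | 0 ≤ a} := ht.nonneg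
    rw [Set.piecewise_eq_of_mem _ _ _ h0]
    have h2 : (CFC.sqrt (G t)).IsHermitian := (Matrix.nonneg_iff_posSemidef.1 (CFC.sqrt_nonneg (G t))).isHermitian
    rw [h2.eq]
    exact CFC.sqrt_mul_sqrt_self (G t) ht.nonneg

/-! ### The frequency interval and Fourier uniqueness. -/

/-- Lebesgue measure on `(-π, π]`. -/
noncomputable abbrev freqMeasure : Measure ℝ := volume.restrict (Set.Ioc (-Real.pi) Real.pi)

theorem intervalIntegral_eq_freq {E : Type*} [NormedAddCommGroup E] [NormedSpace ℝ E]
    (u : ℝ → E) : ∫ t in (-Real.pi)..Real.pi, u t = ∫ t, u t ∂freqMeasure :=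
  intervalIntegral.integral_of_le (by linarith [Real.pi_pos])

/-- An integrable function on `(-π, π]` whose Fourier coefficients vanish is zero. -/
theorem ae_eq_zero_of_fourier_eq_zero {u : ℝ → ℂ} (hu : Integrable u freqMeasure)
    (h0 : ∀ n : ℤ, ∫ t, Complex.exp (Complex.I * n * t) * u t ∂freqMeasure = 0) :
    u =ᵐ[freqMeasure] 0 := by
  have : Fact (0 < 2 * Real.pi) := ⟨Real.two_pi_pos⟩
  have hint : ∀ g : C(AddCircle (2 * Real.pi), ℂ),
      Integrable (fun t : ℝ => g t * u t) freqMeasure := fun g =>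
    hu.bdd_mul (c := ‖g‖) ((g.continuous.comp (AddCircle.continuous_mk' _)).aestronglyMeasurable)
      (Eventually.of_forall fun t => g.norm_coe_le_norm _)
  -- Integration against `u` is a bounded functional on continuous functions of the circle. It kills
  -- the characters, whose span is uniformly dense, hence it is zero.
  let Λ : C(AddCircle (2 * Real.pi), ℂ) →ₗ[ℂ] ℂ :=
    { toFun := fun g => ∫ t : ℝ, g t * u t ∂freqMeasure
      map_add' := fun g g' => by
        simp only [ContinuousMap.add_apply, add_mul]
        exact integral_add (hint g) (hint g')
      map_smul' := fun c g => by
        simp only [ContinuousMap.smul_apply, smul_eq_mul, mul_assoc, RingHom.id_apply]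
        exact integral_const_mul _ _ }
  have hΛc : Continuous Λ := by
    refine AddMonoidHomClass.continuous_of_bound Λ (∫ t, ‖u t‖ ∂freqMeasure) fun g => ?_
    calc ‖Λ g‖ ≤ ∫ t : ℝ, ‖g t * u t‖ ∂freqMeasure := norm_integral_le_integral_norm _
      _ ≤ ∫ t, ‖u t‖ * ‖g‖ ∂freqMeasure := by
        refine integral_mono (hint g).norm (hu.norm.mul_const _) fun t => ?_
        simp only [norm_mul]
        rw [mul_comm]
        gcongr
        exact g.norm_coe_le_norm _
      _ = _ := integral_mul_const _ _
  have hΛ : ∀ g, Λ g = 0 := by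
    intro g
    have hg : g ∈ (Submodule.span ℂ (Set.range <| @fourier (2 * Real.pi))).topologicalClosure := by
      rw [span_fourier_closure_eq_top]; trivial
    have hcl : IsClosed {g | Λ g = 0} := isClosed_eq hΛc continuous_const
    rw [← SetLike.mem_coe, Submodule.topologicalClosure_coe] at hg
    refine closure_minimal (fun x hx => ?_) hcl hg
    have : Submodule.span ℂ (Set.range <| @fourier (2 * Real.pi)) ≤ LinearMap.ker Λ := by
      rw [Submodule.span_le]
      rintro _ ⟨n, rfl⟩
      have := h0 n
      change ∫ t : ℝ, fourier n (t : AddCircle (2 * Real.pi)) * u t ∂freqMeasure = 0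
      rw [← this]
      refine integral_congr_ae (Eventually.of_forall fun t => ?_)
      simp only [fourier_coe_apply]
      congr 2
      have : (Real.pi : ℂ) ≠ 0 := by exact_mod_cast Real.pi_ne_zero
      push_cast
      field_simp
    exact this hx
  -- On the open interval, of full measure, it suffices to test with smooth functions compactly
  -- supported inside. These vanish at both ends and so descend to continuous functions on the
  -- circle.
  have hres : freqMeasure = volume.restrict (Set.Ioo (-Real.pi) Real.pi) :=
    Measure.restrict_congr_set Ioo_ae_eq_Ioc.symm
  have key : ∀ᵐ t, t ∈ Set.Ioo (-Real.pi) Real.pi → u t = 0 := by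
    refine isOpen_Ioo.ae_eq_zero_of_integral_contDiff_smul_eq_zero ?_ ?_
    · have : IntegrableOn u (Set.Ioo (-Real.pi) Real.pi) := by
        rw [IntegrableOn, ← hres]; exact hu
      exact this.locallyIntegrableOn
    · intro g hg hgc hgs
      have hgz : ∀ t, t ∉ Set.Ioo (-Real.pi) Real.pi → g t = 0 := fun t ht =>
        image_eq_zero_of_notMem_tsupport fun h => ht (hgs h)
      let G : C(AddCircle (2 * Real.pi), ℂ) :=
        ⟨AddCircle.liftIco (2 * Real.pi) (-Real.pi) (fun t => (g t : ℂ)), by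
          refine AddCircle.liftIco_continuous ?_ ?_
          · rw [hgz (-Real.pi) (by simp), hgz (-Real.pi + 2 * Real.pi) (by
              simp only [Set.mem_Ioo, not_and, not_lt]; intro; linarith)]
          · exact (Complex.continuous_ofReal.comp hg.continuous).continuousOn⟩
      have := hΛ G
      have h2 : ∫ t, g t • u t = ∫ t in Set.Ioo (-Real.pi) Real.pi, g t • u t := by
        refine (setIntegral_eq_integral_of_forall_compl_eq_zero fun t ht => ?_).symm
        rw [hgz t ht, zero_smul]
      rw [h2, ← hres, ← this]
      change _ = ∫ t : ℝ, G t * u t ∂freqMeasure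
      rw [hres]
      refine setIntegral_congr_fun measurableSet_Ioo fun t ht => ?_
      change _ = AddCircle.liftIco (2 * Real.pi) (-Real.pi) (fun t => (g t : ℂ)) t * u t
      rw [AddCircle.liftIco_coe_apply (by exact ⟨ht.1.le, by linarith [ht.2]⟩)]
      simp
  rw [hres]
  exact (ae_restrict_iff' measurableSet_Ioo).2 key

/-! ### The weighted space `L₂(F)` and approximation by duality. -/

variable {T : ℕ} {F : ℝ → Matrix (Fin T) (Fin T) ℂ} {b c : ℝ → Fin T → ℂ}

/-- A matrix-valued density on `(-π, π]`. -/
structure IsWeight (F : ℝ → Matrix (Fin T) (Fin T) ℂ) : Prop where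
  integrable : ∀ ν μ, Integrable (fun t => F t ν μ) freqMeasure
  posSemidef : ∀ᵐ t ∂freqMeasure, (F t).PosSemidef

theorem sqNorm_eq (F : ℝ → Matrix (Fin T) (Fin T) ℂ) (b : ℝ → Fin T → ℂ) :
    sqNorm F b = ∫ t, (b t ⬝ᵥ (F t *ᵥ star (b t))).re ∂freqMeasure :=
  intervalIntegral_eq_freq _

theorem form_nonneg {F : Matrix (Fin T) (Fin T) ℂ} (hF : F.PosSemidef) (b : Fin T → ℂ) :
    0 ≤ b ⬝ᵥ (F *ᵥ star b) := by
  simpa using hF.dotProduct_mulVec_nonneg (star b)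

theorem sqNorm_nonneg (hF : IsWeight F) (b : ℝ → Fin T → ℂ) : 0 ≤ sqNorm F b := by
  rw [sqNorm_eq]
  refine integral_nonneg_of_ae ?_
  filter_upwards [hF.posSemidef] with t ht
  exact (Complex.le_def.1 (form_nonneg ht (b t))).1

theorem aestronglyMeasurable_of_pi {b : ℝ → Fin T → ℂ}
    (h : ∀ i, AEStronglyMeasurable (fun t => b t i) freqMeasure) :
    AEStronglyMeasurable b freqMeasure :=
  (aemeasurable_pi_iff.2 fun i => (h i).aemeasurable).aestronglyMeasurable

theorem MemL2.integrable_re (hb : MemL2 F b) :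
    Integrable (fun t => (b t ⬝ᵥ (F t *ᵥ star (b t))).re) freqMeasure :=
  hb.2.re

theorem integrable_form (hF : ∀ ν μ, Integrable (fun t => F t ν μ) freqMeasure) {C D : ℝ}
    (hb : AEStronglyMeasurable b freqMeasure) (hc : AEStronglyMeasurable c freqMeasure)
    (hbC : ∀ t, ‖b t‖ ≤ C) (hcD : ∀ t, ‖c t‖ ≤ D) :
    Integrable (fun t => b t ⬝ᵥ (F t *ᵥ star (c t))) freqMeasure := by
  have hb' : ∀ ν, AEStronglyMeasurable (fun t => b t ν) freqMeasure := fun ν =>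
    (continuous_apply ν).comp_aestronglyMeasurable hb
  have hc' : ∀ ν, AEStronglyMeasurable (fun t => c t ν) freqMeasure := fun ν =>
    (continuous_apply ν).comp_aestronglyMeasurable hc
  simp only [dotProduct, Matrix.mulVec]
  refine integrable_finsetSum _ fun ν _ => ?_
  refine Integrable.bdd_mul (c := C) ?_ (hb' ν)
    (Eventually.of_forall fun t => (norm_le_pi_norm _ _).trans (hbC t))
  refine integrable_finsetSum _ fun κ _ => ?_
  refine Integrable.mul_bdd (c := D) (hF ν κ) ?_
    (Eventually.of_forall fun t => ?_)
  · exact continuous_star.comp_aestronglyMeasurable (hc' κ)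
  · rw [Pi.star_apply, norm_star]
    exact (norm_le_pi_norm _ _).trans (hcD t)

theorem memL2_of_bounded (hF : IsWeight F) {C : ℝ}
    (hb : AEStronglyMeasurable b freqMeasure) (hbC : ∀ t, ‖b t‖ ≤ C) : MemL2 F b :=
  ⟨hb, integrable_form hF.integrable hb hb hbC hbC⟩

/-- The Euclidean vector field `t ↦ M(t) b(t)`. -/
noncomputable def emb (M : ℝ → Matrix (Fin T) (Fin T) ℂ) (b : ℝ → Fin T → ℂ) (t : ℝ) :
    EuclideanSpace ℂ (Fin T) :=
  WithLp.toLp 2 (M t *ᵥ b t)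

theorem inner_emb {M : ℝ → Matrix (Fin T) (Fin T) ℂ} {t : ℝ} (w : EuclideanSpace ℂ (Fin T)) :
    inner ℂ w (emb M b t) = star ((M t)ᴴ *ᵥ w.ofLp) ⬝ᵥ b t := by
  rw [EuclideanSpace.inner_eq_star_dotProduct, emb, dotProduct_comm, Matrix.star_mulVec,
    Matrix.conjTranspose_conjTranspose, Matrix.dotProduct_mulVec]

/-- `M` factors the form of `F` in a measurable way. -/
structure IsFactor (F M : ℝ → Matrix (Fin T) (Fin T) ℂ) : Prop where
  meas : ∀ i j, AEStronglyMeasurable (fun t => M t i j) freqMeasure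
  factor : ∀ᵐ t ∂freqMeasure, (M t)ᴴ * M t = (F t)ᵀ

theorem IsWeight.exists_factor (hF : IsWeight F) : ∃ M, IsFactor F M := by
  obtain ⟨M, h1, h2⟩ := exists_factor_of_posSemidef (μ := freqMeasure) (G := fun t => (F t)ᵀ)
    (fun i j => (hF.integrable j i).aestronglyMeasurable)
    (hF.posSemidef.mono fun t ht => ht.transpose)
  exact ⟨M, h1, h2⟩

variable {M : ℝ → Matrix (Fin T) (Fin T) ℂ}

theorem emb_measurable (hM : IsFactor F M) (hb : AEStronglyMeasurable b freqMeasure) :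
    AEStronglyMeasurable (emb M b) freqMeasure := by
  have : AEStronglyMeasurable (fun t => M t *ᵥ b t) freqMeasure := by
    refine aestronglyMeasurable_of_pi fun i => ?_
    simp only [Matrix.mulVec, dotProduct]
    exact Finset.aestronglyMeasurable_fun_sum _ fun j _ =>
      (hM.meas i j).mul ((continuous_apply j).comp_aestronglyMeasurable hb)
  exact (PiLp.continuous_toLp 2 _).comp_aestronglyMeasurable this

/-- The transpose in `IsFactor` is forced: the form `bᵀ F c̄` is linear in its first argument, the
Euclidean inner product in its second. The quantifiers over fields stand inside the
almost-everywhere statement because the exceptional set depends on `F` and `M` only. -/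
theorem IsFactor.inner_eq (hM : IsFactor F M) :
    ∀ᵐ t ∂freqMeasure, ∀ b c : ℝ → Fin T → ℂ,
      inner ℂ (emb M b t) (emb M c t) = c t ⬝ᵥ (F t *ᵥ star (b t)) := by
  filter_upwards [hM.factor] with t ht b c
  rw [inner_emb]
  simp only [emb]
  rw [Matrix.mulVec_mulVec, ht, dotProduct_comm, Matrix.star_mulVec,
    Matrix.conjTranspose, Matrix.transpose_transpose, ← Matrix.mulVec_transpose]
  congr 2
  have h1 : ((F t)ᵀ)ᴴ = (F t)ᵀ := by rw [← ht]; simp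
  exact congrArg Matrix.transpose h1

theorem IsFactor.normSq_eq (hM : IsFactor F M) :
    ∀ᵐ t ∂freqMeasure, ∀ b : ℝ → Fin T → ℂ,
      (b t ⬝ᵥ (F t *ᵥ star (b t))) = ((‖emb M b t‖ ^ 2 : ℝ) : ℂ) := by
  filter_upwards [hM.inner_eq] with t ht b
  rw [← ht b b, inner_self_eq_norm_sq_to_K]
  simp

/-- Through `emb M`, the space `L₂(F)` inherits its linear structure, triangle inequality and
duality from the ordinary `L²` of Euclidean fields. -/
theorem IsFactor.memL2_iff (hM : IsFactor F M) (hb : AEStronglyMeasurable b freqMeasure) :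
    MemL2 F b ↔ MemLp (emb M b) 2 freqMeasure := by
  rw [memLp_two_iff_integrable_sq_norm (emb_measurable hM hb)]
  constructor
  · intro h
    refine h.integrable_re.congr ?_
    filter_upwards [hM.normSq_eq] with t ht
    rw [ht b, Complex.ofReal_re]
  · intro h
    refine ⟨hb, (h.ofReal (𝕜 := ℂ)).congr ?_⟩
    filter_upwards [hM.normSq_eq] with t ht
    rw [ht b]
    simp

theorem IsFactor.sqNorm_eq (hM : IsFactor F M) (b : ℝ → Fin T → ℂ) :
    sqNorm F b = ∫ t, ‖emb M b t‖ ^ 2 ∂freqMeasure := by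
  rw [PCInterp.sqNorm_eq]
  refine integral_congr_ae ?_
  filter_upwards [hM.normSq_eq] with t ht
  rw [ht b, Complex.ofReal_re]

theorem norm_toLp_sq {α E : Type*} [MeasurableSpace α] {μ : Measure α} [NormedAddCommGroup E]
    [InnerProductSpace ℂ E] {x : α → E} (hx : MemLp x 2 μ) :
    ‖hx.toLp x‖ ^ 2 = ∫ t, ‖x t‖ ^ 2 ∂μ := by
  have h := L2.inner_def (𝕜 := ℂ) (hx.toLp x) (hx.toLp x)
  rw [inner_self_eq_norm_sq_to_K] at h
  have h2 : ∫ t, inner ℂ (hx.toLp x t) (hx.toLp x t) ∂μ = ((∫ t, ‖x t‖ ^ 2 ∂μ : ℝ) : ℂ) := by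
    rw [← integral_complex_ofReal]
    refine integral_congr_ae ?_
    filter_upwards [hx.coeFn_toLp] with t ht
    rw [ht, inner_self_eq_norm_sq_to_K]
    simp
  rw [h2] at h
  exact Complex.ofReal_injective (by simpa using h)

theorem IsFactor.sqNorm_eq_norm (hM : IsFactor F M) (hb : MemLp (emb M b) 2 freqMeasure) :
    sqNorm F b = ‖hb.toLp (emb M b)‖ ^ 2 := by
  rw [hM.sqNorm_eq, norm_toLp_sq]

theorem emb_add (M : ℝ → Matrix (Fin T) (Fin T) ℂ) (b c : ℝ → Fin T → ℂ) :
    emb M (fun t => b t + c t) = emb M b + emb M c := by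
  funext t; simp [emb, Matrix.mulVec_add]

theorem emb_sub (M : ℝ → Matrix (Fin T) (Fin T) ℂ) (b c : ℝ → Fin T → ℂ) :
    emb M (fun t => b t - c t) = emb M b - emb M c := by
  funext t; simp [emb, Matrix.mulVec_sub]

theorem emb_smul (M : ℝ → Matrix (Fin T) (Fin T) ℂ) (z : ℂ) (b : ℝ → Fin T → ℂ) :
    emb M (fun t => z • b t) = z • emb M b := by
  funext t; simp [emb, Matrix.mulVec_smul]

theorem MemL2.add (hF : IsWeight F) (hb : MemL2 F b) (hc : MemL2 F c) :
    MemL2 F (fun t => b t + c t) := by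
  obtain ⟨M, hM⟩ := hF.exists_factor
  rw [hM.memL2_iff (b := fun t => b t + c t) (hb.1.add hc.1), emb_add]
  exact ((hM.memL2_iff hb.1).1 hb).add ((hM.memL2_iff hc.1).1 hc)

theorem MemL2.sub (hF : IsWeight F) (hb : MemL2 F b) (hc : MemL2 F c) :
    MemL2 F (fun t => b t - c t) := by
  obtain ⟨M, hM⟩ := hF.exists_factor
  rw [hM.memL2_iff (b := fun t => b t - c t) (hb.1.sub hc.1), emb_sub]
  exact ((hM.memL2_iff hb.1).1 hb).sub ((hM.memL2_iff hc.1).1 hc)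

theorem MemL2.smul (hF : IsWeight F) (z : ℂ) (hb : MemL2 F b) :
    MemL2 F (fun t => z • b t) := by
  obtain ⟨M, hM⟩ := hF.exists_factor
  rw [hM.memL2_iff (b := fun t => z • b t) (hb.1.const_smul z), emb_smul]
  exact ((hM.memL2_iff hb.1).1 hb).const_smul z

theorem sqrt_sqNorm_add_le (hF : IsWeight F) (hb : MemL2 F b) (hc : MemL2 F c) :
    √(sqNorm F fun t => b t + c t) ≤ √(sqNorm F b) + √(sqNorm F c) := by
  obtain ⟨M, hM⟩ := hF.exists_factor
  have hb' := (hM.memL2_iff hb.1).1 hb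
  have hc' := (hM.memL2_iff hc.1).1 hc
  have hbc : MemLp (emb M fun t => b t + c t) 2 freqMeasure := by
    rw [emb_add]; exact hb'.add hc'
  rw [hM.sqNorm_eq_norm hb', hM.sqNorm_eq_norm hc', hM.sqNorm_eq_norm hbc,
    Real.sqrt_sq (norm_nonneg _), Real.sqrt_sq (norm_nonneg _), Real.sqrt_sq (norm_nonneg _)]
  have : hbc.toLp _ = hb'.toLp _ + hc'.toLp _ := by
    rw [← MemLp.toLp_add]
    exact MemLp.toLp_congr _ _ (by rw [emb_add])
  rw [this]
  exact norm_add_le _ _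

theorem sqNorm_smul (F : ℝ → Matrix (Fin T) (Fin T) ℂ) (z : ℂ) (b : ℝ → Fin T → ℂ) :
    sqNorm F (fun t => z • b t) = ‖z‖ ^ 2 * sqNorm F b := by
  rw [sqNorm_eq, sqNorm_eq, ← integral_const_mul]
  refine integral_congr_ae (Eventually.of_forall fun t => ?_)
  simp only [star_smul, Matrix.mulVec_smul, smul_dotProduct, dotProduct_smul, smul_smul]
  have : star z * z = ((‖z‖ ^ 2 : ℝ) : ℂ) := by
    rw [mul_comm]; simpa using Complex.mul_conj' z
  rw [smul_eq_mul, this, Complex.re_ofReal_mul]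

theorem sqNorm_zero (F : ℝ → Matrix (Fin T) (Fin T) ℂ) : sqNorm F (fun _ => 0) = 0 := by
  simp [sqNorm_eq]

theorem sqNorm_sub_comm (F : ℝ → Matrix (Fin T) (Fin T) ℂ) (b c : ℝ → Fin T → ℂ) :
    sqNorm F (fun t => b t - c t) = sqNorm F (fun t => c t - b t) := by
  have := sqNorm_smul F (-1) (fun t => c t - b t)
  simpa using this

/-- Approximation by duality: `b` lies in the closure of the range of `ι` in `L₂(F)` if it is
annihilated by every integrable field that annihilates this range. -/
theorem exists_sqNorm_sub_lt {V : Type*} [AddCommGroup V] [Module ℂ V] (hF : IsWeight F)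
    (ι : V →ₗ[ℂ] (ℝ → Fin T → ℂ)) (hι : ∀ v, MemL2 F (ι v)) (hb : MemL2 F b)
    (h : ∀ u : ℝ → Fin T → ℂ, (∀ ν, Integrable (fun t => u t ν) freqMeasure) →
      Integrable (fun t => star (u t) ⬝ᵥ b t) freqMeasure →
      (∀ v, ∫ t, star (u t) ⬝ᵥ ι v t ∂freqMeasure = 0) →
      ∫ t, star (u t) ⬝ᵥ b t ∂freqMeasure = 0) {ε : ℝ} (hε : 0 < ε) :
    ∃ v, sqNorm F (fun t => b t - ι v t) < ε := by
  obtain ⟨M, hM⟩ := hF.exists_factor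
  have hι' := fun v => (hM.memL2_iff (hι v).1).1 (hι v)
  have hb' := (hM.memL2_iff hb.1).1 hb
  let J : V →ₗ[ℂ] Lp (EuclideanSpace ℂ (Fin T)) 2 freqMeasure :=
    { toFun := fun v => (hι' v).toLp _
      map_add' := fun v w => by
        rw [← MemLp.toLp_add]
        refine MemLp.toLp_congr _ _ (Eventually.of_forall fun t => ?_)
        rw [map_add]
        exact congrFun (emb_add M _ _) t
      map_smul' := fun z v => by
        rw [RingHom.id_apply, ← MemLp.toLp_const_smul]
        refine MemLp.toLp_congr _ _ (Eventually.of_forall fun t => ?_)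
        rw [map_smul]
        exact congrFun (emb_smul M z _) t }
  -- The closure of the range is its double orthogonal complement. A vector `w` orthogonal to the
  -- range acts on fields through `u = Mᴴ w`, which is the annihilator handed to `h`.
  have hmem : hb'.toLp _ ∈ (LinearMap.range J).topologicalClosure := by
    rw [← Submodule.orthogonal_orthogonal_eq_closure, Submodule.mem_orthogonal]
    intro w hw
    rw [Submodule.mem_orthogonal'] at hw
    have hww : MemLp w 2 freqMeasure := Lp.memLp w
    have hin : ∀ {c : ℝ → Fin T → ℂ}, (hc : MemLp (emb M c) 2 freqMeasure) →
        inner ℂ w (hc.toLp _) = ∫ t, star ((M t)ᴴ *ᵥ (w t).ofLp) ⬝ᵥ c t ∂freqMeasure := by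
      intro c hc
      rw [L2.inner_def]
      refine integral_congr_ae ?_
      filter_upwards [hc.coeFn_toLp] with t ht
      rw [ht, inner_emb]
    have hinI : ∀ {c : ℝ → Fin T → ℂ}, MemLp (emb M c) 2 freqMeasure →
        Integrable (fun t => star ((M t)ᴴ *ᵥ (w t).ofLp) ⬝ᵥ c t) freqMeasure := by
      intro c hc
      refine (L2.integrable_inner (𝕜 := ℂ) w (hc.toLp _)).congr ?_
      filter_upwards [hc.coeFn_toLp] with t ht
      rw [ht, inner_emb]
    rw [hin]
    refine h (fun t => (M t)ᴴ *ᵥ (w t).ofLp) (fun ν => ?_) (hinI hb') (fun v => ?_)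
    -- Constant fields lie in `L₂(F)` because `F` is integrable; pairing `w` with the image of `δ_ν`
    -- shows that the coordinate `u_ν` is integrable.
    · have h1 : MemL2 F (fun _ => Pi.single ν 1) :=
        memL2_of_bounded hF aestronglyMeasurable_const (fun t => le_rfl)
      have h2 := hinI ((hM.memL2_iff h1.1).1 h1)
      have h3 := (ContinuousLinearMap.integrable_comp
        (Complex.conjCLE : ℂ →L[ℝ] ℂ) h2)
      refine h3.congr (Eventually.of_forall fun t => ?_)
      simp
    · rw [← hin (hι' v)]
      exact hw _ ⟨v, rfl⟩
  rw [← SetLike.mem_coe, Submodule.topologicalClosure_coe, Metric.mem_closure_iff] at hmem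
  obtain ⟨_, ⟨v, rfl⟩, hv⟩ := hmem (√ε) (Real.sqrt_pos.2 hε)
  refine ⟨v, ?_⟩
  have hs : MemLp (emb M fun t => b t - ι v t) 2 freqMeasure := by
    rw [emb_sub]; exact hb'.sub (hι' v)
  rw [hM.sqNorm_eq_norm hs]
  have : hs.toLp _ = hb'.toLp _ - J v := by
    change _ = hb'.toLp _ - (hι' v).toLp _
    rw [← MemLp.toLp_sub]
    exact MemLp.toLp_congr _ _ (by rw [emb_sub])
  rw [this, ← dist_eq_norm]
  calc _ < √ε ^ 2 := by gcongr
    _ = ε := Real.sq_sqrt hε.le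

theorem IsWeight.add {f g : ℝ → Matrix (Fin T) (Fin T) ℂ} (hf : IsWeight f) (hg : IsWeight g) :
    IsWeight (fun t => f t + g t) :=
  ⟨fun ν μ => (hf.integrable ν μ).add (hg.integrable ν μ), by
    filter_upwards [hf.posSemidef, hg.posSemidef] with t h1 h2 using h1.add h2⟩

theorem MemL2.of_add_left {f g : ℝ → Matrix (Fin T) (Fin T) ℂ} (hf : IsWeight f)
    (hg : IsWeight g) (hb : MemL2 (fun t => f t + g t) b) : MemL2 f b := by
  obtain ⟨M, hM⟩ := hf.exists_factor
  refine ⟨hb.1, Integrable.mono' hb.2.norm ?_ ?_⟩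
  -- Measurability of the `f`-form is not part of the hypothesis on `f + g`; it is read off from the
  -- factorization.
  · have h := (emb_measurable hM hb.1).norm.pow 2
    refine (Complex.continuous_ofReal.comp_aestronglyMeasurable h).congr ?_
    filter_upwards [hM.normSq_eq] with t ht
    rw [ht b]; rfl
  · filter_upwards [hf.posSemidef, hg.posSemidef] with t h1 h2
    simp only [Matrix.add_mulVec, dotProduct_add]
    have e1 := form_nonneg h1 (b t)
    have e2 := form_nonneg h2 (b t)
    have h3 : ((‖b t ⬝ᵥ f t *ᵥ star (b t)‖ : ℝ) : ℂ) ≤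
        (‖b t ⬝ᵥ f t *ᵥ star (b t) + b t ⬝ᵥ g t *ᵥ star (b t)‖ : ℝ) := by
      rw [Complex.norm_of_nonneg' e1, Complex.norm_of_nonneg' (add_nonneg e1 e2)]
      exact le_add_of_nonneg_right e2
    exact_mod_cast h3

theorem MemL2.of_add_right {f g : ℝ → Matrix (Fin T) (Fin T) ℂ} (hf : IsWeight f)
    (hg : IsWeight g) (hb : MemL2 (fun t => f t + g t) b) : MemL2 g b :=
  MemL2.of_add_left (f := g) (g := f) hg hf (by simpa only [add_comm] using hb)

theorem sqNorm_add {f g : ℝ → Matrix (Fin T) (Fin T) ℂ} (hf : MemL2 f b) (hg : MemL2 g b) :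
    sqNorm (fun t => f t + g t) b = sqNorm f b + sqNorm g b := by
  rw [sqNorm_eq, sqNorm_eq, sqNorm_eq, ← integral_add hf.integrable_re hg.integrable_re]
  simp [Matrix.add_mulVec, dotProduct_add]

theorem form_conj_symm {n : Type*} [Fintype n] {F : Matrix n n ℂ} (hF : F.IsHermitian)
    (b c : n → ℂ) : c ⬝ᵥ (F *ᵥ star b) = star (b ⬝ᵥ (F *ᵥ star c)) := by
  rw [← Matrix.star_dotProduct_star, Matrix.star_mulVec, hF.eq, star_star,
    Matrix.dotProduct_mulVec]

/-! ### Continuous extension of isometries. -/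

section IsometricLimit

variable {T : ℕ} {F : ℝ → Matrix (Fin T) (Fin T) ℂ} {b c : ℝ → Fin T → ℂ}
  {V : Type*} [AddCommGroup V] [Module ℂ V]
  {K : Type*} [NormedAddCommGroup K] [InnerProductSpace ℂ K]
  {ι : V →ₗ[ℂ] (ℝ → Fin T → ℂ)} {I : V →ₗ[ℂ] K} {X Y : K}

/-- `I` is, up to the factor `(2π)^{-1/2}`, isometric for the seminorm that `ι` induces from
`L₂(F)`. -/
structure IsIsometric (F : ℝ → Matrix (Fin T) (Fin T) ℂ) (ι : V →ₗ[ℂ] (ℝ → Fin T → ℂ))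
    (I : V →ₗ[ℂ] K) : Prop where
  memL2 : ∀ v, MemL2 F (ι v)
  norm_sq : ∀ v, ‖I v‖ ^ 2 = 1 / (2 * Real.pi) * sqNorm F (ι v)

/-- `Y` is the value at `b` of the continuous extension of `I` along `ι`. -/
def HasExtension (F : ℝ → Matrix (Fin T) (Fin T) ℂ) (ι : V →ₗ[ℂ] (ℝ → Fin T → ℂ))
    (I : V →ₗ[ℂ] K) (b : ℝ → Fin T → ℂ) (Y : K) : Prop :=
  MemL2 F b ∧ ∃ v : ℕ → V, Tendsto (fun n => sqNorm F (fun t => b t - ι (v n) t)) atTop (𝓝 0) ∧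
    Tendsto (fun n => I (v n)) atTop (𝓝 Y)

theorem tendsto_sqNorm_add (hF : IsWeight F) {x y : ℕ → ℝ → Fin T → ℂ}
    (hx : ∀ n, MemL2 F (x n)) (hy : ∀ n, MemL2 F (y n))
    (hx0 : Tendsto (fun n => sqNorm F (x n)) atTop (𝓝 0))
    (hy0 : Tendsto (fun n => sqNorm F (y n)) atTop (𝓝 0)) :
    Tendsto (fun n => sqNorm F (fun t => x n t + y n t)) atTop (𝓝 0) := by
  have h := (hx0.sqrt.add hy0.sqrt).pow 2
  rw [Real.sqrt_zero, add_zero, zero_pow two_ne_zero] at h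
  refine squeeze_zero (fun n => sqNorm_nonneg hF _) (fun n => ?_) h
  rw [← Real.sqrt_le_left (by positivity)]
  exact sqrt_sqNorm_add_le hF (hx n) (hy n)

theorem tendsto_sqNorm (hF : IsWeight F) (hb : MemL2 F b) {x : ℕ → ℝ → Fin T → ℂ}
    (hx : ∀ n, MemL2 F (x n))
    (h : Tendsto (fun n => sqNorm F (fun t => b t - x n t)) atTop (𝓝 0)) :
    Tendsto (fun n => sqNorm F (x n)) atTop (𝓝 (sqNorm F b)) := by
  have h0 := h.sqrt
  rw [Real.sqrt_zero] at h0
  have h1 : Tendsto (fun n => √(sqNorm F (x n))) atTop (𝓝 (√(sqNorm F b))) := by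
    rw [tendsto_iff_dist_tendsto_zero]
    refine squeeze_zero (fun n => dist_nonneg) (fun n => ?_) h0
    rw [Real.dist_eq, abs_sub_le_iff]
    constructor
    · have := sqrt_sqNorm_add_le hF (b := fun t => x n t - b t) (MemL2.sub hF (hx n) hb) hb
      simp only [sub_add_cancel] at this
      rw [sqNorm_sub_comm F (x n) b] at this
      linarith
    · have := sqrt_sqNorm_add_le hF (b := fun t => b t - x n t) (MemL2.sub hF hb (hx n)) (hx n)
      simp only [sub_add_cancel] at this
      linarith
  have h2 := h1.pow 2
  simpa only [Real.sq_sqrt (sqNorm_nonneg hF _)] using h2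

theorem HasExtension.of_apply (hI : IsIsometric F ι I) (v : V) :
    HasExtension F ι I (ι v) (I v) :=
  ⟨hI.memL2 v, fun _ => v, by simp [sqNorm_zero], tendsto_const_nhds⟩

theorem HasExtension.add (hF : IsWeight F) (hI : IsIsometric F ι I)
    (hX : HasExtension F ι I b X) (hY : HasExtension F ι I c Y) :
    HasExtension F ι I (fun t => b t + c t) (X + Y) := by
  obtain ⟨hb, v, hv, hv'⟩ := hX
  obtain ⟨hc, w, hw, hw'⟩ := hY
  refine ⟨MemL2.add hF hb hc, fun n => v n + w n, ?_, ?_⟩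
  · have := tendsto_sqNorm_add hF (fun n => MemL2.sub hF hb (hI.memL2 (v n)))
      (fun n => MemL2.sub hF hc (hI.memL2 (w n))) hv hw
    refine this.congr fun n => ?_
    congr 1
    funext t
    ext i
    simp only [map_add, Pi.add_apply, Pi.sub_apply]
    ring
  · simpa only [map_add] using hv'.add hw'

theorem HasExtension.smul (hF : IsWeight F) (hX : HasExtension F ι I b X) (z : ℂ) :
    HasExtension F ι I (fun t => z • b t) (z • X) := by
  obtain ⟨hb, v, hv, hv'⟩ := hX
  refine ⟨MemL2.smul hF z hb, fun n => z • v n, ?_, ?_⟩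
  · have := hv.const_mul (‖z‖ ^ 2)
    rw [mul_zero] at this
    refine this.congr fun n => ?_
    rw [← sqNorm_smul]
    congr 1
    funext t
    rw [map_smul, Pi.smul_apply, smul_sub]
  · simpa only [map_smul] using hv'.const_smul z

theorem HasExtension.sub (hF : IsWeight F) (hI : IsIsometric F ι I)
    (hX : HasExtension F ι I b X) (hY : HasExtension F ι I c Y) :
    HasExtension F ι I (fun t => b t - c t) (X - Y) := by
  simpa [sub_eq_add_neg] using hX.add hF hI (hY.smul hF (-1))

theorem HasExtension.sum (hF : IsWeight F) (hI : IsIsometric F ι I) {J : Type*} (s : Finset J)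
    {x : J → ℝ → Fin T → ℂ} {y : J → K} (h : ∀ j ∈ s, HasExtension F ι I (x j) (y j)) :
    HasExtension F ι I (fun t => ∑ j ∈ s, x j t) (∑ j ∈ s, y j) := by
  classical
  induction s using Finset.induction_on with
  | empty =>
    have := HasExtension.of_apply hI 0
    simpa [Pi.zero_def] using this
  | insert j s hj ih =>
    simp only [Finset.sum_insert hj]
    exact (h j (Finset.mem_insert_self j s)).add hF hI
      (ih fun i hi => h i (Finset.mem_insert_of_mem hi))

theorem HasExtension.norm_sq (hF : IsWeight F) (hI : IsIsometric F ι I)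
    (hX : HasExtension F ι I b X) : ‖X‖ ^ 2 = 1 / (2 * Real.pi) * sqNorm F b := by
  obtain ⟨hb, v, hv, hv'⟩ := hX
  have h1 := (tendsto_sqNorm hF hb (fun n => hI.memL2 (v n)) hv).const_mul (1 / (2 * Real.pi))
  simp only [← hI.norm_sq] at h1
  exact tendsto_nhds_unique (hv'.norm.pow 2) h1

/-- Isometry makes the extension insensitive to the type of approximant: any fields in its domain
that converge in `L₂(F)` will do. This is what allows passing between simple functions and
trigonometric polynomials. -/
theorem HasExtension.tendsto (hF : IsWeight F) (hI : IsIsometric F ι I)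
    (hX : HasExtension F ι I b X) {x : ℕ → ℝ → Fin T → ℂ} {y : ℕ → K}
    (h : ∀ n, HasExtension F ι I (x n) (y n))
    (hx : Tendsto (fun n => sqNorm F (fun t => b t - x n t)) atTop (𝓝 0)) :
    Tendsto y atTop (𝓝 X) := by
  have h1 := (hx.const_mul (1 / (2 * Real.pi))).sqrt
  rw [mul_zero, Real.sqrt_zero] at h1
  rw [tendsto_iff_norm_sub_tendsto_zero]
  refine h1.congr fun n => ?_
  rw [← (hX.sub hF hI (h n)).norm_sq hF hI, Real.sqrt_sq (norm_nonneg _), norm_sub_rev]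

theorem HasExtension.exists [CompleteSpace K] (hF : IsWeight F) (hI : IsIsometric F ι I)
    (hb : MemL2 F b) (h : ∀ ε > 0, ∃ v, sqNorm F (fun t => b t - ι v t) < ε) :
    ∃ Y, HasExtension F ι I b Y := by
  choose v hv using fun n : ℕ => h (1 / ((n : ℝ) + 1)) Nat.one_div_pos_of_nat
  have hv0 : Tendsto (fun n => sqNorm F (fun t => b t - ι (v n) t)) atTop (𝓝 0) :=
    squeeze_zero (fun n => sqNorm_nonneg hF _) (fun n => (hv n).le)
      tendsto_one_div_add_atTop_nhds_zero_nat
  have hs := hv0.sqrt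
  rw [Real.sqrt_zero] at hs
  have hC : CauchySeq fun n => I (v n) := by
    -- Two approximants are compared through `b`: the isometry turns the distance of their images
    -- into a distance in `L₂(F)`, and the triangle inequality splits it at `b`.
    have hd : ∀ n m, dist (I (v n)) (I (v m)) ≤ √(1 / (2 * Real.pi)) *
        (√(sqNorm F (fun t => b t - ι (v n) t)) + √(sqNorm F (fun t => b t - ι (v m) t))) := by
      intro n m
      rw [dist_eq_norm, ← map_sub, ← Real.sqrt_sq (norm_nonneg (I (v n - v m))), hI.norm_sq,
        Real.sqrt_mul (by positivity)]
      gcongr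
      have := sqrt_sqNorm_add_le hF (MemL2.sub hF (hI.memL2 (v n)) hb)
        (MemL2.sub hF hb (hI.memL2 (v m)))
      rw [sqNorm_sub_comm F b (ι (v n))]
      simp only [sub_add_sub_cancel] at this
      simpa [map_sub, Pi.sub_def] using this
    rw [Metric.cauchySeq_iff']
    intro ε hε
    have h2 := (hs.const_mul (√(1 / (2 * Real.pi))))
    rw [mul_zero] at h2
    obtain ⟨N, hN⟩ := ((tendsto_order.1 h2).2 (ε / 2) (by positivity)).exists_forall_of_atTop
    refine ⟨N, fun n hn => (hd n N).trans_lt ?_⟩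
    rw [mul_add]
    linarith [hN n hn, hN N le_rfl]
  obtain ⟨Y, hY⟩ := cauchySeq_tendsto_of_complete hC
  exact ⟨Y, hb, v, hv0, hY⟩

theorem integrable_cross (hF : IsWeight F) (hb : MemL2 F b) (hc : MemL2 F c) :
    Integrable (fun t => b t ⬝ᵥ (F t *ᵥ star (c t))) freqMeasure := by
  obtain ⟨M, hM⟩ := hF.exists_factor
  have hb' := (hM.memL2_iff hb.1).1 hb
  have hc' := (hM.memL2_iff hc.1).1 hc
  refine (L2.integrable_inner (𝕜 := ℂ) (hc'.toLp _) (hb'.toLp _)).congr ?_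
  filter_upwards [hb'.coeFn_toLp, hc'.coeFn_toLp, hM.inner_eq] with t h1 h2 h3
  rw [h1, h2, h3]

/-- Polarization of the norm identity: sums and differences give the real part. -/
theorem HasExtension.inner_eq (hF : IsWeight F) (hI : IsIsometric F ι I)
    (hX : HasExtension F ι I b X) (hY : HasExtension F ι I c Y) :
    inner ℂ Y X =
      (1 / (2 * Real.pi) : ℂ) * ∫ t, b t ⬝ᵥ (F t *ᵥ star (c t)) ∂freqMeasure := by
  have hre : ∀ {b c : ℝ → Fin T → ℂ} {X Y : K}, HasExtension F ι I b X →
      HasExtension F ι I c Y → (inner ℂ Y X).re =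
        1 / (2 * Real.pi) * (∫ t, b t ⬝ᵥ (F t *ᵥ star (c t)) ∂freqMeasure).re := by
    intro b c X Y hX hY
    have h1 := (hX.add hF hI hY).norm_sq hF hI
    have h2 := (hX.sub hF hI hY).norm_sq hF hI
    have h3 := @norm_add_sq ℂ _ _ _ _ X Y
    have h4 := @norm_sub_sq ℂ _ _ _ _ X Y
    have h5 : sqNorm F (fun t => b t + c t) - sqNorm F (fun t => b t - c t) =
        4 * (∫ t, b t ⬝ᵥ (F t *ᵥ star (c t)) ∂freqMeasure).re := by
      have e := integral_re (integrable_cross hF hX.1 hY.1)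
      change _ = (∫ t, b t ⬝ᵥ (F t *ᵥ star (c t)) ∂freqMeasure).re at e
      rw [sqNorm_eq, sqNorm_eq, ← integral_sub
        (MemL2.add hF hX.1 hY.1).integrable_re (MemL2.sub hF hX.1 hY.1).integrable_re,
        ← e, ← integral_const_mul]
      refine integral_congr_ae ?_
      filter_upwards [hF.posSemidef] with t ht
      have hs := form_conj_symm ht.isHermitian (b t) (c t)
      simp only [star_add, star_sub, Matrix.mulVec_add, Matrix.mulVec_sub, dotProduct_add,
        dotProduct_sub, add_dotProduct, sub_dotProduct, hs]
      simp
      ring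
    have h6 : RCLike.re (inner ℂ X Y) = (inner ℂ Y X).re := inner_re_symm (𝕜 := ℂ) X Y
    rw [h6] at h3 h4
    rw [h1] at h3
    rw [h2] at h4
    linear_combination (1/4 : ℝ) * h4 - (1/4 : ℝ) * h3 + (1 / (2 * Real.pi) / 4) * h5
  apply Complex.ext
  · rw [hre hX hY]
    simp
  -- Multiplying `X` by `-i` turns the imaginary part of the inner product into a real part.
  · have := hre (hX.smul hF (-Complex.I)) hY
    simp only [inner_smul_right, smul_dotProduct, smul_eq_mul, integral_const_mul] at this
    simpa using this

end IsometricLimit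

/-! ### Gram matrices and norms of linear combinations. -/

section Gram

variable {T : ℕ} {F : ℝ → Matrix (Fin T) (Fin T) ℂ}
  {K : Type*} [NormedAddCommGroup K] [InnerProductSpace ℂ K]

theorem MemL2.sum (hF : IsWeight F) {J : Type*} (s : Finset J) {x : J → ℝ → Fin T → ℂ}
    (h : ∀ j ∈ s, MemL2 F (x j)) : MemL2 F (fun t => ∑ j ∈ s, x j t) := by
  classical
  induction s using Finset.induction_on with
  | empty =>
    simpa using memL2_of_bounded hF (b := fun _ => 0) (C := 0) aestronglyMeasurable_const (by simp)
  | insert j s hj ih =>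
    simp only [Finset.sum_insert hj]
    exact (h j (Finset.mem_insert_self j s)).add hF
      (ih fun i hi => h i (Finset.mem_insert_of_mem hi))

/-- Equality of Gram matrices gives equality of norms of linear combinations. -/
theorem norm_sq_sum_eq (hF : IsWeight F) {J : Type*} (s : Finset J) (z : J → ℂ)
    {x : J → ℝ → Fin T → ℂ} {e : J → K} (hx : ∀ j ∈ s, MemL2 F (x j))
    (h : ∀ j ∈ s, ∀ k ∈ s, inner ℂ (e k) (e j) =
      (1 / (2 * Real.pi) : ℂ) * ∫ t, x j t ⬝ᵥ (F t *ᵥ star (x k t)) ∂freqMeasure) :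
    ‖∑ j ∈ s, z j • e j‖ ^ 2 =
      1 / (2 * Real.pi) * sqNorm F (fun t => ∑ j ∈ s, z j • x j t) := by
  have h1 : sqNorm F (fun t => ∑ j ∈ s, z j • x j t) =
      (∑ j ∈ s, ∑ k ∈ s, z j * star (z k) *
        ∫ t, x j t ⬝ᵥ (F t *ᵥ star (x k t)) ∂freqMeasure).re := by
    have hm := MemL2.sum hF s (x := fun j t => z j • x j t) fun j hj => (hx j hj).smul hF (z j)
    have e0 : ∀ j ∈ s, ∀ k ∈ s, Integrable
        (fun t => z j * star (z k) * (x j t ⬝ᵥ (F t *ᵥ star (x k t)))) freqMeasure :=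
      fun j hj k hk => (integrable_cross hF (hx j hj) (hx k hk)).const_mul _
    rw [sqNorm_eq]
    have e1 := integral_re hm.2
    change ∫ t, (_ : ℂ).re ∂freqMeasure = (_ : ℂ).re at e1
    rw [e1]
    congr 1
    calc _ = ∫ t, ∑ j ∈ s, ∑ k ∈ s,
          z j * star (z k) * (x j t ⬝ᵥ (F t *ᵥ star (x k t))) ∂freqMeasure := by
          refine integral_congr_ae (Eventually.of_forall fun t => ?_)
          simp only [star_sum, star_smul, Matrix.mulVec_sum, Matrix.mulVec_smul, sum_dotProduct,
            dotProduct_sum, smul_dotProduct, dotProduct_smul, smul_eq_mul]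
          simp only [Finset.mul_sum]
          rw [Finset.sum_comm]
          refine Finset.sum_congr rfl fun j _ => Finset.sum_congr rfl fun k _ => ?_
          ring
      _ = _ := by
          rw [integral_finsetSum _ fun j hj => integrable_finsetSum _ fun k hk => e0 j hj k hk]
          refine Finset.sum_congr rfl fun j hj => ?_
          rw [integral_finsetSum _ fun k hk => e0 j hj k hk]
          refine Finset.sum_congr rfl fun k hk => ?_
          rw [integral_const_mul]
  have h2 : ((‖∑ j ∈ s, z j • e j‖ ^ 2 : ℝ) : ℂ) = (1 / (2 * Real.pi) : ℂ) *
      ∑ j ∈ s, ∑ k ∈ s, z j * star (z k) *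
        ∫ t, x j t ⬝ᵥ (F t *ᵥ star (x k t)) ∂freqMeasure := by
    have e1 := inner_self_eq_norm_sq_to_K (𝕜 := ℂ) (∑ j ∈ s, z j • e j)
    rw [Complex.ofReal_pow]
    refine e1.symm.trans ?_
    rw [inner_sum, Finset.mul_sum]
    refine Finset.sum_congr rfl fun j hj => ?_
    rw [sum_inner, Finset.mul_sum]
    refine Finset.sum_congr rfl fun k hk => ?_
    rw [inner_smul_left, inner_smul_right, h j hj k hk]
    simp only [starRingEnd_apply]
    ring
  rw [h1]
  have h3 := congrArg Complex.re h2
  rw [Complex.ofReal_re] at h3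
  rw [h3]
  have : (1 / (2 * Real.pi) : ℂ) = ((1 / (2 * Real.pi) : ℝ) : ℂ) := by push_cast; rfl
  rw [this, Complex.re_ofReal_mul]

end Gram

/-! ### Integrals of simple functions against random measures. -/

section Simple

variable {T : ℕ} {F : ℝ → Matrix (Fin T) (Fin T) ℂ} {b : ℝ → Fin T → ℂ}

/-- Simple functions as functions. -/
noncomputable def simpleCoe (T : ℕ) : SimpleFunc ℝ (Fin T → ℂ) →ₗ[ℂ] (ℝ → Fin T → ℂ) where
  toFun φ := φ
  map_add' _ _ := rfl
  map_smul' _ _ := rfl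

@[simp]
theorem simpleCoe_apply {T : ℕ} (φ : SimpleFunc ℝ (Fin T → ℂ)) : simpleCoe T φ = φ := rfl

theorem memL2_simple (hF : IsWeight F) (φ : SimpleFunc ℝ (Fin T → ℂ)) : MemL2 F φ := by
  obtain ⟨C, hC⟩ := φ.exists_forall_norm_le
  exact memL2_of_bounded hF φ.aestronglyMeasurable hC

/-- By duality: a field that annihilates all `1_Δ δ_ν` has every coordinate of integral zero over
every measurable set, hence is zero almost everywhere. -/
theorem exists_simple_sqNorm_sub_lt (hF : IsWeight F) (hb : MemL2 F b) {ε : ℝ} (hε : 0 < ε) :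
    ∃ φ, sqNorm F (fun t => b t - simpleCoe T φ t) < ε := by
  refine exists_sqNorm_sub_lt hF (simpleCoe T) (memL2_simple hF) hb (fun u hu _ h => ?_) hε
  have hz : ∀ ν, (fun t => u t ν) =ᵐ[freqMeasure] 0 := by
    intro ν
    refine (hu ν).ae_eq_zero_of_forall_setIntegral_eq_zero fun Δ hΔ _ => ?_
    have h1 := h (SimpleFunc.piecewise Δ hΔ (SimpleFunc.const ℝ (Pi.single ν 1)) 0)
    rw [← integral_indicator hΔ, ← star_eq_zero, ← h1, ← starRingEnd_apply, ← integral_conj]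
    refine integral_congr_ae (Eventually.of_forall fun t => ?_)
    by_cases ht : t ∈ Δ <;> simp [ht]
  rw [← integral_zero ℝ ℂ (μ := freqMeasure)]
  refine integral_congr_ae ?_
  filter_upwards [ae_all_iff.2 hz] with t ht
  have : u t = 0 := funext ht
  simp [this]

variable {Ω : Type*} [MeasurableSpace Ω] {P : Measure Ω}
  {Z : Fin T → VectorMeasure ℝ (Lp ℂ 2 P)}

/-- The integral of simple functions as a linear map. -/
noncomputable def simpleIntegralₗ (Z : Fin T → VectorMeasure ℝ (Lp ℂ 2 P)) :
    SimpleFunc ℝ (Fin T → ℂ) →ₗ[ℂ] Lp ℂ 2 P :=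
  let τ : Set ℝ → (Fin T → ℂ) →L[ℝ] Lp ℂ 2 P := fun Δ =>
    ∑ ν, ((ContinuousLinearMap.proj (R := ℂ) ν).smulRight (Z ν Δ)).restrictScalars ℝ
  -- Additivity over a common refinement of two simple functions is taken from
  -- `SimpleFunc.setToSimpleFunc`. For the zero measure every simple function is integrable, so no
  -- finiteness condition arises.
  have hτ : FinMeasAdditive (0 : Measure ℝ) τ := fun s t hs ht _ _ hd => by
    ext1 v
    simp [τ, sum_apply, VectorMeasure.of_union hd hs ht,
      Finset.sum_add_distrib]
  { toFun := fun φ => simpleIntegral Z φ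
    map_add' := fun φ ψ => by
      have := SimpleFunc.setToSimpleFunc_add τ hτ (f := φ) (g := ψ) integrable_zero_measure
        integrable_zero_measure
      simpa [SimpleFunc.setToSimpleFunc, simpleIntegral, τ, sum_apply] using this
    map_smul' := fun z φ => by
      have := SimpleFunc.setToSimpleFunc_smul τ hτ (fun c s x => by
        simp [τ, sum_apply, Finset.smul_sum, smul_smul]) z (f := φ)
        integrable_zero_measure
      simpa [SimpleFunc.setToSimpleFunc, simpleIntegral, τ, sum_apply]
        using this }

theorem hasStochIntegral_iff {Y : Lp ℂ 2 P} :
    HasStochIntegral Z F b Y ↔ HasExtension F (simpleCoe T) (simpleIntegralₗ Z) b Y := Iff.rfl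

theorem simpleFunc_eq_sum (φ : SimpleFunc ℝ (Fin T → ℂ)) (t : ℝ) :
    φ t = ∑ v ∈ φ.range, ∑ ν, v ν • (φ ⁻¹' {v}).indicator (fun _ => Pi.single ν 1) t := by
  rw [Finset.sum_eq_single_of_mem (φ t) (SimpleFunc.mem_range_self φ t)]
  · ext i
    simp [Set.indicator, Pi.single_apply]
  · intro v _ hv
    refine Finset.sum_eq_zero fun ν _ => ?_
    rw [Set.indicator_of_notMem, smul_zero]
    simpa using hv.symm

theorem memL2_indicator (hF : IsWeight F) {Δ : Set ℝ} (hΔ : MeasurableSet Δ) (ν : Fin T) :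
    MemL2 F (Δ.indicator fun _ => Pi.single ν 1) := by
  refine memL2_of_bounded hF (C := ‖(Pi.single ν 1 : Fin T → ℂ)‖)
    (aestronglyMeasurable_const.indicator hΔ) fun t => ?_
  exact norm_indicator_le_norm_self _ _

theorem integral_indicator_form (F : ℝ → Matrix (Fin T) (Fin T) ℂ) {Δ₁ Δ₂ : Set ℝ}
    (h₁ : MeasurableSet Δ₁) (h₂ : MeasurableSet Δ₂) (ν μ : Fin T) :
    ∫ t, (Δ₁.indicator (fun _ => Pi.single ν 1) t : Fin T → ℂ) ⬝ᵥ
      (F t *ᵥ star (Δ₂.indicator (fun _ => Pi.single μ 1) t)) ∂freqMeasure =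
    ∫ t in Δ₁ ∩ Δ₂ ∩ Set.Ioc (-Real.pi) Real.pi, F t ν μ := by
  rw [← Measure.restrict_restrict (h₁.inter h₂), ← integral_indicator (h₁.inter h₂)]
  refine integral_congr_ae (Eventually.of_forall fun t => ?_)
  by_cases a₁ : t ∈ Δ₁ <;> by_cases a₂ : t ∈ Δ₂ <;> simp [a₁, a₂]

/-- The inner product of `L²(P)` as an expectation. -/
theorem inner_Lp_eq (X Y : Lp ℂ 2 P) : inner ℂ Y X = ∫ ω, X ω * conj (Y ω) ∂P := by
  rw [L2.inner_def]
  rfl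

/-- The covariance of an orthogonal random measure. -/
def HasCovariance (Z : Fin T → VectorMeasure ℝ (Lp ℂ 2 P))
    (F : ℝ → Matrix (Fin T) (Fin T) ℂ) : Prop :=
  ∀ (ν μ : Fin T) (Δ₁ Δ₂ : Set ℝ), MeasurableSet Δ₁ → MeasurableSet Δ₂ →
    ∫ ω, Z ν Δ₁ ω * conj (Z μ Δ₂ ω) ∂P =
      (1 / (2 * Real.pi) : ℂ) * ∫ t in Δ₁ ∩ Δ₂ ∩ Set.Ioc (-Real.pi) Real.pi, F t ν μ

/-- The covariance condition says that the vectors `Z_ν(Δ)` have, up to `1/(2π)`, the same Gram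
matrix as the fields `1_Δ δ_ν` in `L₂(F)`. Here the combination runs over pairs of a value of `φ`
and a coordinate. -/
theorem norm_sq_simpleIntegral (hF : IsWeight F) (hZ : HasCovariance Z F)
    (φ : SimpleFunc ℝ (Fin T → ℂ)) :
    ‖simpleIntegral Z φ‖ ^ 2 = 1 / (2 * Real.pi) * sqNorm F φ := by
  have hm : ∀ v, MeasurableSet (φ ⁻¹' {v}) := φ.measurableSet_fiber
  have hg : ∀ p ∈ φ.range ×ˢ (Finset.univ : Finset (Fin T)),
      ∀ q ∈ φ.range ×ˢ (Finset.univ : Finset (Fin T)),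
      inner ℂ (Z q.2 (φ ⁻¹' {q.1})) (Z p.2 (φ ⁻¹' {p.1})) = (1 / (2 * Real.pi) : ℂ) *
        ∫ t, ((φ ⁻¹' {p.1}).indicator (fun _ => Pi.single p.2 1) t : Fin T → ℂ) ⬝ᵥ
          (F t *ᵥ star ((φ ⁻¹' {q.1}).indicator (fun _ => Pi.single q.2 1) t))
          ∂freqMeasure := fun p _ q _ => by
    rw [inner_Lp_eq, hZ p.2 q.2 _ _ (hm p.1) (hm q.1),
      integral_indicator_form F (hm p.1) (hm q.1)]
  have h := norm_sq_sum_eq hF (φ.range ×ˢ Finset.univ) (fun p => p.1 p.2)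
    (fun p _ => memL2_indicator hF (hm p.1) p.2) hg
  rw [Finset.sum_product] at h
  rw [simpleIntegral, h]
  congr 2
  funext t
  rw [Finset.sum_product]
  exact (simpleFunc_eq_sum φ t).symm

theorem isIsometric_simpleIntegral (hF : IsWeight F) (hZ : HasCovariance Z F) :
    IsIsometric F (simpleCoe T) (simpleIntegralₗ Z) :=
  ⟨memL2_simple hF, norm_sq_simpleIntegral hF hZ⟩

theorem exists_hasStochIntegral (hF : IsWeight F) (hZ : HasCovariance Z F) (hb : MemL2 F b) :
    ∃ Y, HasStochIntegral Z F b Y := by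
  have h := HasExtension.exists hF (isIsometric_simpleIntegral hF hZ) hb
    fun ε hε => exists_simple_sqNorm_sub_lt hF hb hε
  obtain ⟨Y, hY⟩ := h
  exact ⟨Y, hasStochIntegral_iff.2 hY⟩

end Simple

/-! ### Exponentials and trigonometric polynomials. -/

theorem norm_exp_I_mul (z : ℤ) (t : ℝ) : ‖Complex.exp (Complex.I * z * t)‖ = 1 := by
  rw [show Complex.I * z * t = ((z * t : ℝ) : ℂ) * Complex.I by push_cast; ring]
  exact Complex.norm_exp_ofReal_mul_I _

theorem star_exp_I_mul (z : ℤ) (t : ℝ) :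
    star (Complex.exp (Complex.I * z * t)) = Complex.exp (-(Complex.I * z * t)) := by
  rw [← starRingEnd_apply, ← Complex.exp_conj]
  simp

theorem continuous_exp_I_mul (z : ℂ) : Continuous fun t : ℝ => Complex.exp (Complex.I * z * t) := by
  fun_prop

theorem integral_exp_I_mul (n : ℤ) :
    ∫ t : ℝ, Complex.exp (Complex.I * n * t) ∂freqMeasure =
      if n = 0 then (2 * Real.pi : ℂ) else 0 := by
  rw [← intervalIntegral_eq_freq]
  split_ifs with h
  · subst h
    simp
    ring
  · have hc : Complex.I * (n : ℂ) ≠ 0 := mul_ne_zero Complex.I_ne_zero (by exact_mod_cast h)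
    rw [integral_exp_mul_complex hc]
    have : Complex.exp (Complex.I * n * Real.pi) =
        Complex.exp (Complex.I * n * ((-Real.pi : ℝ) : ℂ)) := by
      rw [Complex.exp_eq_exp_iff_exists_int]
      exact ⟨n, by push_cast; ring⟩
    rw [this, sub_self, zero_div]

theorem integrable_exp_mul {u : ℝ → ℂ} (hu : Integrable u freqMeasure) (z : ℤ) :
    Integrable (fun t : ℝ => Complex.exp (Complex.I * z * t) * u t) freqMeasure :=
  hu.bdd_mul (c := 1) (continuous_exp_I_mul z).aestronglyMeasurable
    (Eventually.of_forall fun t => (norm_exp_I_mul z t).le)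

section Trig

variable {T : ℕ} {F : ℝ → Matrix (Fin T) (Fin T) ℂ} {b : ℝ → Fin T → ℂ}

/-- The linear map `∑_j p(j) e^{ijt} ↦ ∑_j ∑_ν p(j)_ν e(j, ν)`. -/
noncomputable def trigLin {K : Type*} [AddCommGroup K] [Module ℂ K] (e : ℤ → Fin T → K) :
    (ℤ →₀ (Fin T → ℂ)) →ₗ[ℂ] K :=
  Finsupp.lsum ℂ fun j => ∑ ν, (LinearMap.proj (R := ℂ) ν).smulRight (e j ν)

theorem trigLin_apply {K : Type*} [AddCommGroup K] [Module ℂ K] (e : ℤ → Fin T → K)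
    (p : ℤ →₀ (Fin T → ℂ)) : trigLin e p = ∑ j ∈ p.support, ∑ ν, p j ν • e j ν := by
  simp [trigLin, Finsupp.sum]

theorem trigLin_single {K : Type*} [AddCommGroup K] [Module ℂ K] (e : ℤ → Fin T → K) (j : ℤ)
    (ν : Fin T) : trigLin e (Finsupp.single j (Pi.single ν 1)) = e j ν := by
  simp only [trigLin, Finsupp.lsum_single, LinearMap.sum_apply, LinearMap.smulRight_apply,
    LinearMap.proj_apply]
  rw [Finset.sum_eq_single ν (by intro i _ hi; simp [hi]) (by simp)]
  simp

/-- The vector-valued exponentials `e^{ijt} δ_ν`. -/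
noncomputable def expVec (T : ℕ) (j : ℤ) (ν : Fin T) (t : ℝ) : Fin T → ℂ :=
  Pi.single ν (Complex.exp (Complex.I * j * t))

theorem trigLin_expVec (p : ℤ →₀ (Fin T → ℂ)) : trigLin (expVec T) p = trigPoly p := by
  funext t
  rw [trigLin_apply, Finset.sum_apply, trigPoly, Finsupp.sum]
  refine Finset.sum_congr rfl fun j _ => ?_
  ext i
  simp [expVec, Pi.single_apply, mul_comm]

theorem memL2_expVec (hF : IsWeight F) (j : ℤ) (ν : Fin T) : MemL2 F (expVec T j ν) := by
  refine memL2_of_bounded hF (C := 1) ?_ fun t => ?_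
  · refine Continuous.aestronglyMeasurable (continuous_pi fun i => ?_)
    by_cases h : i = ν
    · subst h
      simpa [expVec] using continuous_exp_I_mul j
    · simpa [expVec, h] using continuous_const
  · rw [expVec, Pi.norm_single, norm_exp_I_mul]

theorem memL2_trigLin (hF : IsWeight F) (p : ℤ →₀ (Fin T → ℂ)) :
    MemL2 F (trigLin (expVec T) p) := by
  have h := MemL2.sum hF p.support (x := fun j t => ∑ ν, p j ν • expVec T j ν t) fun j _ =>
    MemL2.sum hF Finset.univ (x := fun ν t => p j ν • expVec T j ν t) fun ν _ =>
      (memL2_expVec hF j ν).smul hF _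
  rw [trigLin_apply]
  convert h using 1
  funext t
  simp

theorem expVec_form (F : ℝ → Matrix (Fin T) (Fin T) ℂ) (n m : ℤ) (ν μ : Fin T) (t : ℝ) :
    expVec T n ν t ⬝ᵥ (F t *ᵥ star (expVec T m μ t)) =
      Complex.exp (Complex.I * ((n : ℂ) - m) * t) * F t ν μ := by
  have : Complex.exp (Complex.I * ((n : ℂ) - m) * t) =
      Complex.exp (Complex.I * n * t) * star (Complex.exp (Complex.I * m * t)) := by
    rw [star_exp_I_mul, ← Complex.exp_add]
    congr 1; ring
  rw [this]
  simp only [expVec, ← Pi.single_star, Matrix.mulVec_single, single_dotProduct]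
  simp
  ring

theorem isIsometric_trigLin {K : Type*} [NormedAddCommGroup K] [InnerProductSpace ℂ K]
    (hF : IsWeight F) {x : ℤ → Fin T → K}
    (hx : ∀ (n m : ℤ) (ν μ : Fin T), inner ℂ (x m μ) (x n ν) = (1 / (2 * Real.pi) : ℂ) *
      ∫ t, Complex.exp (Complex.I * ((n : ℂ) - m) * t) * F t ν μ ∂freqMeasure) :
    IsIsometric F (trigLin (expVec T)) (trigLin x) := by
  refine ⟨memL2_trigLin hF, fun p => ?_⟩
  have h := norm_sq_sum_eq hF (p.support ×ˢ Finset.univ) (fun q => p q.1 q.2)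
    (x := fun q => expVec T q.1 q.2) (e := fun q => x q.1 q.2)
    (fun q _ => memL2_expVec hF q.1 q.2) (fun q _ r _ => by
      simp only [hx, expVec_form])
  rw [Finset.sum_product] at h
  rw [trigLin_apply, h]
  congr 2
  funext t
  rw [Finset.sum_product, trigLin_apply]
  simp

/-- The Fourier coefficients of `∑_{j ∈ S} v⃗(j) e^{ijt}`. -/
theorem integral_exp_mul_expSum (S : Finset ℤ) (v : S × Fin T → ℂ) (n : ℤ) (ν : Fin T) :
    ∫ t : ℝ, Complex.exp (Complex.I * n * t) * expSum S v t ν ∂freqMeasure =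
      2 * Real.pi * if h : -n ∈ S then v (⟨-n, h⟩, ν) else 0 := by
  have hi : ∀ j : S, Integrable (fun t : ℝ => v (j, ν) *
      Complex.exp (Complex.I * ((n + j : ℤ) : ℂ) * t)) freqMeasure := fun j => by
    refine Integrable.const_mul ?_ _
    simpa using integrable_exp_mul (u := fun _ => 1) (integrable_const _) (n + j)
  have h1 : ∀ t : ℝ, Complex.exp (Complex.I * n * t) * expSum S v t ν =
      ∑ j : S, v (j, ν) * Complex.exp (Complex.I * ((n + j : ℤ) : ℂ) * t) := fun t => by
    rw [expSum, Finset.mul_sum]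
    refine Finset.sum_congr rfl fun j _ => ?_
    rw [mul_left_comm, ← Complex.exp_add]
    congr 2
    push_cast; ring
  simp only [h1]
  rw [integral_finsetSum _ fun j _ => hi j]
  simp only [integral_const_mul, integral_exp_I_mul]
  split_ifs with h
  · rw [Finset.sum_eq_single ⟨-n, h⟩]
    · simp; ring
    · intro j _ hj
      rw [if_neg, mul_zero]
      intro h0
      exact hj (Subtype.ext (by simp; omega))
    · simp
  · rw [mul_zero]
    refine Finset.sum_eq_zero fun j _ => ?_
    rw [if_neg, mul_zero]
    intro h0
    apply h
    rw [show -n = j by omega]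
    exact j.2

theorem continuous_expSum (S : Finset ℤ) (v : S × Fin T → ℂ) : Continuous (expSum S v) := by
  refine continuous_pi fun ν => ?_
  unfold expSum
  fun_prop

theorem norm_expSum_le (S : Finset ℤ) (v : S × Fin T → ℂ) (t : ℝ) :
    ‖expSum S v t‖ ≤ ∑ p, ‖v p‖ := by
  rw [pi_norm_le_iff_of_nonneg (by positivity)]
  intro ν
  refine (norm_sum_le _ _).trans ?_
  rw [Fintype.sum_prod_type]
  refine Finset.sum_le_sum fun j _ => ?_
  rw [norm_mul, norm_exp_I_mul, mul_one]
  exact Finset.single_le_sum (f := fun ν => ‖v (j, ν)‖) (fun _ _ => norm_nonneg _)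
    (Finset.mem_univ ν)

theorem integrable_expSum (S : Finset ℤ) (v : S × Fin T → ℂ) (ν : Fin T) :
    Integrable (fun t => expSum S v t ν) freqMeasure := by
  refine Integrable.of_bound (C := ∑ p, ‖v p‖)
    ((continuous_apply ν).comp (continuous_expSum S v)).aestronglyMeasurable
    (Eventually.of_forall fun t => (norm_le_pi_norm _ _).trans (norm_expSum_le S v t))

/-- An integrable field with Fourier coefficients supported in `S` is a trigonometric polynomial. -/
theorem exists_ae_eq_expSum (S : Finset ℤ) {u : ℝ → Fin T → ℂ}
    (hu : ∀ ν, Integrable (fun t => u t ν) freqMeasure)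
    (h0 : ∀ j ∉ S, ∀ ν, ∫ t, Complex.exp (-(Complex.I * j * t)) * u t ν ∂freqMeasure = 0) :
    ∃ v : S × Fin T → ℂ, u =ᵐ[freqMeasure] expSum S v := by
  have hneg : ∀ (n : ℤ) (t : ℝ), Complex.exp (-(Complex.I * ((-n : ℤ) : ℂ) * t)) =
      Complex.exp (Complex.I * n * t) := fun n t => by push_cast; ring_nf
  refine ⟨fun p => 1 / (2 * Real.pi) *
    ∫ t, Complex.exp (-(Complex.I * (p.1 : ℤ) * t)) * u t p.2 ∂freqMeasure, ?_⟩
  set v : S × Fin T → ℂ := fun p => 1 / (2 * Real.pi) *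
    ∫ t, Complex.exp (-(Complex.I * (p.1 : ℤ) * t)) * u t p.2 ∂freqMeasure with hv
  have hpi : (Real.pi : ℂ) ≠ 0 := by exact_mod_cast Real.pi_ne_zero
  have h : ∀ ν, (fun t => u t ν - expSum S v t ν) =ᵐ[freqMeasure] 0 := fun ν => by
    refine ae_eq_zero_of_fourier_eq_zero ((hu ν).sub (integrable_expSum S v ν)) fun n => ?_
    simp only [mul_sub]
    rw [integral_sub (integrable_exp_mul (hu ν) n) (integrable_exp_mul (integrable_expSum S v ν) n),
      integral_exp_mul_expSum, sub_eq_zero]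
    split_ifs with hn
    · simp only [hv, hneg]
      field_simp
    · rw [mul_zero, ← h0 (-n) hn ν]
      simp only [hneg]
  filter_upwards [ae_all_iff.2 h] with t ht
  funext ν
  exact sub_eq_zero.1 (ht ν)

/-- Sending the generators with frequency in `S` to zero realizes the restricted polynomials as the
range of a linear map on all coefficient families, the shape that the duality criterion takes. -/
theorem trigLin_ite (S : Finset ℤ) (p : ℤ →₀ (Fin T → ℂ)) :
    trigLin (fun j ν => if j ∈ S then 0 else expVec T j ν) p =
      trigLin (expVec T) (p.filter fun j => j ∉ S) := by
  rw [trigLin_apply, trigLin_apply, Finsupp.support_filter, Finset.sum_filter]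
  refine Finset.sum_congr rfl fun j _ => ?_
  by_cases h : j ∈ S <;> simp [h]

theorem star_dotProduct_expVec (u : Fin T → ℂ) (j : ℤ) (ν : Fin T) (t : ℝ) :
    star u ⬝ᵥ expVec T j ν t = star (Complex.exp (-(Complex.I * j * t)) * u ν) := by
  rw [expVec, dotProduct_single, Pi.star_apply, star_mul', ← star_exp_I_mul, star_star, mul_comm]

/-- Fields in `L₂(F)` with vanishing Fourier coefficients on `S` are limits of trigonometric
polynomials with frequencies outside `S`. -/
theorem exists_trig_sqNorm_sub_lt (hF : IsWeight F) (S : Finset ℤ) (hb : MemL2 F b)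
    (hbi : ∀ j ∈ S, ∀ ν, Integrable (fun t => b t ν) freqMeasure)
    (hb0 : ∀ j ∈ S, ∀ ν,
      ∫ t, Complex.exp (-(Complex.I * (j : ℤ) * t)) * b t ν ∂freqMeasure = 0)
    {ε : ℝ} (hε : 0 < ε) :
    ∃ p : ℤ →₀ (Fin T → ℂ), (∀ j ∈ S, p j = 0) ∧
      sqNorm F (fun t => b t - trigLin (expVec T) p t) < ε := by
  suffices h : ∃ p : ℤ →₀ (Fin T → ℂ), sqNorm F (fun t => b t -
      trigLin (fun j ν => if j ∈ S then 0 else expVec T j ν) p t) < ε by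
    obtain ⟨p, hp⟩ := h
    rw [trigLin_ite] at hp
    exact ⟨_, fun j hj => Finsupp.filter_apply_neg _ _ (not_not.2 hj), hp⟩
  refine exists_sqNorm_sub_lt hF _ (fun p => ?_) hb (fun u hu _ h => ?_) hε
  · rw [trigLin_ite]
    exact memL2_trigLin hF _
  -- The annihilator has no Fourier coefficients outside `S`, so it is a trigonometric polynomial
  -- with frequencies in `S`. Its pairing with `b` then involves only the coefficients of `b` on
  -- `S`, which vanish.
  obtain ⟨v, hv⟩ := exists_ae_eq_expSum S hu fun j hj ν => by
    have h1 := h (Finsupp.single j (Pi.single ν 1))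
    simp only [trigLin_single, if_neg hj, star_dotProduct_expVec] at h1
    rw [← star_eq_zero, ← starRingEnd_apply, ← integral_conj]
    exact h1
  calc ∫ t, star (u t) ⬝ᵥ b t ∂freqMeasure
      = ∫ t, ∑ ν, ∑ j : S, star (v (j, ν)) *
          (Complex.exp (-(Complex.I * (j : ℤ) * t)) * b t ν) ∂freqMeasure := by
        refine integral_congr_ae ?_
        filter_upwards [hv] with t ht
        rw [ht, dotProduct]
        refine Finset.sum_congr rfl fun ν _ => ?_
        rw [Pi.star_apply, expSum, star_sum, Finset.sum_mul]
        refine Finset.sum_congr rfl fun j _ => ?_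
        rw [star_mul', star_exp_I_mul, mul_assoc]
    _ = 0 := by
        have hneg : ∀ (n : ℤ) (t : ℝ), Complex.exp (-(Complex.I * n * t)) =
          Complex.exp (Complex.I * ((-n : ℤ) : ℂ) * t) := fun n t => by push_cast; ring_nf
        have hI : ∀ (j : S) ν, Integrable (fun t : ℝ => star (v (j, ν)) *
            (Complex.exp (-(Complex.I * (j : ℤ) * t)) * b t ν)) freqMeasure := fun j ν => by
          simp only [hneg]
          exact (integrable_exp_mul (hbi j j.2 ν) _).const_mul _
        rw [integral_finsetSum _ fun ν _ => integrable_finsetSum _ fun j _ => hI j ν]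
        refine Finset.sum_eq_zero fun ν _ => ?_
        rw [integral_finsetSum _ fun j _ => hI j ν]
        refine Finset.sum_eq_zero fun j _ => ?_
        rw [integral_const_mul, hb0 j j.2 ν, mul_zero]

end Trig

/-! ### Construction of the orthogonal random measures. -/

section Measures

variable {T : ℕ} {f : ℝ → Matrix (Fin T) (Fin T) ℂ} {b : ℝ → Fin T → ℂ}
  {Ω : Type*} [MeasurableSpace Ω] {P : Measure Ω} {X : ℤ → Fin T → Ω → ℂ}

theorem IsSpectralDensity.isWeight (hf : IsSpectralDensity P X f) : IsWeight f :=
  ⟨hf.integrable, hf.posSemidef⟩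

theorem IsSpectralDensity.inner_toLp (hf : IsSpectralDensity P X f)
    (hX : ∀ n ν, MemLp (X n ν) 2 P) (n m : ℤ) (ν μ : Fin T) :
    inner ℂ ((hX m μ).toLp (X m μ)) ((hX n ν).toLp (X n ν)) = (1 / (2 * Real.pi) : ℂ) *
      ∫ t, Complex.exp (Complex.I * ((n : ℂ) - m) * t) * f t ν μ ∂freqMeasure := by
  rw [inner_Lp_eq, ← intervalIntegral_eq_freq, ← hf.covariance]
  refine integral_congr_ae ?_
  filter_upwards [(hX m μ).coeFn_toLp, (hX n ν).coeFn_toLp] with ω h1 h2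
  rw [h1, h2]

theorem IsSpectralDensity.isIsometric (hf : IsSpectralDensity P X f)
    (hX : ∀ n ν, MemLp (X n ν) 2 P) :
    IsIsometric f (trigLin (expVec T)) (trigLin fun n ν => (hX n ν).toLp (X n ν)) :=
  isIsometric_trigLin hf.isWeight (hf.inner_toLp hX)

/-- For empty `S` the conditions on `b` as an integrable field are void. Hence trigonometric
polynomials are dense in `L₂(F)` for every weight, with no minimality condition. -/
theorem exists_trig_sqNorm_sub_lt' {F : ℝ → Matrix (Fin T) (Fin T) ℂ} (hF : IsWeight F)
    (hb : MemL2 F b) {ε : ℝ} (hε : 0 < ε) :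
    ∃ p : ℤ →₀ (Fin T → ℂ), sqNorm F (fun t => b t - trigLin (expVec T) p t) < ε := by
  obtain ⟨p, -, hp⟩ := exists_trig_sqNorm_sub_lt hF ∅ hb (by simp) (by simp) hε
  exact ⟨p, hp⟩

theorem sqNorm_indicator (F : ℝ → Matrix (Fin T) (Fin T) ℂ) {Δ : Set ℝ} (hΔ : MeasurableSet Δ)
    (ν : Fin T) : sqNorm F (Δ.indicator fun _ => Pi.single ν 1) =
      ∫ t in Δ, (F t ν ν).re ∂freqMeasure := by
  rw [sqNorm_eq, ← integral_indicator hΔ]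
  refine integral_congr_ae (Eventually.of_forall fun t => ?_)
  by_cases h : t ∈ Δ <;> simp [h]

/-- An isometric family indexed by indicator functions is an `L²`-valued measure. -/
theorem hasSum_of_hasExtension {K V : Type*} [NormedAddCommGroup K] [InnerProductSpace ℂ K]
    [AddCommGroup V] [Module ℂ V] {ι : V →ₗ[ℂ] (ℝ → Fin T → ℂ)} {I : V →ₗ[ℂ] K}
    (hF : IsWeight f) (hI : IsIsometric f ι I) {ν : Fin T} {Φ : Set ℝ → K}
    (hΦ : ∀ Δ, MeasurableSet Δ → HasExtension f ι I (Δ.indicator fun _ => Pi.single ν 1) (Φ Δ))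
    {A : ℕ → Set ℝ} (hA : ∀ i, MeasurableSet (A i)) (hd : Pairwise (Function.onFun Disjoint A)) :
    HasSum (fun i => Φ (A i)) (Φ (⋃ i, A i)) := by
  have hre : Integrable (fun t => (f t ν ν).re) freqMeasure := (hF.integrable ν ν).re
  have h1 := hasSum_integral_iUnion hA hd hre.integrableOn
  -- By isometry, the quantity under the limit is the norm of the remainder after the sets indexed
  -- by `s`. It tends to zero by countable additivity of the integral of `f_νν`.
  have h2 : Tendsto (fun s : Finset ℕ => √(1 / (2 * Real.pi) *
      (∫ t in ⋃ i, A i, (f t ν ν).re ∂freqMeasure -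
        ∑ i ∈ s, ∫ t in A i, (f t ν ν).re ∂freqMeasure))) atTop (𝓝 0) := by
    have h3 : Tendsto _ atTop (𝓝 _) := h1
    have := ((h3.const_sub (∫ t in ⋃ i, A i, (f t ν ν).re ∂freqMeasure)).const_mul (1 / (2 * Real.pi))).sqrt
    simpa using this
  rw [HasSum, tendsto_iff_norm_sub_tendsto_zero]
  refine h2.congr fun s => ?_
  have hU : MeasurableSet (⋃ i, A i) := MeasurableSet.iUnion hA
  have hs : MeasurableSet (⋃ i ∈ s, A i) := Finset.measurableSet_biUnion s fun i _ => hA i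
  have hsub : (⋃ i ∈ s, A i) ⊆ ⋃ i, A i := Set.iUnion₂_subset_iUnion _ _
  have e1 := ((hΦ _ hU).sub hF hI (HasExtension.sum hF hI s fun i _ => hΦ _ (hA i))).norm_sq hF hI
  have e2 : (fun t => (⋃ i, A i).indicator (fun _ => (Pi.single ν 1 : Fin T → ℂ)) t -
      ∑ i ∈ s, (A i).indicator (fun _ => (Pi.single ν 1 : Fin T → ℂ)) t) =
      ((⋃ i, A i) \ ⋃ i ∈ s, A i).indicator fun _ => Pi.single ν 1 := by
    rw [Set.indicator_sdiff hsub, Finset.indicator_biUnion s A fun i _ j _ hij => hd hij]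
    rfl
  rw [e2, sqNorm_indicator f (hU.diff hs), setIntegral_sdiff hs hre.integrableOn hsub,
    integral_biUnion_finset s (fun i _ => hA i) (fun i _ j _ hij => hd hij)
      (fun i _ => hre.integrableOn)] at e1
  rw [← e1, Real.sqrt_sq (norm_nonneg _), norm_sub_rev]

/-- The isometry `e^{int} δ_ν ↦ X_ν(n)` extends to all of `L₂(f)`, and `Z_ν(Δ)` is its value at `1_Δ
δ_ν`. Preservation of inner products gives the covariance. Integrals of simple functions are values
of the same extension, so simple functions converging to `e^{int} δ_ν` recover `X_ν(n)`. -/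
theorem exists_isOrthogonalMeasureOf (hf : IsSpectralDensity P X f)
    (hX : ∀ n ν, MemLp (X n ν) 2 P) :
    ∃ Z : Fin T → VectorMeasure ℝ (Lp ℂ 2 P), IsOrthogonalMeasureOf Z X f := by
  classical
  have hF := hf.isWeight
  have hI := hf.isIsometric hX
  set I := trigLin fun n ν => (hX n ν).toLp (X n ν) with hIdef
  -- A vector measure has to vanish on non-measurable sets, whence the second clause.
  have hex : ∀ (ν : Fin T) (Δ : Set ℝ), ∃ Y : Lp ℂ 2 P,
      (MeasurableSet Δ → HasExtension f (trigLin (expVec T)) I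
        (Δ.indicator fun _ => Pi.single ν 1) Y) ∧ (¬ MeasurableSet Δ → Y = 0) := by
    intro ν Δ
    by_cases hΔ : MeasurableSet Δ
    · obtain ⟨Y, hY⟩ := HasExtension.exists hF hI (memL2_indicator hF hΔ ν)
        fun ε hε => exists_trig_sqNorm_sub_lt' hF (memL2_indicator hF hΔ ν) hε
      exact ⟨Y, fun _ => hY, fun h => absurd hΔ h⟩
    · exact ⟨0, fun h => absurd h hΔ, fun _ => rfl⟩
  choose Φ hΦ hΦ0 using hex
  let Z : Fin T → VectorMeasure ℝ (Lp ℂ 2 P) := fun ν =>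
    { measureOf' := Φ ν
      empty' := by
        have h := (hΦ ν ∅ MeasurableSet.empty).norm_sq hF hI
        rw [Set.indicator_empty, sqNorm_zero, mul_zero] at h
        simpa using h
      not_measurable' := fun Δ hΔ => hΦ0 ν Δ hΔ
      m_iUnion' := fun A hA hd => hasSum_of_hasExtension hF hI (hΦ ν) hA hd }
  have hZ : ∀ ν Δ, Z ν Δ = Φ ν Δ := fun _ _ => rfl
  have hsimple : ∀ φ : SimpleFunc ℝ (Fin T → ℂ), HasExtension f (trigLin (expVec T)) I φ (simpleIntegral Z φ) := by
    intro φ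
    have h := HasExtension.sum hF hI φ.range fun v _ =>
      HasExtension.sum hF hI Finset.univ fun ν _ =>
        (hΦ ν _ (φ.measurableSet_fiber v)).smul hF (v ν)
    have e : (φ : ℝ → Fin T → ℂ) = fun t => ∑ v ∈ φ.range, ∑ ν,
        v ν • (φ ⁻¹' {v}).indicator (fun _ => Pi.single ν 1) t := funext (simpleFunc_eq_sum φ)
    rw [e]
    exact h
  refine ⟨Z, fun ν μ Δ₁ Δ₂ h₁ h₂ => ?_, fun n ν => ?_⟩
  · rw [hZ, hZ, ← inner_Lp_eq, (hΦ ν Δ₁ h₁).inner_eq hF hI (hΦ μ Δ₂ h₂),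
      integral_indicator_form f h₁ h₂]
  · have hx : HasExtension f (trigLin (expVec T)) I (expVec T n ν) ((hX n ν).toLp (X n ν)) := by
      have := HasExtension.of_apply hI (Finsupp.single n (Pi.single ν 1))
      rwa [hIdef, trigLin_single, trigLin_single] at this
    refine ⟨_, (hX n ν).coeFn_toLp, hx.1, ?_⟩
    choose φ hφ using fun k : ℕ => exists_simple_sqNorm_sub_lt hF hx.1
      (Nat.one_div_pos_of_nat (α := ℝ) (n := k))
    have h0 : Tendsto (fun k => sqNorm f (fun t => expVec T n ν t - φ k t)) atTop (𝓝 0) :=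
      squeeze_zero (fun n => sqNorm_nonneg hF _) (fun n => (hφ n).le)
        tendsto_one_div_add_atTop_nhds_zero_nat
    exact ⟨φ, h0, hx.tendsto hF hI (fun k => hsimple (φ k)) h0⟩

/-- The stochastic integral of a trigonometric polynomial. -/
theorem IsOrthogonalMeasureOf.hasExtension_trig
    {Z : Fin T → VectorMeasure ℝ (Lp ℂ 2 P)} (hF : IsWeight f)
    (hZ : IsOrthogonalMeasureOf Z X f) (hX : ∀ n ν, MemLp (X n ν) 2 P)
    (p : ℤ →₀ (Fin T → ℂ)) :
    HasExtension f (simpleCoe T) (simpleIntegralₗ Z) (trigLin (expVec T) p)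
      (trigLin (fun n ν => (hX n ν).toLp (X n ν)) p) := by
  have hI := isIsometric_simpleIntegral hF hZ.covariance
  have h1 : ∀ n ν, HasExtension f (simpleCoe T) (simpleIntegralₗ Z) (expVec T n ν)
      ((hX n ν).toLp (X n ν)) := by
    intro n ν
    obtain ⟨Y, hY, h⟩ := hZ.representation n ν
    have : (hX n ν).toLp (X n ν) = Y := Lp.ext ((hX n ν).coeFn_toLp.trans hY.symm)
    rw [this]
    exact hasStochIntegral_iff.1 h
  have h := HasExtension.sum hF hI p.support fun j _ =>
    HasExtension.sum hF hI Finset.univ fun ν _ => (h1 j ν).smul hF (p j ν)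
  rw [trigLin_apply, trigLin_apply]
  convert h using 1
  funext t
  simp

end Measures

/-! ### Pointwise matrix inequalities and the parallel sum. -/

theorem form_re_nonneg {n : Type*} [Fintype n] {M : Matrix n n ℂ}
    (hM : M.PosSemidef) (x : n → ℂ) : 0 ≤ (x ⬝ᵥ (M *ᵥ star x)).re := by
  have := hM.dotProduct_mulVec_nonneg (star x)
  rw [star_star] at this
  exact (Complex.le_def.1 this).1

section Pointwise

variable {n : Type*} [Fintype n] {A B M : Matrix n n ℂ}

/-- Cauchy–Schwarz in additive form, ready to be integrated. It is nonnegativity of the form at `c x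
- y`, with a unimodular `c` that makes the mixed term equal to its modulus. -/
theorem two_mul_norm_form_le (hM : M.PosSemidef) (x y : n → ℂ) :
    2 * ‖x ⬝ᵥ (M *ᵥ star y)‖ ≤ (x ⬝ᵥ (M *ᵥ star x)).re + (y ⬝ᵥ (M *ᵥ star y)).re := by
  obtain ⟨c, hc, hc'⟩ := RCLike.exists_norm_eq_mul_self (x ⬝ᵥ (M *ᵥ star y))
  have h := form_re_nonneg hM (c • x - y)
  have hs := form_conj_symm hM.isHermitian (c • x) y
  have hcc : star c * c = 1 := by
    rw [mul_comm]
    have := Complex.mul_conj' c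
    rw [hc] at this
    simpa using this
  simp only [star_sub, Matrix.mulVec_sub, dotProduct_sub, sub_dotProduct] at h
  rw [hs] at h
  simp only [star_smul, Matrix.mulVec_smul, dotProduct_smul, smul_dotProduct, smul_eq_mul,
    ← mul_assoc, hcc, one_mul] at h
  rw [← hc'] at h
  simp at h
  linarith

/-- The terms linear in `d` are twice the real part of `h (A + B) d̄ - a A d̄`, which the equation
for `h` reduces to `-c d̄`. So the first variation at `h` is carried by the multiplier `c` alone. -/
theorem mse_integrand_add (hA : A.PosSemidef) (hB : B.PosSemidef) {a c h : n → ℂ}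
    (hh : h ᵥ* (A + B) = a ᵥ* A - c) (d : n → ℂ) :
    ((a - (h + d)) ⬝ᵥ (A *ᵥ star (a - (h + d)))).re +
      ((h + d) ⬝ᵥ (B *ᵥ star (h + d))).re =
    ((a - h) ⬝ᵥ (A *ᵥ star (a - h))).re + (h ⬝ᵥ (B *ᵥ star h)).re +
      (d ⬝ᵥ ((A + B) *ᵥ star d)).re - 2 * (c ⬝ᵥ star d).re := by
  have e1 := form_conj_symm hA.isHermitian (a - h) d
  have e2 := form_conj_symm hB.isHermitian h d
  have e3 : h ⬝ᵥ (A *ᵥ star d) + h ⬝ᵥ (B *ᵥ star d) = a ⬝ᵥ (A *ᵥ star d) - c ⬝ᵥ star d := by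
    have := congrArg (fun x => x ⬝ᵥ star d) hh
    simpa only [Matrix.vecMul_add, add_dotProduct, sub_dotProduct, ← Matrix.dotProduct_mulVec]
      using this
  have e4 : c ⬝ᵥ star d = (a - h) ⬝ᵥ (A *ᵥ star d) - h ⬝ᵥ (B *ᵥ star d) := by
    rw [sub_dotProduct]
    linear_combination e3
  rw [← sub_sub, e4]
  generalize a - h = x at *
  simp only [star_add, star_sub, Matrix.mulVec_add, Matrix.mulVec_sub, dotProduct_add,
    dotProduct_sub, add_dotProduct, sub_dotProduct, Matrix.add_mulVec, e1, e2] at *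
  simp
  ring

variable [DecidableEq n]

/-- At unit vectors the preceding inequality reads `2|M_ij| ≤ M_ii + M_jj`, and no diagonal entry
exceeds the trace. -/
theorem norm_entry_le_trace (hM : M.PosSemidef) (i j : n) : ‖M i j‖ ≤ M.trace.re := by
  have h := two_mul_norm_form_le hM (Pi.single i 1) (Pi.single j 1)
  have hd : ∀ k, (M k k).re ≤ M.trace.re := fun k => by
    rw [Matrix.trace, Complex.re_sum]
    exact Finset.single_le_sum (f := fun i => (M.diag i).re)
      (fun l _ => (Complex.le_def.1 hM.diag_nonneg).1) (Finset.mem_univ k)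
  simp at h
  linarith [hd i, hd j]

/-- Both sides equal `A - A (A + B)⁻¹ A`. -/
theorem parallel_comm (hU : IsUnit (A + B).det) : A * (A + B)⁻¹ * B = B * (A + B)⁻¹ * A := by
  have h1 : A * (A + B)⁻¹ * B = A - A * (A + B)⁻¹ * A := by
    have : A * (A + B)⁻¹ * (A + B) = A := by
      rw [mul_assoc, Matrix.nonsing_inv_mul _ hU, mul_one]
    rw [mul_add] at this
    exact eq_sub_of_add_eq' this
  have h2 : B * (A + B)⁻¹ * A = A - A * (A + B)⁻¹ * A := by
    have : (A + B) * (A + B)⁻¹ * A = A := by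
      rw [Matrix.mul_nonsing_inv _ hU, one_mul]
    rw [add_mul, add_mul] at this
    exact eq_sub_of_add_eq' this
  rw [h1, h2]

theorem mul_inv_mul_self (hU : IsUnit (A + B).det) :
    A * (A + B)⁻¹ * A = A - A * (A + B)⁻¹ * B := by
  have : A * (A + B)⁻¹ * (A + B) = A := by
    rw [mul_assoc, Matrix.nonsing_inv_mul _ hU, mul_one]
  rw [mul_add] at this
  exact eq_sub_of_add_eq this

/-- Splits the parallel sum into two congruences, of `A` and of `B`, so that its positivity becomes
visible. Commutation rewrites the second summand so that `B + A` factors out on the left and cancels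
an inverse. The same splitting reappears in the error of the characteristic. -/
theorem parallel_eq (hU : IsUnit (A + B).det) :
    B * (A + B)⁻¹ * A * (A + B)⁻¹ * B + A * (A + B)⁻¹ * B * (A + B)⁻¹ * A =
      A * (A + B)⁻¹ * B := by
  have h1 : A * (A + B)⁻¹ * B * (A + B)⁻¹ * A = A * (A + B)⁻¹ * A * (A + B)⁻¹ * B := by
    simp only [mul_assoc]
    rw [← mul_assoc B, ← parallel_comm hU]
    simp only [mul_assoc]
  rw [h1, ← add_mul, ← add_mul, ← add_mul, ← add_mul, add_comm B A, Matrix.mul_nonsing_inv _ hU,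
    one_mul]

theorem posSemidef_parallel (hA : A.PosSemidef) (hB : B.PosSemidef) (hU : IsUnit (A + B).det) :
    (A * (A + B)⁻¹ * B).PosSemidef := by
  have hW := (hA.add hB).inv
  rw [← parallel_eq hU]
  have e1 := hA.conjTranspose_mul_mul_same ((A + B)⁻¹ * B)
  have e2 := hB.conjTranspose_mul_mul_same ((A + B)⁻¹ * A)
  rw [Matrix.conjTranspose_mul, hW.isHermitian.eq, hB.isHermitian.eq] at e1
  rw [Matrix.conjTranspose_mul, hW.isHermitian.eq, hA.isHermitian.eq] at e2
  have := e1.add e2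
  simpa only [mul_assoc] using this

/-- The parallel sum lies below `A`, the difference being the positive semidefinite `A (A + B)⁻¹ A`.
-/
theorem norm_parallel_entry_le (hA : A.PosSemidef) (hB : B.PosSemidef)
    (hU : IsUnit (A + B).det) (i j : n) :
    ‖(A * (A + B)⁻¹ * B) i j‖ ≤ A.trace.re := by
  refine (norm_entry_le_trace (posSemidef_parallel hA hB hU) i j).trans ?_
  have h2 : (A * (A + B)⁻¹ * A).PosSemidef := by
    have := (hA.add hB).inv.conjTranspose_mul_mul_same A
    rwa [hA.isHermitian.eq] at this
  have h := (Complex.le_def.1 h2.trace_nonneg).1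
  rw [mul_inv_mul_self hU, Matrix.trace_sub, Complex.sub_re, Complex.zero_re] at h
  linarith

/-- The entry is the `(A + B)⁻¹`-form of row `i` of `A` and `δ_j`. The diagonal terms bounding it
are entries of `A (A + B)⁻¹ A`, which is at most `A`, and of `(A + B)⁻¹`. -/
theorem norm_mul_inv_entry_le (hA : A.PosSemidef) (hB : B.PosSemidef)
    (hU : IsUnit (A + B).det) (i j : n) :
    ‖(A * (A + B)⁻¹) i j‖ ≤ A.trace.re + ((A + B)⁻¹).trace.re := by
  have hW := (hA.add hB).inv
  have h := two_mul_norm_form_le hW (A i) (Pi.single j 1)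
  have h1 : A i ⬝ᵥ ((A + B)⁻¹ *ᵥ star (Pi.single j 1)) = (A * (A + B)⁻¹) i j := by
    rw [← Pi.single_star, Matrix.mulVec_single]
    simp [Matrix.mul_apply, dotProduct]
  have h2 : A i ⬝ᵥ ((A + B)⁻¹ *ᵥ star (A i)) = (A * (A + B)⁻¹ * A) i i := by
    rw [Matrix.dotProduct_mulVec]
    have : star (A i) = A.col i := by
      funext k
      exact congrFun (congrFun hA.isHermitian.eq k) i
    rw [this]
    simp [Matrix.mul_apply, dotProduct, Matrix.vecMul, Matrix.col]
  have h3 : (A * (A + B)⁻¹ * A).PosSemidef := by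
    have := hW.conjTranspose_mul_mul_same A
    rwa [hA.isHermitian.eq] at this
  have h4 := Complex.re_le_norm ((A * (A + B)⁻¹ * A) i i)
  have h5 := norm_entry_le_trace h3 i i
  have h6 := (Complex.le_def.1 (posSemidef_parallel hA hB hU).trace_nonneg).1
  have h7 := norm_entry_le_trace hW j j
  have h8 := Complex.re_le_norm ((A + B)⁻¹ j j)
  rw [mul_inv_mul_self hU, Matrix.trace_sub, Complex.sub_re] at h5
  rw [← mul_inv_mul_self hU] at h5
  rw [h1, h2] at h
  simp at h h6
  have := norm_nonneg ((A * (A + B)⁻¹) i j)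
  linarith

/-- The coordinate `d_i` is the `F`-form of `d` and row `i` of `F⁻¹`. The weight `ε` serves two
purposes: the value `1` yields integrability, small values yield continuity of Fourier coefficients.
-/
theorem two_mul_norm_apply_le {F : Matrix n n ℂ} (hF : F.PosSemidef) (hU : IsUnit F.det)
    {ε : ℝ} (d : n → ℂ) (i : n) :
    2 * (|ε| * ‖d i‖) ≤ (d ⬝ᵥ (F *ᵥ star d)).re + ε ^ 2 * (F⁻¹).trace.re := by
  have hW := hF.inv
  have h := two_mul_norm_form_le hF d ((ε : ℂ) • F⁻¹ i)
  have hs : star (F⁻¹ i) = F⁻¹.col i := by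
    funext k
    exact congrFun (congrFun hW.isHermitian.eq k) i
  have h1 : F *ᵥ star (F⁻¹ i) = Pi.single i 1 := by
    rw [hs, ← Matrix.mulVec_single_one, Matrix.mulVec_mulVec, Matrix.mul_nonsing_inv _ hU,
      Matrix.one_mulVec]
  simp only [star_smul, Matrix.mulVec_smul, dotProduct_smul, smul_dotProduct, h1] at h
  simp only [dotProduct_single, mul_one, smul_eq_mul, norm_mul] at h
  have h7 := norm_entry_le_trace hW i i
  have h8 := Complex.re_le_norm (F⁻¹ i i)
  have h10 : ‖star (ε : ℂ)‖ = |ε| := by simp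
  have h9 : (star (ε : ℂ) * ((ε : ℂ) * F⁻¹ i i)).re = ε ^ 2 * (F⁻¹ i i).re := by
    simp
    ring
  rw [h10] at h
  have := mul_le_mul_of_nonneg_left (h8.trans h7) (sq_nonneg ε)
  rw [h9] at h
  linarith

theorem specChar_mul (hU : IsUnit (A + B).det) (a c : n → ℂ) :
    ((a ᵥ* A - c) ᵥ* (A + B)⁻¹) ᵥ* (A + B) = a ᵥ* A - c := by
  rw [Matrix.vecMul_vecMul, Matrix.nonsing_inv_mul _ hU, Matrix.vecMul_one]

theorem specChar_second_form (hU : IsUnit (A + B).det) (a c : n → ℂ) :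
    (a ᵥ* A - c) ᵥ* (A + B)⁻¹ = a - (a ᵥ* B + c) ᵥ* (A + B)⁻¹ := by
  have : a ᵥ* (A + B) ᵥ* (A + B)⁻¹ = a := by
    rw [Matrix.vecMul_vecMul, Matrix.mul_nonsing_inv _ hU, Matrix.vecMul_one]
  rw [Matrix.vecMul_add, Matrix.add_vecMul] at this
  nth_rw 2 [← this]
  rw [Matrix.sub_vecMul, Matrix.add_vecMul]
  abel

/-- The middle matrix is left free: `A + B` is needed for membership in `L₂(f + g)`, the single
summands for the two parts of the error. -/
theorem specChar_form (hA : A.PosSemidef) (hB : B.PosSemidef) (a c : n → ℂ) (M : Matrix n n ℂ) :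
    ((a ᵥ* A - c) ᵥ* (A + B)⁻¹) ⬝ᵥ (M *ᵥ star ((a ᵥ* A - c) ᵥ* (A + B)⁻¹)) =
      a ⬝ᵥ ((A * (A + B)⁻¹ * M * (A + B)⁻¹ * A) *ᵥ star a)
        - a ⬝ᵥ ((A * (A + B)⁻¹ * M * (A + B)⁻¹) *ᵥ star c)
        - c ⬝ᵥ (((A + B)⁻¹ * M * (A + B)⁻¹ * A) *ᵥ star a)
        + c ⬝ᵥ (((A + B)⁻¹ * M * (A + B)⁻¹) *ᵥ star c) := by
  have hW := (hA.add hB).inv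
  simp only [Matrix.star_vecMul, star_sub, Matrix.conjTranspose_mul, hW.isHermitian.eq,
    hA.isHermitian.eq, Matrix.mulVec_sub, dotProduct_sub, sub_dotProduct, Matrix.sub_vecMul, Matrix.mulVec_mulVec,
    Matrix.dotProduct_mulVec, Matrix.vecMul_vecMul, mul_assoc]
  ring

/-- The residual `a - h` has the same shape as `h`, with `A` and `B` exchanged and `c` replaced by
`-c`. The mixed terms in `a` and `c` then cancel by commutation, the terms in `a` add up to the
parallel sum and those in `c` to `(A + B)⁻¹`. -/
theorem mse_integrand_eq (hA : A.PosSemidef) (hB : B.PosSemidef) (hU : IsUnit (A + B).det)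
    (a c : n → ℂ) :
    (a - (a ᵥ* A - c) ᵥ* (A + B)⁻¹) ⬝ᵥ (A *ᵥ star (a - (a ᵥ* A - c) ᵥ* (A + B)⁻¹)) +
      ((a ᵥ* A - c) ᵥ* (A + B)⁻¹) ⬝ᵥ (B *ᵥ star ((a ᵥ* A - c) ᵥ* (A + B)⁻¹)) =
    a ⬝ᵥ ((A * (A + B)⁻¹ * B) *ᵥ star a) + c ⬝ᵥ ((A + B)⁻¹ *ᵥ star c) := by
  have h1 : a - (a ᵥ* A - c) ᵥ* (A + B)⁻¹ = (a ᵥ* B - (-c)) ᵥ* (B + A)⁻¹ := by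
    rw [specChar_second_form hU, add_comm B A]
    simp
  rw [h1, specChar_form hB hA, specChar_form hA hB, add_comm B A]
  have k1 := parallel_eq hU
  have k2 : B * (A + B)⁻¹ * A = A * (A + B)⁻¹ * B := (parallel_comm hU).symm
  have k3 : (A + B)⁻¹ * A * (A + B)⁻¹ + (A + B)⁻¹ * B * (A + B)⁻¹ = (A + B)⁻¹ := by
    rw [← add_mul, ← mul_add, Matrix.nonsing_inv_mul _ hU, one_mul]
  have k4 : (A + B)⁻¹ * A * (A + B)⁻¹ * B = (A + B)⁻¹ * B * (A + B)⁻¹ * A := by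
    simp only [mul_assoc] at k2 ⊢
    rw [k2]
  have k5 : c ⬝ᵥ ((A + B)⁻¹ *ᵥ star c) = c ⬝ᵥ (((A + B)⁻¹ * A * (A + B)⁻¹) *ᵥ star c) +
      c ⬝ᵥ (((A + B)⁻¹ * B * (A + B)⁻¹) *ᵥ star c) := by
    rw [← dotProduct_add, ← Matrix.add_mulVec, k3]
  have k6 : a ⬝ᵥ ((A * (A + B)⁻¹ * B) *ᵥ star a) =
      a ⬝ᵥ ((B * (A + B)⁻¹ * A * (A + B)⁻¹ * B) *ᵥ star a) +
      a ⬝ᵥ ((A * (A + B)⁻¹ * B * (A + B)⁻¹ * A) *ᵥ star a) := by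
    rw [← dotProduct_add, ← Matrix.add_mulVec, k1]
  rw [k5, k6, k2, k4]
  simp only [star_neg, Matrix.mulVec_neg, dotProduct_neg, neg_dotProduct]
  ring

end Pointwise

/-! ### Consequences of minimality and block Toeplitz forms. -/

section Minimal

variable {T : ℕ} {f g G : ℝ → Matrix (Fin T) (Fin T) ℂ} {S : Finset ℤ}

theorem aestronglyMeasurable_det {M : ℝ → Matrix (Fin T) (Fin T) ℂ}
    (hM : ∀ i j, AEStronglyMeasurable (fun t => M t i j) freqMeasure) :
    AEStronglyMeasurable (fun t => (M t).det) freqMeasure := by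
  simp only [Matrix.det_apply']
  refine Finset.aestronglyMeasurable_fun_sum _ fun σ _ => ?_
  exact (Finset.aestronglyMeasurable_fun_prod _ fun i _ => hM (σ i) i).const_mul _

/-- Cramer's rule writes the entries as quotients of determinants, which are polynomials in
measurable functions. -/
theorem aestronglyMeasurable_inv {M : ℝ → Matrix (Fin T) (Fin T) ℂ}
    (hM : ∀ i j, AEStronglyMeasurable (fun t => M t i j) freqMeasure) (i j : Fin T) :
    AEStronglyMeasurable (fun t => (M t)⁻¹ i j) freqMeasure := by
  have h : ∀ t, (M t)⁻¹ i j = ((M t).det)⁻¹ * ((M t).updateRow j (Pi.single i 1)).det := by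
    intro t
    rw [Matrix.inv_def, Ring.inverse_eq_inv', Matrix.smul_apply, Matrix.adjugate_apply,
      smul_eq_mul]
  simp only [h]
  refine (aestronglyMeasurable_det hM).aemeasurable.inv.aestronglyMeasurable.mul
    (aestronglyMeasurable_det fun k l => ?_)
  by_cases hk : k = j
  · subst hk
    simpa using aestronglyMeasurable_const
  · simpa [hk] using hM k l

theorem aestronglyMeasurable_matrix_mul {M N : ℝ → Matrix (Fin T) (Fin T) ℂ}
    (hM : ∀ i j, AEStronglyMeasurable (fun t => M t i j) freqMeasure)
    (hN : ∀ i j, AEStronglyMeasurable (fun t => N t i j) freqMeasure) (i j : Fin T) :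
    AEStronglyMeasurable (fun t => (M t * N t) i j) freqMeasure := by
  simp only [Matrix.mul_apply]
  exact Finset.aestronglyMeasurable_fun_sum _ fun k _ => (hM i k).mul (hN k j)

/-- Two densities that satisfy the minimality condition. -/
structure IsMinimalPair (f g : ℝ → Matrix (Fin T) (Fin T) ℂ) : Prop where
  left : IsWeight f
  right : IsWeight g
  minimality : Minimality f g

namespace IsMinimalPair


theorem weight (h : IsMinimalPair f g) : IsWeight (fun t => f t + g t) := h.left.add h.right

theorem ae_good (h : IsMinimalPair f g) : ∀ᵐ t ∂freqMeasure,
    (f t).PosSemidef ∧ (g t).PosSemidef ∧ IsUnit (f t + g t).det := by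
  filter_upwards [h.left.posSemidef, h.right.posSemidef, h.minimality.1] with t h1 h2 h3
  exact ⟨h1, h2, h3⟩

theorem integrable_trace_left (h : IsMinimalPair f g) :
    Integrable (fun t => (f t).trace.re) freqMeasure := by
  have : Integrable (fun t => (f t).trace) freqMeasure :=
    integrable_finsetSum _ fun i _ => h.left.integrable i i
  exact this.re

theorem integrable_trace_inv (h : IsMinimalPair f g) :
    Integrable (fun t => ((f t + g t)⁻¹).trace.re) freqMeasure :=
  Integrable.re (𝕜 := ℂ) h.minimality.2

theorem meas_inv (h : IsMinimalPair f g) (i j : Fin T) :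
    AEStronglyMeasurable (fun t => (f t + g t)⁻¹ i j) freqMeasure :=
  aestronglyMeasurable_inv (fun i j => (h.weight.integrable i j).aestronglyMeasurable) i j

theorem integrable_inv (h : IsMinimalPair f g) (i j : Fin T) :
    Integrable (fun t => (f t + g t)⁻¹ i j) freqMeasure := by
  refine h.integrable_trace_inv.mono' (h.meas_inv i j) ?_
  filter_upwards [h.ae_good] with t ht
  exact norm_entry_le_trace (ht.1.add ht.2.1).inv i j

theorem meas_mul_inv (h : IsMinimalPair f g) (i j : Fin T) :
    AEStronglyMeasurable (fun t => (f t * (f t + g t)⁻¹) i j) freqMeasure :=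
  aestronglyMeasurable_matrix_mul (fun i j => (h.left.integrable i j).aestronglyMeasurable)
    h.meas_inv i j

theorem integrable_mul_inv (h : IsMinimalPair f g) (i j : Fin T) :
    Integrable (fun t => (f t * (f t + g t)⁻¹) i j) freqMeasure := by
  refine (h.integrable_trace_left.add h.integrable_trace_inv).mono' (h.meas_mul_inv i j) ?_
  filter_upwards [h.ae_good] with t ht
  exact norm_mul_inv_entry_le ht.1 ht.2.1 ht.2.2 i j

theorem integrable_parallel (h : IsMinimalPair f g) (i j : Fin T) :
    Integrable (fun t => (f t * (f t + g t)⁻¹ * g t) i j) freqMeasure := by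
  refine h.integrable_trace_left.mono' (aestronglyMeasurable_matrix_mul h.meas_mul_inv
    (fun i j => (h.right.integrable i j).aestronglyMeasurable) i j) ?_
  filter_upwards [h.ae_good] with t ht
  exact norm_parallel_entry_le ht.1 ht.2.1 ht.2.2 i j

theorem inv_isWeight (h : IsMinimalPair f g) : IsWeight (fun t => (f t + g t)⁻¹) :=
  ⟨h.integrable_inv, by
    filter_upwards [h.ae_good] with t ht using (ht.1.add ht.2.1).inv⟩

end IsMinimalPair

theorem integrable_vecMul {C : ℝ} {x : ℝ → Fin T → ℂ}
    (hG : ∀ i j, Integrable (fun t => G t i j) freqMeasure)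
    (hx : AEStronglyMeasurable x freqMeasure) (hC : ∀ t, ‖x t‖ ≤ C) (ν : Fin T) :
    Integrable (fun t => (x t ᵥ* G t) ν) freqMeasure := by
  simp only [Matrix.vecMul, dotProduct]
  exact integrable_finsetSum _ fun i _ => (hG i ν).bdd_mul (c := C)
    ((continuous_apply i).comp_aestronglyMeasurable hx)
    (Eventually.of_forall fun t => (norm_le_pi_norm _ _).trans (hC t))

theorem integrable_expSum_vecMul (hG : ∀ i j, Integrable (fun t => G t i j) freqMeasure)
    (v : S × Fin T → ℂ) (ν : Fin T) :
    Integrable (fun t => (expSum S v t ᵥ* G t) ν) freqMeasure :=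
  integrable_vecMul hG (continuous_expSum S v).aestronglyMeasurable (norm_expSum_le S v) ν

theorem integrable_expSum_form (hG : ∀ i j, Integrable (fun t => G t i j) freqMeasure)
    (u v : S × Fin T → ℂ) :
    Integrable (fun t => expSum S u t ⬝ᵥ (G t *ᵥ star (expSum S v t))) freqMeasure :=
  integrable_form hG (continuous_expSum S u).aestronglyMeasurable
    (continuous_expSum S v).aestronglyMeasurable (norm_expSum_le S u) (norm_expSum_le S v)

theorem exp_neg_eq (n : ℤ) (t : ℝ) : Complex.exp (-(Complex.I * n * t)) =
    Complex.exp (Complex.I * ((-n : ℤ) : ℂ) * t) := by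
  push_cast; ring_nf

theorem integrable_exp_neg_mul {u : ℝ → ℂ} (hu : Integrable u freqMeasure) (z : ℤ) :
    Integrable (fun t : ℝ => Complex.exp (-(Complex.I * z * t)) * u t) freqMeasure := by
  simp only [exp_neg_eq]
  exact integrable_exp_mul hu _

/-- The action of a block Toeplitz matrix through Fourier coefficients. -/
theorem fourierMatrix_mulVec (hG : ∀ i j, Integrable (fun t => G t i j) freqMeasure)
    (v : S × Fin T → ℂ) (p : S × Fin T) :
    (fourierMatrix S G *ᵥ v) p = (1 / (2 * Real.pi) : ℂ) *
      ∫ t, Complex.exp (-(Complex.I * (p.1 : ℤ) * t)) * (expSum S v t ᵥ* G t) p.2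
        ∂freqMeasure := by
  have hI : ∀ q : S × Fin T, Integrable (fun t : ℝ =>
      (G t)ᵀ p.2 q.2 * Complex.exp (Complex.I * (((q.1 : ℤ) : ℂ) - ((p.1 : ℤ) : ℂ)) * t) * v q)
      freqMeasure := fun q => by
    have := (integrable_exp_mul (hG q.2 p.2) ((q.1 : ℤ) - (p.1 : ℤ))).mul_const (v q)
    refine this.congr (Eventually.of_forall fun t => ?_)
    simp only [Matrix.transpose_apply]
    push_cast
    ring
  have h1 : (fourierMatrix S G *ᵥ v) p = (1 / (2 * Real.pi) : ℂ) * ∫ t, ∑ q,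
      (G t)ᵀ p.2 q.2 * Complex.exp (Complex.I * (((q.1 : ℤ) : ℂ) - ((p.1 : ℤ) : ℂ)) * t) * v q
      ∂freqMeasure := by
    rw [integral_finsetSum _ fun q _ => hI q, Finset.mul_sum]
    simp only [Matrix.mulVec, dotProduct, fourierMatrix, Matrix.of_apply, intervalIntegral_eq_freq]
    refine Finset.sum_congr rfl fun q _ => ?_
    rw [integral_mul_const]
    ring
  rw [h1]
  congr 1
  refine integral_congr_ae (Eventually.of_forall fun t => ?_)
  simp only [Matrix.vecMul, dotProduct, expSum, Finset.sum_mul, Finset.mul_sum]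
  rw [Fintype.sum_prod_type_right]
  refine Finset.sum_congr rfl fun i _ => Finset.sum_congr rfl fun j _ => ?_
  have : Complex.exp (Complex.I * (((j : ℤ) : ℂ) - ((p.1 : ℤ) : ℂ)) * t) =
      Complex.exp (Complex.I * (j : ℤ) * t) * Complex.exp (-(Complex.I * (p.1 : ℤ) * t)) := by
    rw [← Complex.exp_add]
    congr 1; ring
  rw [this, Matrix.transpose_apply]
  ring

/-- The form of a block Toeplitz matrix as an integral. -/
theorem star_dotProduct_fourierMatrix (hG : ∀ i j, Integrable (fun t => G t i j) freqMeasure)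
    (u v : S × Fin T → ℂ) :
    star u ⬝ᵥ (fourierMatrix S G *ᵥ v) = (1 / (2 * Real.pi) : ℂ) *
      ∫ t, expSum S v t ⬝ᵥ (G t *ᵥ star (expSum S u t)) ∂freqMeasure := by
  have hI : ∀ p : S × Fin T, Integrable (fun t : ℝ => star (u p) *
      (Complex.exp (-(Complex.I * (p.1 : ℤ) * t)) * (expSum S v t ᵥ* G t) p.2)) freqMeasure :=
    fun p => (integrable_exp_neg_mul (integrable_expSum_vecMul hG v p.2) _).const_mul _
  rw [dotProduct]
  simp only [fourierMatrix_mulVec hG, Pi.star_apply]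
  calc _ = (1 / (2 * Real.pi) : ℂ) * ∫ t, ∑ p, star (u p) *
      (Complex.exp (-(Complex.I * (p.1 : ℤ) * t)) * (expSum S v t ᵥ* G t) p.2) ∂freqMeasure := by
        rw [integral_finsetSum _ fun p _ => hI p, Finset.mul_sum]
        refine Finset.sum_congr rfl fun p _ => ?_
        rw [integral_const_mul]
        ring
    _ = _ := by
        congr 1
        refine integral_congr_ae (Eventually.of_forall fun t => ?_)
        simp only
        rw [Matrix.dotProduct_mulVec, dotProduct, Fintype.sum_prod_type_right]
        refine Finset.sum_congr rfl fun i _ => ?_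
        have hs : star (expSum S u t i) = ∑ j : S, star (u (j, i)) *
            Complex.exp (-(Complex.I * (j : ℤ) * t)) := by
          simp only [expSum, star_sum, star_mul', star_exp_I_mul]
        rw [Pi.star_apply, hs, Finset.mul_sum]
        refine Finset.sum_congr rfl fun j _ => ?_
        ring

theorem eq_zero_of_expSum_ae_eq_zero {v : S × Fin T → ℂ} (hv : expSum S v =ᵐ[freqMeasure] 0) :
    v = 0 := by
  funext p
  have h := integral_exp_mul_expSum S v (-(p.1 : ℤ)) p.2
  have h0 : ∫ t : ℝ, Complex.exp (Complex.I * ((-(p.1 : ℤ) : ℤ) : ℂ) * t) * expSum S v t p.2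
      ∂freqMeasure = 0 := by
    rw [← integral_zero ℝ ℂ (μ := freqMeasure)]
    refine integral_congr_ae ?_
    filter_upwards [hv] with t ht
    simp [ht]
  have hpi : (Real.pi : ℂ) ≠ 0 := by exact_mod_cast Real.pi_ne_zero
  rw [h0] at h
  simpa [hpi] using h.symm

/-- A nonnegative integrand with zero integral vanishes almost everywhere; where a positive
semidefinite form vanishes, the vector is in the kernel, which is trivial by invertibility. -/
theorem ae_eq_zero_of_sqNorm_eq_zero {F : ℝ → Matrix (Fin T) (Fin T) ℂ} {d : ℝ → Fin T → ℂ}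
    (hF : IsWeight F) (hU : ∀ᵐ t ∂freqMeasure, IsUnit (F t).det) (hd : MemL2 F d)
    (h0 : sqNorm F d = 0) : d =ᵐ[freqMeasure] 0 := by
  rw [sqNorm_eq, integral_eq_zero_iff_of_nonneg_ae
    (hF.posSemidef.mono fun t ht => form_re_nonneg ht (d t)) hd.integrable_re] at h0
  filter_upwards [h0, hF.posSemidef, hU] with t h1 h2 h3
  have h4 : star (star (d t)) ⬝ᵥ (F t *ᵥ star (d t)) = 0 := by
    rw [star_star]
    refine Complex.ext h1 ?_
    exact (Complex.le_def.1 (form_nonneg h2 (d t))).2.symm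
  rw [Matrix.PosSemidef.dotProduct_mulVec_zero_iff h2] at h4
  have h5 : (F t)⁻¹ *ᵥ (F t *ᵥ star (d t)) = star (d t) := by
    rw [Matrix.mulVec_mulVec, Matrix.nonsing_inv_mul _ h3, Matrix.one_mulVec]
  rw [h4, Matrix.mulVec_zero] at h5
  simpa using h5.symm

/-- The form of `B` at `v` is, up to `1/(2π)`, the squared norm of the trigonometric polynomial of
`v` in `L₂((f + g)⁻¹)`. If `B v = 0`, this polynomial is zero almost everywhere, and so are its
coefficients. -/
theorem IsMinimalPair.isUnit_det_matB (h : IsMinimalPair f g) (S : Finset ℤ) :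
    IsUnit (matB S f g).det := by
  rw [← Matrix.isUnit_iff_isUnit_det, ← Matrix.mulVec_injective_iff_isUnit]
  rw [← Matrix.coe_mulVecLin, ← LinearMap.ker_eq_bot, LinearMap.ker_eq_bot']
  intro v hv
  rw [Matrix.mulVecLin_apply] at hv
  have h1 := star_dotProduct_fourierMatrix h.integrable_inv v v
  change star v ⬝ᵥ (matB S f g *ᵥ v) = _ at h1
  rw [hv, dotProduct_zero] at h1
  have hm : MemL2 (fun t => (f t + g t)⁻¹) (expSum S v) :=
    ⟨(continuous_expSum S v).aestronglyMeasurable, integrable_expSum_form h.integrable_inv v v⟩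
  refine eq_zero_of_expSum_ae_eq_zero (ae_eq_zero_of_sqNorm_eq_zero h.inv_isWeight ?_ hm ?_)
  · filter_upwards [h.ae_good] with t ht
    exact (Matrix.isUnit_nonsing_inv_det _ ht.2.2)
  · have hpi : (Real.pi : ℂ) ≠ 0 := by exact_mod_cast Real.pi_ne_zero
    have h2 : ∫ t, expSum S v t ⬝ᵥ ((f t + g t)⁻¹ *ᵥ star (expSum S v t)) ∂freqMeasure = 0 := by
      simpa [hpi] using h1.symm
    rw [sqNorm_eq]
    have e := integral_re hm.2
    change ∫ t, (_ : ℂ).re ∂freqMeasure = (_ : ℂ).re at e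
    rw [e]
    exact congrArg Complex.re h2

end Minimal

/-! ### The spectral characteristic and its optimality. -/

section Characteristic

variable {T : ℕ} {f g F : ℝ → Matrix (Fin T) (Fin T) ℂ} {S : Finset ℤ} {a : ℤ → Fin T → ℂ}
  {b : ℝ → Fin T → ℂ}

theorem specChar_apply (S : Finset ℤ) (f g : ℝ → Matrix (Fin T) (Fin T) ℂ)
    (a : ℤ → Fin T → ℂ) (t : ℝ) : specChar S f g a t =
      expSum S (stack S a) t ᵥ* (f t * (f t + g t)⁻¹) -
        expSum S (coeffC S f g a) t ᵥ* (f t + g t)⁻¹ := by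
  rw [specChar, Matrix.sub_vecMul, Matrix.vecMul_vecMul]

theorem memL2Minus_iff : MemL2Minus S F b ↔ MemL2 F b ∧ ∀ ε > 0, ∃ p : ℤ →₀ (Fin T → ℂ),
    (∀ j ∈ S, p j = 0) ∧ sqNorm F (fun t => b t - trigLin (expVec T) p t) < ε := by
  simp only [trigLin_expVec]
  rfl

theorem memL2_expSum (hF : IsWeight F) (v : S × Fin T → ℂ) : MemL2 F (expSum S v) :=
  memL2_of_bounded hF (continuous_expSum S v).aestronglyMeasurable (norm_expSum_le S v)

/-- The Fourier coefficients of a trigonometric polynomial vanish off its frequencies. -/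
theorem integral_exp_mul_trigLin {p : ℤ →₀ (Fin T → ℂ)} {j : ℤ} (hj : p j = 0) (ν : Fin T) :
    ∫ t, Complex.exp (-(Complex.I * j * t)) * trigLin (expVec T) p t ν ∂freqMeasure = 0 := by
  have h1 : ∀ t : ℝ, Complex.exp (-(Complex.I * j * t)) * trigLin (expVec T) p t ν =
      ∑ k ∈ p.support, p k ν * Complex.exp (Complex.I * ((k - j : ℤ) : ℂ) * t) := fun t => by
    rw [trigLin_expVec, trigPoly, Finsupp.sum, Finset.sum_apply, Finset.mul_sum]
    refine Finset.sum_congr rfl fun k _ => ?_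
    rw [Pi.smul_apply, smul_eq_mul, ← mul_assoc, ← Complex.exp_add, mul_comm]
    congr 2
    push_cast; ring
  simp only [h1]
  rw [integral_finsetSum]
  · refine Finset.sum_eq_zero fun k hk => ?_
    rw [integral_const_mul, integral_exp_I_mul, if_neg, mul_zero]
    intro h0
    rw [sub_eq_zero] at h0
    subst h0
    exact (Finsupp.mem_support_iff.1 hk) hj
  · intro k _
    refine Integrable.const_mul ?_ _
    simpa using integrable_exp_mul (u := fun _ => 1) (integrable_const _) (k - j)

namespace IsMinimalPair

theorem integrable_specChar (h : IsMinimalPair f g) (S : Finset ℤ) (a : ℤ → Fin T → ℂ)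
    (ν : Fin T) : Integrable (fun t => specChar S f g a t ν) freqMeasure := by
  simp only [specChar_apply, Pi.sub_apply]
  exact (integrable_expSum_vecMul h.integrable_mul_inv _ ν).sub
    (integrable_expSum_vecMul h.integrable_inv _ ν)

/-- These coefficients are `2π` times the entries of `D a - B c`, so the choice of `c` is exactly
the condition that they vanish. -/
theorem specChar_coeff (h : IsMinimalPair f g) (a : ℤ → Fin T → ℂ) {j : ℤ} (hj : j ∈ S)
    (ν : Fin T) :
    ∫ t, Complex.exp (-(Complex.I * j * t)) * specChar S f g a t ν ∂freqMeasure = 0 := by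
  have hD := fourierMatrix_mulVec h.integrable_mul_inv (stack S a) (⟨j, hj⟩, ν)
  have hB := fourierMatrix_mulVec h.integrable_inv (coeffC S f g a) (⟨j, hj⟩, ν)
  have hBC : matB S f g *ᵥ coeffC S f g a = matD S f g *ᵥ stack S a := by
    rw [coeffC, Matrix.mulVec_mulVec, Matrix.mul_nonsing_inv _ (h.isUnit_det_matB S),
      Matrix.one_mulVec]
  change (matD S f g *ᵥ stack S a) _ = _ at hD
  change (matB S f g *ᵥ coeffC S f g a) _ = _ at hB
  rw [hBC, hD] at hB
  have hpi : (Real.pi : ℂ) ≠ 0 := by exact_mod_cast Real.pi_ne_zero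
  have hB' := mul_left_cancel₀ (by simp [hpi]) hB
  simp only [specChar_apply, Pi.sub_apply, mul_sub]
  rw [integral_sub
    (integrable_exp_neg_mul (integrable_expSum_vecMul h.integrable_mul_inv _ ν) j)
    (integrable_exp_neg_mul (integrable_expSum_vecMul h.integrable_inv _ ν) j), sub_eq_zero]
  exact hB'

/-- The form of `f + g` at the characteristic expands into four forms in bounded exponential sums.
Their matrices `f - f (f + g)⁻¹ g`, `f (f + g)⁻¹`, its adjoint and `(f + g)⁻¹` are all integrable.
-/
theorem memL2_specChar (h : IsMinimalPair f g) (S : Finset ℤ) (a : ℤ → Fin T → ℂ) :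
    MemL2 (fun t => f t + g t) (specChar S f g a) := by
  refine ⟨aestronglyMeasurable_of_pi fun ν => (h.integrable_specChar S a ν).aestronglyMeasurable,
    ?_⟩
  have e1 := integrable_expSum_form (S := S) (fun i j => (h.left.integrable i j).sub
    (h.integrable_parallel i j)) (stack S a) (stack S a)
  have e2 := integrable_expSum_form h.integrable_mul_inv (stack S a) (coeffC S f g a)
  have hWf : ∀ i j, Integrable (fun t => star ((f t * (f t + g t)⁻¹) j i)) freqMeasure :=
    fun i j => (ContinuousLinearMap.integrable_comp
      (Complex.conjCLE : ℂ →L[ℝ] ℂ) (h.integrable_mul_inv j i))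
  have e3 := integrable_expSum_form (G := fun t => (f t * (f t + g t)⁻¹)ᴴ) hWf
    (coeffC S f g a) (stack S a)
  have e4 := integrable_expSum_form h.integrable_inv (coeffC S f g a) (coeffC S f g a)
  refine (((e1.sub e2).sub e3).add e4).congr ?_
  filter_upwards [h.ae_good] with t ht
  have hW := (ht.1.add ht.2.1).inv.isHermitian
  simp only [specChar, Pi.add_apply, Pi.sub_apply]
  rw [specChar_form ht.1 ht.2.1]
  have k : (f t + g t)⁻¹ * (f t + g t) = 1 := Matrix.nonsing_inv_mul _ ht.2.2
  have k' : (f t + g t) * (f t + g t)⁻¹ = 1 := Matrix.mul_nonsing_inv _ ht.2.2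
  have i1 : f t * (f t + g t)⁻¹ * (f t + g t) * (f t + g t)⁻¹ * f t =
      f t - f t * (f t + g t)⁻¹ * g t := by
    rw [mul_assoc (f t), k, mul_one, mul_inv_mul_self ht.2.2]
  have i2 : f t * (f t + g t)⁻¹ * (f t + g t) * (f t + g t)⁻¹ = f t * (f t + g t)⁻¹ := by
    rw [mul_assoc (f t), k, mul_one]
  have i3 : (f t + g t)⁻¹ * (f t + g t) * (f t + g t)⁻¹ * f t = (f t * (f t + g t)⁻¹)ᴴ := by
    rw [k, one_mul, Matrix.conjTranspose_mul, hW.eq, ht.1.isHermitian.eq]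
  have i4 : (f t + g t)⁻¹ * (f t + g t) * (f t + g t)⁻¹ = (f t + g t)⁻¹ := by
    rw [k, one_mul]
  rw [i1, i2, i3, i4]
  rfl

theorem memL2Minus_specChar (h : IsMinimalPair f g) (S : Finset ℤ) (a : ℤ → Fin T → ℂ) :
    MemL2Minus S (fun t => f t + g t) (specChar S f g a) :=
  memL2Minus_iff.2 ⟨h.memL2_specChar S a, fun _ hε =>
    exists_trig_sqNorm_sub_lt h.weight S (h.memL2_specChar S a)
      (fun _ _ ν => h.integrable_specChar S a ν) (fun _ hj ν => h.specChar_coeff a hj ν) hε⟩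

theorem ae_two_mul_norm_apply_le (h : IsMinimalPair f g) (ε : ℝ) (d : ℝ → Fin T → ℂ)
    (ν : Fin T) : ∀ᵐ t ∂freqMeasure, 2 * (|ε| * ‖d t ν‖) ≤
      (d t ⬝ᵥ ((f t + g t) *ᵥ star (d t))).re + ε ^ 2 * ((f t + g t)⁻¹).trace.re := by
  filter_upwards [h.ae_good] with t ht
  exact two_mul_norm_apply_le (ht.1.add ht.2.1) ht.2.2 (d t) ν

/-- This embedding in `L¹` is where the trace condition of minimality makes Fourier coefficients of
general elements meaningful. -/
theorem integrable_of_memL2 (h : IsMinimalPair f g) (hb : MemL2 (fun t => f t + g t) b)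
    (ν : Fin T) : Integrable (fun t => b t ν) freqMeasure := by
  refine (hb.integrable_re.add h.integrable_trace_inv).mono'
    ((continuous_apply ν).comp_aestronglyMeasurable hb.1) ?_
  filter_upwards [h.ae_two_mul_norm_apply_le 1 b ν] with t ht
  simp only [abs_one, one_mul, one_pow] at ht
  simp only [Pi.add_apply]
  linarith [norm_nonneg (b t ν)]

/-- Elements of `L₂^{s-}(f + g)` have vanishing Fourier coefficients on `S`. -/
theorem coeff_eq_zero (h : IsMinimalPair f g) (hb : MemL2Minus S (fun t => f t + g t) b)
    {j : ℤ} (hj : j ∈ S) (ν : Fin T) :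
    ∫ t, Complex.exp (-(Complex.I * j * t)) * b t ν ∂freqMeasure = 0 := by
  obtain ⟨hb, happ⟩ := memL2Minus_iff.1 hb
  set K := ∫ t, ((f t + g t)⁻¹).trace.re ∂freqMeasure
  set z := ∫ t, Complex.exp (-(Complex.I * j * t)) * b t ν ∂freqMeasure
  have hle : ∀ ε > 0, 2 * ‖z‖ ≤ ε * (1 + K) := by
    intro ε hε
    -- The precision `ε²` matches the weight `ε²` on the trace term in the pointwise inequality, so
    -- division by `ε` leaves a bound that tends to zero with `ε`.
    obtain ⟨p, hp, hpε⟩ := happ (ε ^ 2) (by positivity)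
    have hm := MemL2.sub h.weight hb (memL2_trigLin h.weight p)
    have hi := h.integrable_of_memL2 hm ν
    have h1 : z = ∫ t, Complex.exp (-(Complex.I * j * t)) *
        (b t - trigLin (expVec T) p t) ν ∂freqMeasure := by
      simp only [Pi.sub_apply, mul_sub]
      rw [integral_sub (integrable_exp_neg_mul (h.integrable_of_memL2 hb ν) j)
        (integrable_exp_neg_mul (h.integrable_of_memL2 (memL2_trigLin h.weight p) ν) j),
        integral_exp_mul_trigLin (hp j hj) ν, sub_zero]
    have h2 : ‖z‖ ≤ ∫ t, ‖(b t - trigLin (expVec T) p t) ν‖ ∂freqMeasure := by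
      rw [h1]
      refine (norm_integral_le_integral_norm _).trans (le_of_eq ?_)
      refine integral_congr_ae (Eventually.of_forall fun t => ?_)
      simp only [norm_mul, exp_neg_eq, norm_exp_I_mul, one_mul]
    have h3 : 2 * (ε * ∫ t, ‖(b t - trigLin (expVec T) p t) ν‖ ∂freqMeasure) ≤
        ε ^ 2 + ε ^ 2 * K := by
      refine le_trans ?_ (add_le_add_left hpε.le (ε ^ 2 * K))
      rw [sqNorm_eq, ← integral_const_mul, ← integral_const_mul, ← integral_const_mul,
        ← integral_add hm.integrable_re (h.integrable_trace_inv.const_mul _)]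
      refine integral_mono_ae ((hi.norm.const_mul ε).const_mul 2)
        (hm.integrable_re.add (h.integrable_trace_inv.const_mul _)) ?_
      filter_upwards [h.ae_two_mul_norm_apply_le ε
        (fun t => b t - trigLin (expVec T) p t) ν] with t ht
      rw [abs_of_pos hε] at ht
      exact ht
    have h4 : ε * (2 * ‖z‖) ≤ ε * (ε * (1 + K)) := by nlinarith
    exact le_of_mul_le_mul_left h4 hε
  have hz : 2 * ‖z‖ ≤ 0 := by
    refine ge_of_tendsto (x := 𝓝[>] (0 : ℝ)) (f := fun ε => ε * (1 + K)) ?_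
      (eventually_nhdsWithin_of_forall fun ε hε => hle ε hε)
    have : Tendsto (fun ε : ℝ => ε * (1 + K)) (𝓝 0) (𝓝 (0 * (1 + K))) :=
      tendsto_id.mul_const _
    rw [zero_mul] at this
    exact this.mono_left nhdsWithin_le_nhds
  exact norm_le_zero_iff.1 (by linarith)

/-- The mean square error of `b` exceeds that of the spectral characteristic by the squared
distance in `L₂(f + g)`. -/
theorem mse_eq_add (h : IsMinimalPair f g) (hb : MemL2Minus S (fun t => f t + g t) b) :
    mse (expSum S (stack S a)) f g b = mse (expSum S (stack S a)) f g (specChar S f g a) +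
      1 / (2 * Real.pi) * sqNorm (fun t => f t + g t) (fun t => b t - specChar S f g a t) := by
  set H := specChar S f g a with hH
  have hHm : MemL2 (fun t => f t + g t) H := h.memL2_specChar S a
  have hA := memL2_expSum h.left (stack S a)
  have m1 := MemL2.sub h.left hA (hb.1.of_add_left h.left h.right)
  have m2 := hb.1.of_add_right h.left h.right
  have m3 := MemL2.sub h.left hA (hHm.of_add_left h.left h.right)
  have m4 := hHm.of_add_right h.left h.right
  have m5 := MemL2.sub h.weight hb.1 hHm
  have hdi := fun ν => h.integrable_of_memL2 m5 ν
  have hci : ∀ (j : S) (ν : Fin T), Integrable (fun t : ℝ => coeffC S f g a (j, ν) *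
      star (Complex.exp (-(Complex.I * (j : ℤ) * t)) * (b t - H t) ν)) freqMeasure := fun j ν =>
    (ContinuousLinearMap.integrable_comp (Complex.conjCLE : ℂ →L[ℝ] ℂ)
      (integrable_exp_neg_mul (hdi ν) j)).const_mul _
  have hce : ∀ t, expSum S (coeffC S f g a) t ⬝ᵥ star (b t - H t) =
      ∑ ν, ∑ j : S, coeffC S f g a (j, ν) *
        star (Complex.exp (-(Complex.I * (j : ℤ) * t)) * (b t - H t) ν) := by
    intro t
    rw [dotProduct]
    refine Finset.sum_congr rfl fun ν _ => ?_
    rw [expSum, Finset.sum_mul]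
    refine Finset.sum_congr rfl fun j _ => ?_
    rw [star_mul', ← star_exp_I_mul, star_star, mul_assoc]
    rfl
  have hI : Integrable (fun t => expSum S (coeffC S f g a) t ⬝ᵥ star (b t - H t))
      freqMeasure := by
    simp only [hce]
    exact integrable_finsetSum _ fun ν _ => integrable_finsetSum _ fun j _ => hci j ν
  -- The multiplier has frequencies in `S`, while `b` and `H` both have zero coefficients there, so
  -- the first variation vanishes.
  have hzero : ∫ t, expSum S (coeffC S f g a) t ⬝ᵥ star (b t - H t) ∂freqMeasure = 0 := by
    simp only [hce]
    rw [integral_finsetSum _ fun ν _ => integrable_finsetSum _ fun j _ => hci j ν]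
    refine Finset.sum_eq_zero fun ν _ => ?_
    rw [integral_finsetSum _ fun j _ => hci j ν]
    refine Finset.sum_eq_zero fun j _ => ?_
    rw [integral_const_mul]
    have e1 : ∫ t, star (Complex.exp (-(Complex.I * (j : ℤ) * t)) * (b t - H t) ν)
        ∂freqMeasure = star (∫ t, Complex.exp (-(Complex.I * (j : ℤ) * t)) * (b t - H t) ν
        ∂freqMeasure) := integral_conj
    rw [e1]
    simp only [Pi.sub_apply, mul_sub]
    rw [integral_sub (integrable_exp_neg_mul (h.integrable_of_memL2 hb.1 ν) j)
      (integrable_exp_neg_mul (h.integrable_of_memL2 hHm ν) j), h.coeff_eq_zero hb j.2,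
      h.specChar_coeff a j.2, sub_zero, star_zero, mul_zero]
  have hre : ∫ t, 2 * (expSum S (coeffC S f g a) t ⬝ᵥ star (b t - H t)).re ∂freqMeasure = 0 := by
    rw [integral_const_mul]
    have e := integral_re hI
    change ∫ t, (_ : ℂ).re ∂freqMeasure = (_ : ℂ).re at e
    rw [e, hzero, Complex.zero_re, mul_zero]
  have hreI : Integrable (fun t => 2 * (expSum S (coeffC S f g a) t ⬝ᵥ star (b t - H t)).re)
      freqMeasure := Integrable.const_mul hI.re _
  have key : sqNorm f (fun t => expSum S (stack S a) t - b t) + sqNorm g b =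
      sqNorm f (fun t => expSum S (stack S a) t - H t) + sqNorm g H +
        sqNorm (fun t => f t + g t) (fun t => b t - H t) := by
    -- Inserting the vanishing first variation makes the identity hold already between integrands,
    -- where `mse_integrand_add` applies.
    rw [← sub_zero (_ + sqNorm (fun t => f t + g t) _), ← hre]
    simp only [sqNorm_eq]
    rw [← integral_add' m1.integrable_re m2.integrable_re,
      ← integral_add' m3.integrable_re m4.integrable_re,
      ← integral_add' (m3.integrable_re.add m4.integrable_re) m5.integrable_re,
      ← integral_sub' ((m3.integrable_re.add m4.integrable_re).add m5.integrable_re) hreI]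
    refine integral_congr_ae ?_
    filter_upwards [h.ae_good] with t ht
    have hh : H t ᵥ* (f t + g t) = expSum S (stack S a) t ᵥ* f t - expSum S (coeffC S f g a) t :=
      specChar_mul ht.2.2 _ _
    have := mse_integrand_add ht.1 ht.2.1 hh (b t - H t)
    rw [add_sub_cancel] at this
    exact this
  rw [mse, mse, ← mul_add, key]
  ring

theorem isSpectralCharacteristic (h : IsMinimalPair f g) (S : Finset ℤ) (a : ℤ → Fin T → ℂ) :
    IsSpectralCharacteristic S (expSum S (stack S a)) f g (specChar S f g a) := by
  refine ⟨h.memL2Minus_specChar S a, fun b hb => ?_⟩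
  rw [h.mse_eq_add hb]
  have := sqNorm_nonneg h.weight (fun t => b t - specChar S f g a t)
  have : 0 ≤ 1 / (2 * Real.pi) *
    sqNorm (fun t => f t + g t) (fun t => b t - specChar S f g a t) := by positivity
  linarith

/-- Two minimizers have equal error, so the surplus in `mse_eq_add` is zero, and invertibility of `f
+ g` makes the seminorm definite up to null sets. -/
theorem eq_specChar (h : IsMinimalPair f g)
    (hb : IsSpectralCharacteristic S (expSum S (stack S a)) f g b) :
    b =ᵐ[freqMeasure] specChar S f g a := by
  have h1 := hb.2 _ (h.memL2Minus_specChar S a)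
  rw [h.mse_eq_add hb.1] at h1
  have h2 := sqNorm_nonneg h.weight (fun t => b t - specChar S f g a t)
  have hp : 0 < 1 / (2 * Real.pi) := by positivity
  have h3 : sqNorm (fun t => f t + g t) (fun t => b t - specChar S f g a t) = 0 := by
    refine le_antisymm ?_ h2
    by_contra hlt
    have := mul_pos hp (not_le.1 hlt)
    linarith
  have h4 := ae_eq_zero_of_sqNorm_eq_zero h.weight h.minimality.1
    (MemL2.sub h.weight hb.1.1 (h.memL2_specChar S a)) h3
  filter_upwards [h4] with t ht
  exact sub_eq_zero.1 ht

theorem mse_specChar (h : IsMinimalPair f g) (S : Finset ℤ) (a : ℤ → Fin T → ℂ) :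
    ((mse (expSum S (stack S a)) f g (specChar S f g a) : ℝ) : ℂ) =
      star (stack S a) ⬝ᵥ (matR S f g *ᵥ stack S a) +
        star (coeffC S f g a) ⬝ᵥ (matB S f g *ᵥ coeffC S f g a) := by
  have hR := star_dotProduct_fourierMatrix h.integrable_parallel (stack S a) (stack S a)
  have hB := star_dotProduct_fourierMatrix h.integrable_inv (coeffC S f g a) (coeffC S f g a)
  have hHm := h.memL2_specChar S a
  have m3 := MemL2.sub h.left (memL2_expSum h.left (stack S a)) (hHm.of_add_left h.left h.right)
  have m4 := hHm.of_add_right h.left h.right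
  have hof : ∀ {F : ℝ → Matrix (Fin T) (Fin T) ℂ} {d : ℝ → Fin T → ℂ}, IsWeight F →
      ((sqNorm F d : ℝ) : ℂ) = ∫ t, d t ⬝ᵥ (F t *ᵥ star (d t)) ∂freqMeasure := by
    intro F d hF
    rw [sqNorm_eq, ← integral_complex_ofReal]
    refine integral_congr_ae ?_
    filter_upwards [hF.posSemidef] with t ht
    exact Complex.ext (Complex.ofReal_re _)
      ((Complex.ofReal_im _).trans (Complex.le_def.1 (form_nonneg ht (d t))).2)
  change _ = star (stack S a) ⬝ᵥ (fourierMatrix S _ *ᵥ stack S a) +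
        star (coeffC S f g a) ⬝ᵥ (fourierMatrix S _ *ᵥ coeffC S f g a)
  rw [hR, hB, ← mul_add, ← integral_add (integrable_expSum_form h.integrable_parallel _ _)
    (integrable_expSum_form h.integrable_inv _ _), mse, ← mul_add, Complex.ofReal_mul,
    Complex.ofReal_add, hof h.left, hof h.right, ← integral_add m3.2 m4.2]
  push_cast
  congr 1
  refine integral_congr_ae ?_
  filter_upwards [h.ae_good] with t ht
  exact mse_integrand_eq ht.1 ht.2.1 ht.2.2 _ _

end IsMinimalPair

end Characteristic

/-! ### The optimal estimate as a stochastic integral. -/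

section Estimate

variable {T : ℕ} {f g : ℝ → Matrix (Fin T) (Fin T) ℂ} {S : Finset ℤ} {a : ℤ → Fin T → ℂ}
  {b c : ℝ → Fin T → ℂ} {Ω : Type*} [MeasurableSpace Ω] {P : Measure Ω}
  {ξ η : ℤ → Fin T → Ω → ℂ} {Zξ Zη : Fin T → VectorMeasure ℝ (Lp ℂ 2 P)} {U V : Lp ℂ 2 P}

theorem sqNorm_le_add_left (hf : IsWeight f) (hg : IsWeight g)
    (hb : MemL2 (fun t => f t + g t) b) : sqNorm f b ≤ sqNorm (fun t => f t + g t) b := by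
  rw [sqNorm_add (hb.of_add_left hf hg) (hb.of_add_right hf hg)]
  linarith [sqNorm_nonneg hg b]

theorem sqNorm_le_add_right (hf : IsWeight f) (hg : IsWeight g)
    (hb : MemL2 (fun t => f t + g t) b) : sqNorm g b ≤ sqNorm (fun t => f t + g t) b := by
  rw [sqNorm_add (hb.of_add_left hf hg) (hb.of_add_right hf hg)]
  linarith [sqNorm_nonneg hf b]

/-- A stochastic integral is a limit of finite linear combinations of the sequence. -/
theorem IsOrthogonalMeasureOf.exists_tendsto (hf : IsWeight f)
    (hZ : IsOrthogonalMeasureOf Zξ ξ f) (hξ : ∀ n ν, MemLp (ξ n ν) 2 P)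
    (hU : HasExtension f (simpleCoe T) (simpleIntegralₗ Zξ) b U) :
    ∃ p : ℕ → ℤ →₀ (Fin T → ℂ),
      Tendsto (fun k => trigLin (fun n ν => (hξ n ν).toLp (ξ n ν)) (p k)) atTop (𝓝 U) := by
  choose p hp using fun k : ℕ => exists_trig_sqNorm_sub_lt' hf hU.1
    (Nat.one_div_pos_of_nat (α := ℝ) (n := k))
  refine ⟨p, hU.tendsto hf (isIsometric_simpleIntegral hf hZ.covariance)
    (fun k => hZ.hasExtension_trig hf hξ (p k)) ?_⟩
  exact squeeze_zero (fun n => sqNorm_nonneg hf _) (fun n => (hp n).le)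
    tendsto_one_div_add_atTop_nhds_zero_nat

theorem inner_trigLin_eq_zero {K : Type*} [NormedAddCommGroup K] [InnerProductSpace ℂ K]
    {x y : ℤ → Fin T → K} (h : ∀ n m ν μ, inner ℂ (x n ν) (y m μ) = 0)
    (p q : ℤ →₀ (Fin T → ℂ)) : inner ℂ (trigLin x p) (trigLin y q) = 0 := by
  rw [trigLin_apply, trigLin_apply, sum_inner]
  refine Finset.sum_eq_zero fun j _ => ?_
  rw [sum_inner]
  refine Finset.sum_eq_zero fun ν _ => ?_
  rw [inner_sum]
  refine Finset.sum_eq_zero fun k _ => ?_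
  rw [inner_sum]
  refine Finset.sum_eq_zero fun μ _ => ?_
  rw [inner_smul_left, inner_smul_right, h, mul_zero, mul_zero]

/-- Each integral is a limit of finite combinations of its own sequence, and combinations of
uncorrelated sequences are orthogonal. -/
theorem inner_stochIntegral_eq_zero (hf : IsWeight f) (hg : IsWeight g)
    (hZξ : IsOrthogonalMeasureOf Zξ ξ f) (hZη : IsOrthogonalMeasureOf Zη η g)
    (hξ : ∀ n ν, MemLp (ξ n ν) 2 P) (hη : ∀ n ν, MemLp (η n ν) 2 P)
    (hξη : ∀ n m ν μ, ∫ ω, ξ n ν ω * conj (η m μ ω) ∂P = 0)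
    (hU : HasExtension f (simpleCoe T) (simpleIntegralₗ Zξ) b U)
    (hV : HasExtension g (simpleCoe T) (simpleIntegralₗ Zη) c V) : inner ℂ U V = 0 := by
  obtain ⟨p, hp⟩ := hZξ.exists_tendsto hf hξ hU
  obtain ⟨q, hq⟩ := hZη.exists_tendsto hg hη hV
  have h := hq.inner (𝕜 := ℂ) hp
  have h0 : ∀ k, inner ℂ (trigLin (fun n ν => (hη n ν).toLp (η n ν)) (q k))
      (trigLin (fun n ν => (hξ n ν).toLp (ξ n ν)) (p k)) = 0 := fun k => by
    refine inner_trigLin_eq_zero (fun n m ν μ => ?_) _ _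
    rw [inner_Lp_eq, ← hξη m n μ ν]
    refine integral_congr_ae ?_
    filter_upwards [(hξ m μ).coeFn_toLp, (hη n ν).coeFn_toLp] with ω h1 h2
    rw [h1, h2]
  simp only [h0] at h
  rw [inner_eq_zero_symm]
  exact (tendsto_nhds_unique tendsto_const_nhds h).symm

theorem simpleIntegral_add (φ : SimpleFunc ℝ (Fin T → ℂ)) :
    simpleIntegral (Zξ + Zη) φ = simpleIntegral Zξ φ + simpleIntegral Zη φ := by
  simp [simpleIntegral, Finset.sum_add_distrib]

/-- The seminorms of `L₂(f)` and `L₂(g)` are dominated by that of `L₂(f + g)`, so one sequence of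
simple functions serves both measures. The covariance of the sum measure is not needed. -/
theorem HasStochIntegral.add_measure (hf : IsWeight f) (hg : IsWeight g)
    (hZξ : IsOrthogonalMeasureOf Zξ ξ f) (hZη : IsOrthogonalMeasureOf Zη η g)
    (hb : MemL2 (fun t => f t + g t) b)
    (hU : HasExtension f (simpleCoe T) (simpleIntegralₗ Zξ) b U)
    (hV : HasExtension g (simpleCoe T) (simpleIntegralₗ Zη) b V) :
    HasStochIntegral (Zξ + Zη) (fun t => f t + g t) b (U + V) := by
  have hF := hf.add hg
  have hIf := isIsometric_simpleIntegral hf hZξ.covariance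
  have hIg := isIsometric_simpleIntegral hg hZη.covariance
  choose φ hφ using fun k : ℕ => exists_simple_sqNorm_sub_lt hF hb
    (Nat.one_div_pos_of_nat (α := ℝ) (n := k))
  have h0 : Tendsto (fun k => sqNorm (fun t => f t + g t) (fun t => b t - φ k t)) atTop (𝓝 0) :=
    squeeze_zero (fun n => sqNorm_nonneg hF _) (fun n => (hφ n).le)
      tendsto_one_div_add_atTop_nhds_zero_nat
  have hm := fun k => MemL2.sub hF hb (memL2_simple hF (φ k))
  refine ⟨hb, φ, h0, ?_⟩
  simp only [simpleIntegral_add]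
  refine Tendsto.add ?_ ?_
  · exact hU.tendsto hf hIf (fun k => HasExtension.of_apply hIf (φ k))
      (squeeze_zero (fun n => sqNorm_nonneg hf _)
        (fun n => sqNorm_le_add_left hf hg (hm n)) h0)
  · exact hV.tendsto hg hIg (fun k => HasExtension.of_apply hIg (φ k))
      (squeeze_zero (fun n => sqNorm_nonneg hg _)
        (fun n => sqNorm_le_add_right hf hg (hm n)) h0)

/-- The mean square error of a stochastic integral. -/
theorem norm_sq_sub_eq_mse (hf : IsWeight f) (hg : IsWeight g)
    (hZξ : IsOrthogonalMeasureOf Zξ ξ f) (hZη : IsOrthogonalMeasureOf Zη η g)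
    (hξ : ∀ n ν, MemLp (ξ n ν) 2 P) (hη : ∀ n ν, MemLp (η n ν) 2 P)
    (hξη : ∀ n m ν μ, ∫ ω, ξ n ν ω * conj (η m μ ω) ∂P = 0) {A : ℝ → Fin T → ℂ} {X : Lp ℂ 2 P}
    (hX : HasExtension f (simpleCoe T) (simpleIntegralₗ Zξ) A X)
    (hU : HasExtension f (simpleCoe T) (simpleIntegralₗ Zξ) b U)
    (hV : HasExtension g (simpleCoe T) (simpleIntegralₗ Zη) b V) :
    ‖X - (U + V)‖ ^ 2 = mse A f g b := by
  have hIf := isIsometric_simpleIntegral hf hZξ.covariance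
  have hIg := isIsometric_simpleIntegral hg hZη.covariance
  have h1 := hX.sub hf hIf hU
  have h2 := inner_stochIntegral_eq_zero hf hg hZξ hZη hξ hη hξη h1 hV
  have h3 := @norm_sub_sq ℂ _ _ _ _ (X - U) V
  rw [h2, map_zero, mul_zero, sub_zero, h1.norm_sq hf hIf, hV.norm_sq hg hIg] at h3
  rw [← sub_sub, h3, mse]

/-- Trigonometric polynomials with frequencies outside `S` give the span of the observations. -/
theorem span_observations_le (hξ : ∀ n ν, MemLp (ξ n ν) 2 P) (hη : ∀ n ν, MemLp (η n ν) 2 P)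
    {Y : Lp ℂ 2 P}
    (hY : Y ∈ Submodule.span ℂ {Y : Lp ℂ 2 P | ∃ p ∈ {p : ℤ × Fin T | p.1 ∉ S},
      Y =ᵐ[P] fun ω => ξ p.1 p.2 ω + η p.1 p.2 ω}) :
    ∃ p : ℤ →₀ (Fin T → ℂ), (∀ j ∈ S, p j = 0) ∧
      Y = trigLin (fun n ν => (hξ n ν).toLp (ξ n ν)) p +
        trigLin (fun n ν => (hη n ν).toLp (η n ν)) p := by
  induction hY using Submodule.span_induction with
  | mem Y hY =>
    obtain ⟨⟨j, ν⟩, hj, hY⟩ := hY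
    refine ⟨Finsupp.single j (Pi.single ν 1), fun i hi => ?_, ?_⟩
    · rw [Finsupp.single_eq_of_ne]
      rintro rfl
      exact hj hi
    · rw [trigLin_single, trigLin_single]
      refine Lp.ext (hY.trans ?_)
      filter_upwards [(hξ j ν).coeFn_toLp, (hη j ν).coeFn_toLp,
        Lp.coeFn_add ((hξ j ν).toLp (ξ j ν)) ((hη j ν).toLp (η j ν))] with ω h1 h2 h3
      rw [h3, Pi.add_apply, h1, h2]
  | zero => exact ⟨0, fun _ _ => rfl, by simp⟩
  | add Y Y' _ _ ih ih' =>
    obtain ⟨p, hp, rfl⟩ := ih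
    obtain ⟨q, hq, rfl⟩ := ih'
    refine ⟨p + q, fun j hj => by simp [hp j hj, hq j hj], ?_⟩
    rw [map_add, map_add]
    abel
  | smul z Y _ ih =>
    obtain ⟨p, hp, rfl⟩ := ih
    exact ⟨z • p, fun j hj => by simp [hp j hj], by rw [map_smul, map_smul, smul_add]⟩

theorem trigLin_mem_span (hξ : ∀ n ν, MemLp (ξ n ν) 2 P) (hη : ∀ n ν, MemLp (η n ν) 2 P)
    {p : ℤ →₀ (Fin T → ℂ)} (hp : ∀ j ∈ S, p j = 0) :
    trigLin (fun n ν => (hξ n ν).toLp (ξ n ν)) p +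
        trigLin (fun n ν => (hη n ν).toLp (η n ν)) p ∈
      Submodule.span ℂ {Y : Lp ℂ 2 P | ∃ p ∈ {p : ℤ × Fin T | p.1 ∉ S},
        Y =ᵐ[P] fun ω => ξ p.1 p.2 ω + η p.1 p.2 ω} := by
  rw [trigLin_apply, trigLin_apply, ← Finset.sum_add_distrib]
  refine Submodule.sum_mem _ fun j hj => ?_
  rw [← Finset.sum_add_distrib]
  refine Submodule.sum_mem _ fun ν _ => ?_
  rw [← smul_add]
  refine Submodule.smul_mem _ _ (Submodule.subset_span ⟨(j, ν), fun hjS => ?_, ?_⟩)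
  · exact (Finsupp.mem_support_iff.1 hj) (hp j hjS)
  · filter_upwards [(hξ j ν).coeFn_toLp, (hη j ν).coeFn_toLp,
      Lp.coeFn_add ((hξ j ν).toLp (ξ j ν)) ((hη j ν).toLp (η j ν))] with ω h1 h2 h3
    rw [h3, Pi.add_apply, h1, h2]

theorem integral_norm_sub_sq {A : Ω → ℂ} {X : Lp ℂ 2 P} (hX : X =ᵐ[P] A) (Y : Lp ℂ 2 P) :
    ∫ ω, ‖A ω - Y ω‖ ^ 2 ∂P = ‖X - Y‖ ^ 2 := by
  have h := norm_toLp_sq (Lp.memLp (X - Y))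
  rw [Lp.toLp_coeFn] at h
  rw [h]
  refine integral_congr_ae ?_
  filter_upwards [hX, Lp.coeFn_sub X Y] with ω h1 h2
  rw [h2, Pi.sub_apply, h1]

/-- Nearest points of a subspace are unique. -/
theorem eq_of_forall_norm_sub_le {K : Type*} [NormedAddCommGroup K] [InnerProductSpace ℂ K]
    {H : Submodule ℂ K} {X Y Y' : K} (hY : Y ∈ H) (hY' : Y' ∈ H)
    (h : ∀ W ∈ H, ‖X - Y‖ ^ 2 ≤ ‖X - W‖ ^ 2) (h' : ‖X - Y'‖ ^ 2 ≤ ‖X - Y‖ ^ 2) : Y' = Y := by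
  have hm : (1 / 2 : ℂ) • (Y + Y') ∈ H := H.smul_mem _ (H.add_mem hY hY')
  have h1 := h _ hm
  have h2 := parallelogram_law_with_norm ℂ (X - Y) (X - Y')
  have e1 : X - Y + (X - Y') = (2 : ℂ) • (X - (1 / 2 : ℂ) • (Y + Y')) := by
    rw [smul_sub, smul_smul]
    norm_num
    rw [two_smul]
    abel
  have e2 : X - Y - (X - Y') = Y' - Y := by abel
  rw [e1, e2, norm_smul] at h2
  have h3 : ‖Y' - Y‖ ^ 2 ≤ 0 := by
    have h4 : ‖(2 : ℂ)‖ = 2 := by simp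
    rw [h4, mul_pow] at h2
    linarith
  have h4 : ‖Y' - Y‖ = 0 := by
    have := sq_nonneg ‖Y' - Y‖
    exact pow_eq_zero_iff two_ne_zero |>.1 (le_antisymm h3 this)
  exact sub_eq_zero.1 (norm_eq_zero.1 h4)

/-- The optimal estimate as a stochastic integral of the spectral characteristic. -/
theorem IsMinimalPair.exists_optimalEstimate (h : IsMinimalPair f g)
    (hZξ : IsOrthogonalMeasureOf Zξ ξ f) (hZη : IsOrthogonalMeasureOf Zη η g)
    (hξ : ∀ n ν, MemLp (ξ n ν) 2 P) (hη : ∀ n ν, MemLp (η n ν) 2 P)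
    (hξη : ∀ n m ν μ, ∫ ω, ξ n ν ω * conj (η m μ ω) ∂P = 0)
    {A : Ω → ℂ} {X : Lp ℂ 2 P} (hA : X =ᵐ[P] A)
    (hX : HasExtension f (simpleCoe T) (simpleIntegralₗ Zξ) (expSum S (stack S a)) X) :
    ∃ Y : Lp ℂ 2 P,
      HasStochIntegral (Zξ + Zη) (fun t => f t + g t) (specChar S f g a) Y ∧
      (∀ Y' : Lp ℂ 2 P, IsOptimalEstimate
          (closedSpan P (fun (p : ℤ × Fin T) ω => ξ p.1 p.2 ω + η p.1 p.2 ω) {p | p.1 ∉ S})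
          A Y' ↔ Y' = Y) ∧
      ∫ ω, ‖A ω - Y ω‖ ^ 2 ∂P = mse (expSum S (stack S a)) f g (specChar S f g a) := by
  have hf := h.left
  have hg := h.right
  have hIf := isIsometric_simpleIntegral hf hZξ.covariance
  have hIg := isIsometric_simpleIntegral hg hZη.covariance
  have hH := h.memL2Minus_specChar S a
  obtain ⟨U, hU⟩ := exists_hasStochIntegral hf hZξ.covariance (hH.1.of_add_left hf hg)
  obtain ⟨V, hV⟩ := exists_hasStochIntegral hg hZη.covariance (hH.1.of_add_right hf hg)
  rw [hasStochIntegral_iff] at hU hV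
  have herr := norm_sq_sub_eq_mse hf hg hZξ hZη hξ hη hξη hX hU hV
  -- Admissible polynomials converging to the characteristic in `L₂(f + g)` converge in `L₂(f)` and
  -- `L₂(g)` too. Their integrals against the two measures add up to combinations of the
  -- observations.
  have hmem : U + V ∈
      closedSpan P (fun (p : ℤ × Fin T) ω => ξ p.1 p.2 ω + η p.1 p.2 ω) {p | p.1 ∉ S} := by
    choose p hpS hp using fun k : ℕ => (memL2Minus_iff.1 hH).2 _
      (Nat.one_div_pos_of_nat (α := ℝ) (n := k))
    have h0 : Tendsto (fun k => sqNorm (fun t => f t + g t)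
        (fun t => specChar S f g a t - trigLin (expVec T) (p k) t)) atTop (𝓝 0) :=
      squeeze_zero (fun n => sqNorm_nonneg h.weight _) (fun n => (hp n).le)
        tendsto_one_div_add_atTop_nhds_zero_nat
    have hm := fun k => MemL2.sub h.weight hH.1 (memL2_trigLin h.weight (p k))
    have t1 := hU.tendsto hf hIf (fun k => hZξ.hasExtension_trig hf hξ (p k))
      (squeeze_zero (fun n => sqNorm_nonneg hf _)
        (fun n => sqNorm_le_add_left hf hg (hm n)) h0)
    have t2 := hV.tendsto hg hIg (fun k => hZη.hasExtension_trig hg hη (p k))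
      (squeeze_zero (fun n => sqNorm_nonneg hg _)
        (fun n => sqNorm_le_add_right hf hg (hm n)) h0)
    rw [closedSpan, ← SetLike.mem_coe, Submodule.topologicalClosure_coe]
    exact mem_closure_of_tendsto (t1.add t2)
      (Eventually.of_forall fun k => trigLin_mem_span hξ hη (hpS k))
  -- The inequality is closed in `W`, so only finite combinations of observations matter. Such a
  -- combination has the error `mse` of its polynomial, itself a competitor in the spectral problem.
  have hmin : ∀ W ∈ closedSpan P (fun (p : ℤ × Fin T) ω => ξ p.1 p.2 ω + η p.1 p.2 ω)
      {p | p.1 ∉ S}, ‖X - (U + V)‖ ^ 2 ≤ ‖X - W‖ ^ 2 := by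
    intro W hW
    rw [closedSpan, ← SetLike.mem_coe, Submodule.topologicalClosure_coe] at hW
    have hcl : IsClosed {W : Lp ℂ 2 P | ‖X - (U + V)‖ ^ 2 ≤ ‖X - W‖ ^ 2} :=
      isClosed_le continuous_const (by fun_prop)
    refine closure_minimal (fun W hW => ?_) hcl hW
    obtain ⟨p, hp, rfl⟩ := span_observations_le hξ hη hW
    rw [Set.mem_ofPred_eq, herr, norm_sq_sub_eq_mse hf hg hZξ hZη hξ hη hξη hX
      (hZξ.hasExtension_trig hf hξ p) (hZη.hasExtension_trig hg hη p)]
    refine (h.isSpectralCharacteristic S a).2 _ (memL2Minus_iff.2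
      ⟨memL2_trigLin h.weight p, fun ε hε => ⟨p, hp, ?_⟩⟩)
    simpa [sqNorm_zero] using hε
  refine ⟨U + V, HasStochIntegral.add_measure hf hg hZξ hZη hH.1 hU hV, fun Y' => ?_, ?_⟩
  · constructor
    · rintro ⟨hY', hopt⟩
      have := hopt _ hmem
      rw [integral_norm_sub_sq hA, integral_norm_sub_sq hA] at this
      exact eq_of_forall_norm_sub_le hmem hY' hmin this
    · rintro rfl
      refine ⟨hmem, fun W hW => ?_⟩
      rw [integral_norm_sub_sq hA, integral_norm_sub_sq hA]
      exact hmin W hW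
  · rw [integral_norm_sub_sq hA, herr]

end Estimate

/-! ### Reduction to blocked sequences. -/

section Blocks

variable {Ω : Type*} [MeasurableSpace Ω] {P : Measure Ω} {T s : ℕ} {N K NT KT : ℕ → ℕ}
  {X Y : ℤ → Ω → ℂ}

theorem IsPC.covariance_add_mul (hX : IsPC P T X) (k n m : ℤ) :
    ∫ ω, X (n + k * T) ω * conj (X (m + k * T) ω) ∂P = ∫ ω, X n ω * conj (X m ω) ∂P := by
  induction k using Int.induction_on with
  | zero => simp
  | succ i ih =>
    rw [← ih, ← hX.periodic (n + i * T) (m + i * T)]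
    simp only [add_mul, one_mul, add_assoc]
  | pred i ih =>
    rw [← ih, ← hX.periodic (n + (-i - 1) * T) (m + (-i - 1) * T)]
    have e : ∀ n : ℤ, n + (-(i : ℤ) - 1) * T + T = n + -(i : ℤ) * T := fun n => by ring
    rw [e, e]

theorem IsPC.isStationary_block (hX : IsPC P T X) : IsStationary P (block T X) where
  memLp n ν := hX.memLp _
  mean_zero n ν := hX.mean_zero _
  covariance := by
    refine ⟨fun k => Matrix.of fun ν μ =>
      ∫ ω, X (k * T + ((ν : ℕ) + 1)) ω * conj (X ((μ : ℕ) + 1) ω) ∂P, fun n m ν μ => ?_⟩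
    change _ = ∫ ω, X ((n - m) * T + ((ν : ℕ) + 1)) ω * conj (X ((μ : ℕ) + 1) ω) ∂P
    rw [← hX.covariance_add_mul m ((n - m) * T + ((ν : ℕ) + 1))]
    have e1 : (n - m) * (T : ℤ) + ((ν : ℕ) + 1) + m * T = n * T + ((ν : ℕ) + 1) := by ring
    have e2 : ((μ : ℕ) + 1 : ℤ) + m * T = m * T + ((μ : ℕ) + 1) := by ring
    rw [e1, e2]
    rfl

theorem block_index_surj (hT : 0 < T) (j : ℤ) : ∃ (k : ℤ) (ν : Fin T), k * T + ((ν : ℕ) + 1) = j := by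
  have hT' : (0 : ℤ) < T := by exact_mod_cast hT
  have h0 := Int.emod_nonneg (j - 1) hT'.ne'
  have h1 := Int.emod_lt_of_pos (j - 1) hT'
  -- Positions in a block count from one and `ν` from zero, hence it is `j - 1` that is divided by
  -- `T`.
  refine ⟨(j - 1) / T, ⟨((j - 1) % T).toNat, by omega⟩, ?_⟩
  have h2 := Int.ediv_mul_add_emod (j - 1) T
  simp only [Int.toNat_of_nonneg h0]
  linarith

/-- The index `T m + 1` is the first of block `m`, so comparison with it depends on the block number
only. Membership in a gap and uniqueness of the block number both reduce to this. -/
theorem block_index_le_iff {m k : ℤ} (ν : Fin T) :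
    T * m + 1 ≤ k * T + ((ν : ℕ) + 1) ↔ m ≤ k := by
  have h1 : ((ν : ℕ) : ℤ) < T := by exact_mod_cast ν.2
  have h0 : (0 : ℤ) ≤ (ν : ℕ) := by positivity
  constructor
  · intro h
    by_contra hk
    have : (k + 1) * (T : ℤ) ≤ m * T := mul_le_mul_of_nonneg_right (by omega) (by omega)
    linarith
  · intro h
    have : m * (T : ℤ) ≤ k * T := mul_le_mul_of_nonneg_right h (by omega)
    linarith

theorem block_index_mem_iff {m n k : ℤ} (ν : Fin T) :
    k * T + ((ν : ℕ) + 1) ∈ Finset.Icc (T * m + 1) (T * m + T * n) ↔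
      k ∈ Finset.Ico m (m + n) := by
  have h := block_index_le_iff (m := m + n) (k := k) ν
  rw [Finset.mem_Icc, Finset.mem_Ico, block_index_le_iff]
  refine and_congr_right fun _ => ?_
  rw [← not_le, ← h, not_le, mul_add]
  omega

theorem block_index_inj {k k' : ℤ} {ν ν' : Fin T}
    (h : k * T + (((ν : ℕ) : ℤ) + 1) = k' * T + (((ν' : ℕ) : ℤ) + 1)) : k = k' ∧ ν = ν' := by
  have hk : k = k' := by
    refine le_antisymm ?_ ?_
    · rw [← block_index_le_iff (T := T) ν', ← h]
      exact (block_index_le_iff ν).2 le_rfl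
    · rw [← block_index_le_iff (T := T) ν, h]
      exact (block_index_le_iff ν').2 le_rfl
  subst hk
  refine ⟨rfl, Fin.ext ?_⟩
  omega

theorem sum_Icc_eq_sum_blocks (hT : 0 < T) (m n : ℤ) (φ : ℤ → ℂ) :
    ∑ j ∈ Finset.Icc (T * m + 1) (T * m + T * n), φ j =
      ∑ k ∈ Finset.Ico m (m + n), ∑ ν : Fin T, φ (k * T + ((ν : ℕ) + 1)) := by
  rw [← Finset.sum_product']
  symm
  refine Finset.sum_bij (fun p _ => p.1 * T + ((p.2 : ℕ) + 1)) ?_ ?_ ?_ ?_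
  · rintro ⟨k, ν⟩ hp
    exact (block_index_mem_iff ν).2 (Finset.mem_product.1 hp).1
  · rintro ⟨k, ν⟩ _ ⟨k', ν'⟩ _ h
    obtain ⟨rfl, rfl⟩ := block_index_inj h
    rfl
  · intro j hj
    obtain ⟨k, ν, rfl⟩ := block_index_surj hT j
    exact ⟨(k, ν), Finset.mem_product.2 ⟨(block_index_mem_iff ν).1 hj, Finset.mem_univ _⟩, rfl⟩
  · intro p _
    rfl

/-- For `l < s` the sum contains `K` only up to index `s - 1`, the range in which divisibility is
given. -/
theorem blockStart_eq_mul (hN : ∀ k ≤ s, N k = T * NT k) (hK : ∀ k < s, K k = T * KT k) {l : ℕ}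
    (hl : l < s) : blockStart N K l = T * blockStart NT KT l := by
  rw [blockStart, blockStart, Finset.mul_sum]
  refine Finset.sum_congr rfl fun k hk => ?_
  have : k ≤ l := by simpa [Nat.lt_succ_iff] using hk
  rw [hN k (by omega), hK k (by omega), mul_add]

theorem block_Icc_eq (hN : ∀ k ≤ s, N k = T * NT k) (hK : ∀ k < s, K k = T * KT k) {l : ℕ}
    (hl : l < s) :
    Finset.Icc ((blockStart N K l : ℤ) + 1) ((blockStart N K l : ℤ) + N (l + 1)) =
      Finset.Icc ((T : ℤ) * blockStart NT KT l + 1)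
        ((T : ℤ) * blockStart NT KT l + T * NT (l + 1)) := by
  rw [blockStart_eq_mul hN hK hl, hN (l + 1) hl]
  push_cast
  rfl

theorem block_mem_missing_iff (hN : ∀ k ≤ s, N k = T * NT k) (hK : ∀ k < s, K k = T * KT k)
    (k : ℤ) (ν : Fin T) :
    k * T + ((ν : ℕ) + 1) ∈ missing N K s ↔ k ∈ missingBlocks NT KT s := by
  simp only [missing, missingBlocks, Finset.mem_biUnion, Finset.mem_range]
  refine exists_congr fun l => and_congr_right fun hl => ?_
  rw [block_Icc_eq hN hK hl, block_index_mem_iff]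

theorem closedSpan_block_eq (hT : 0 < T) (hN : ∀ k ≤ s, N k = T * NT k)
    (hK : ∀ k < s, K k = T * KT k) :
    closedSpan P (fun j ω => X j ω + Y j ω) {j | j ∉ missing N K s} =
      closedSpan P (fun (p : ℤ × Fin T) ω => block T X p.1 p.2 ω + block T Y p.1 p.2 ω)
        {p | p.1 ∉ missingBlocks NT KT s} := by
  unfold closedSpan
  congr 2
  ext W
  constructor
  · rintro ⟨j, hj, hW⟩
    obtain ⟨k, ν, rfl⟩ := block_index_surj hT j
    exact ⟨(k, ν), fun h => hj ((block_mem_missing_iff hN hK k ν).2 h), hW⟩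
  · rintro ⟨⟨k, ν⟩, hk, hW⟩
    exact ⟨k * T + ((ν : ℕ) + 1), fun h => hk ((block_mem_missing_iff hN hK k ν).1 h), hW⟩

theorem blockStart_succ (N K : ℕ → ℕ) (l : ℕ) :
    blockStart N K (l + 1) = blockStart N K l + (N (l + 1) + K (l + 1)) := by
  rw [blockStart, Finset.sum_range_succ]
  rfl

/-- A gap ends before any later one starts. Hence the gaps are disjoint, and the double sum in the
functional is a sum over their union. -/
theorem blockStart_add_le {N K : ℕ → ℕ} {l l' : ℕ} (h : l < l') :
    blockStart N K l + N (l + 1) ≤ blockStart N K l' := by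
  have hmono : Monotone (blockStart N K) := monotone_nat_of_le_succ fun l => by
    rw [blockStart_succ]
    omega
  have h1 := hmono (Nat.succ_le_of_lt h)
  rw [Nat.succ_eq_add_one, blockStart_succ] at h1
  omega

end Blocks

theorem functional_eq_blockFunctional {Ω : Type*} {T s : ℕ} {N K NT KT : ℕ → ℕ}
    {X : ℤ → Ω → ℂ} (hT : 0 < T) (hN : ∀ k ≤ s, N k = T * NT k)
    (hK : ∀ k < s, K k = T * KT k) {a : ℤ → ℂ} {c : ℤ → Fin T → ℂ}
    (ha : ∀ k ∈ missingBlocks NT KT s, ∀ ν : Fin T, a (((ν : ℕ) + 1) + k * T) = c k ν) (ω : Ω) :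
    functional N K s a X ω = blockFunctional NT KT s c (block T X) ω := by
  refine Finset.sum_congr rfl fun l hl => ?_
  have hl' := Finset.mem_range.1 hl
  rw [block_Icc_eq hN hK hl', sum_Icc_eq_sum_blocks hT]
  refine Finset.sum_congr rfl fun k hk => ?_
  rw [dotProduct]
  refine Finset.sum_congr rfl fun ν _ => ?_
  rw [← ha k (Finset.mem_biUnion.2 ⟨l, hl, hk⟩) ν, add_comm (((ν : ℕ) : ℤ) + 1)]
  rfl

theorem blockFunctional_eq_sum {Ω : Type*} {T : ℕ} (N K : ℕ → ℕ) (s : ℕ) (c : ℤ → Fin T → ℂ)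
    (X : ℤ → Fin T → Ω → ℂ) (ω : Ω) :
    blockFunctional N K s c X ω = ∑ j ∈ missingBlocks N K s, ∑ ν, c j ν * X j ν ω := by
  rw [missingBlocks, Finset.sum_biUnion]
  · rfl
  · intro l _ l' _ hll
    rw [Function.onFun, Finset.disjoint_left]
    intro j hj hj'
    rw [Finset.mem_Ico] at hj hj'
    rcases lt_or_gt_of_ne hll with h | h
    · have := blockStart_add_le (N := N) (K := K) h
      omega
    · have := blockStart_add_le (N := N) (K := K) h
      omega

/-- The functional of the blocked sequence as a stochastic integral. -/
theorem IsOrthogonalMeasureOf.exists_blockFunctional {Ω : Type*} [MeasurableSpace Ω]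
    {P : Measure Ω} {T : ℕ} {f : ℝ → Matrix (Fin T) (Fin T) ℂ}
    {ξ : ℤ → Fin T → Ω → ℂ} {Z : Fin T → VectorMeasure ℝ (Lp ℂ 2 P)} (hf : IsWeight f)
    (hZ : IsOrthogonalMeasureOf Z ξ f) (hξ : ∀ n ν, MemLp (ξ n ν) 2 P) (N K : ℕ → ℕ) (s : ℕ)
    (c : ℤ → Fin T → ℂ) : ∃ W : Lp ℂ 2 P, W =ᵐ[P] blockFunctional N K s c ξ ∧
      HasExtension f (simpleCoe T) (simpleIntegralₗ Z)
        (expSum (missingBlocks N K s) (stack (missingBlocks N K s) c)) W := by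
  have hI := isIsometric_simpleIntegral hf hZ.covariance
  have h1 : ∀ j ν, HasExtension f (simpleCoe T) (simpleIntegralₗ Z) (expVec T j ν)
      ((hξ j ν).toLp (ξ j ν)) := fun j ν => by
    have := hZ.hasExtension_trig hf hξ (Finsupp.single j (Pi.single ν 1))
    rwa [trigLin_single, trigLin_single] at this
  have h := HasExtension.sum hf hI (missingBlocks N K s) fun j _ =>
    HasExtension.sum hf hI Finset.univ fun ν _ => (h1 j ν).smul hf (c j ν)
  refine ⟨∑ j ∈ missingBlocks N K s, ∑ ν, c j ν • (hξ j ν).toLp (ξ j ν), ?_, ?_⟩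
  · have hs : ∀ j ν, ∀ᵐ ω ∂P, (c j ν • (hξ j ν).toLp (ξ j ν) : Lp ℂ 2 P) ω = c j ν * ξ j ν ω :=
      fun j ν => by
        filter_upwards [Lp.coeFn_smul (c j ν) ((hξ j ν).toLp (ξ j ν)), (hξ j ν).coeFn_toLp]
          with ω e1 e2
        rw [e1, Pi.smul_apply, e2, smul_eq_mul]
    have h2 : ∀ j, ∀ᵐ ω ∂P, (∑ ν, c j ν • (hξ j ν).toLp (ξ j ν) : Lp ℂ 2 P) ω =
        ∑ ν, c j ν * ξ j ν ω := fun j => by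
      filter_upwards [Lp.coeFn_finsetSum (s := Finset.univ)
        (f := fun ν => c j ν • (hξ j ν).toLp (ξ j ν)), ae_all_iff.2 (hs j)] with ω e1 e2
      rw [e1, Finset.sum_apply]
      exact Finset.sum_congr rfl fun ν _ => e2 ν
    filter_upwards [Lp.coeFn_finsetSum (s := missingBlocks N K s)
      (f := fun j => ∑ ν, c j ν • (hξ j ν).toLp (ξ j ν)), ae_all_iff.2 h2] with ω e1 e2
    rw [e1, Finset.sum_apply, blockFunctional_eq_sum]
    exact Finset.sum_congr rfl fun j _ => e2 j
  · convert h using 1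
    funext t ν
    rw [expSum, Finset.sum_apply, ← Finset.sum_coe_sort (missingBlocks N K s)]
    refine Finset.sum_congr rfl fun j _ => ?_
    simp [expVec, stack, Finset.sum_apply, Pi.single_apply]

end PCInterp

theorem mainTheorem5 {Ω : Type*} [MeasurableSpace Ω] (P : Measure Ω) [IsProbabilityMeasure P]
    (T s : ℕ) (N K NT KT : ℕ → ℕ)
    (hN0 : N 0 = 0) (hK0 : K 0 = 0)
    (hN : ∀ k ≤ s, N k = T * NT k) (hK : ∀ k < s, K k = T * KT k)
    (ζ θ : ℤ → Ω → ℂ)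
    (hζ : PCInterp.IsPC P T ζ) (hθ : PCInterp.IsPC P T θ)
    (hζθ : PCInterp.Uncorrelated P ζ θ)
    (f g : ℝ → Matrix (Fin T) (Fin T) ℂ)
    (hf : PCInterp.IsSpectralDensity P (PCInterp.block T ζ) f)
    (hg : PCInterp.IsSpectralDensity P (PCInterp.block T θ) g)
    (hmin : PCInterp.Minimality f g)
    (a α : ℤ → ℂ) (S : Finset ℤ) (hS : S = PCInterp.missingBlocks NT KT s)
    (ha : ∀ j ∈ S, ∀ ν : Fin T,
      a (((ν : ℕ) + 1) + j * T) =
        α j * Complex.exp (2 * Real.pi * Complex.I * j * ((ν : ℕ) + 1) / T)) :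
    -- reduction to the blocked stationary sequences
    PCInterp.IsStationary P (PCInterp.block T ζ) ∧
    PCInterp.IsStationary P (PCInterp.block T θ) ∧
    (∀ ω, PCInterp.functional N K s a ζ ω =
      PCInterp.blockFunctional NT KT s (PCInterp.coeffVec T α) (PCInterp.block T ζ) ω) ∧
    PCInterp.closedSpan P (fun j ω => ζ j ω + θ j ω)
        {j | j ∉ PCInterp.missing N K s} =
      PCInterp.closedSpan P
        (fun (p : ℤ × Fin T) ω => PCInterp.block T ζ p.1 p.2 ω + PCInterp.block T θ p.1 p.2 ω)
        {p | p.1 ∉ S} ∧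
    -- the matrices are well defined
    (∀ ν μ, IntegrableOn (fun t => (f t + g t)⁻¹ ν μ) (Set.Ioc (-Real.pi) Real.pi) ∧
      IntegrableOn (fun t => (f t * (f t + g t)⁻¹) ν μ) (Set.Ioc (-Real.pi) Real.pi) ∧
      IntegrableOn (fun t => (f t * (f t + g t)⁻¹ * g t) ν μ) (Set.Ioc (-Real.pi) Real.pi)) ∧
    IsUnit (PCInterp.matB S f g).det ∧
    -- the spectral characteristic, in both forms
    PCInterp.IsSpectralCharacteristic S
      (PCInterp.expSum S (PCInterp.stack S (PCInterp.coeffVec T α))) f g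
      (PCInterp.specChar S f g (PCInterp.coeffVec T α)) ∧
    (∀ b, PCInterp.IsSpectralCharacteristic S
        (PCInterp.expSum S (PCInterp.stack S (PCInterp.coeffVec T α))) f g b →
      b =ᵐ[volume.restrict (Set.Ioc (-Real.pi) Real.pi)]
        PCInterp.specChar S f g (PCInterp.coeffVec T α)) ∧
    (∀ᵐ t ∂(volume.restrict (Set.Ioc (-Real.pi) Real.pi)),
      PCInterp.specChar S f g (PCInterp.coeffVec T α) t =
        PCInterp.expSum S (PCInterp.stack S (PCInterp.coeffVec T α)) t -
          (PCInterp.expSum S (PCInterp.stack S (PCInterp.coeffVec T α)) t ᵥ* g t +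
            PCInterp.expSum S (PCInterp.coeffC S f g (PCInterp.coeffVec T α)) t) ᵥ*
              (f t + g t)⁻¹) ∧
    -- the mean square error
    ((PCInterp.mse (PCInterp.expSum S (PCInterp.stack S (PCInterp.coeffVec T α))) f g
        (PCInterp.specChar S f g (PCInterp.coeffVec T α)) : ℝ) : ℂ) =
      star (PCInterp.stack S (PCInterp.coeffVec T α)) ⬝ᵥ
          (PCInterp.matR S f g *ᵥ PCInterp.stack S (PCInterp.coeffVec T α)) +
        star (PCInterp.coeffC S f g (PCInterp.coeffVec T α)) ⬝ᵥ
          (PCInterp.matB S f g *ᵥ PCInterp.coeffC S f g (PCInterp.coeffVec T α)) ∧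
    -- the optimal estimate as a stochastic integral
    (∃ Zζ Zθ : Fin T → VectorMeasure ℝ (Lp ℂ 2 P),
      PCInterp.IsOrthogonalMeasureOf Zζ (PCInterp.block T ζ) f ∧
      PCInterp.IsOrthogonalMeasureOf Zθ (PCInterp.block T θ) g) ∧
    (∀ Zζ Zθ : Fin T → VectorMeasure ℝ (Lp ℂ 2 P),
      PCInterp.IsOrthogonalMeasureOf Zζ (PCInterp.block T ζ) f →
      PCInterp.IsOrthogonalMeasureOf Zθ (PCInterp.block T θ) g →
      ∃ Y : Lp ℂ 2 P,
        PCInterp.HasStochIntegral (Zζ + Zθ) (fun t => f t + g t)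
          (PCInterp.specChar S f g (PCInterp.coeffVec T α)) Y ∧
        (∀ Y' : Lp ℂ 2 P, PCInterp.IsOptimalEstimate
            (PCInterp.closedSpan P
              (fun (p : ℤ × Fin T) ω =>
                PCInterp.block T ζ p.1 p.2 ω + PCInterp.block T θ p.1 p.2 ω)
              {p | p.1 ∉ S})
            (PCInterp.blockFunctional NT KT s (PCInterp.coeffVec T α) (PCInterp.block T ζ)) Y' ↔
          Y' = Y) ∧
        ∫ ω, ‖PCInterp.blockFunctional NT KT s (PCInterp.coeffVec T α)
            (PCInterp.block T ζ) ω - Y ω‖ ^ 2 ∂P =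
          PCInterp.mse (PCInterp.expSum S (PCInterp.stack S (PCInterp.coeffVec T α))) f g
            (PCInterp.specChar S f g (PCInterp.coeffVec T α))) := by
  subst hS
  have hT := hζ.period_pos
  have hm : PCInterp.IsMinimalPair f g := ⟨hf.isWeight, hg.isWeight, hmin⟩
  have hζL : ∀ n ν, MemLp (PCInterp.block T ζ n ν) 2 P := fun n ν => hζ.memLp _
  have hθL : ∀ n ν, MemLp (PCInterp.block T θ n ν) 2 P := fun n ν => hθ.memLp _
  refine ⟨hζ.isStationary_block, hθ.isStationary_block,
    fun ω => PCInterp.functional_eq_blockFunctional hT hN hK ha ω,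
    PCInterp.closedSpan_block_eq hT hN hK,
    fun ν μ => ⟨hm.integrable_inv ν μ, hm.integrable_mul_inv ν μ, hm.integrable_parallel ν μ⟩,
    hm.isUnit_det_matB _, hm.isSpectralCharacteristic _ _, fun b hb => hm.eq_specChar hb, ?_,
    hm.mse_specChar _ _, ?_, fun Zζ Zθ hZζ hZθ => ?_⟩
  · filter_upwards [hmin.1] with t ht
    exact PCInterp.specChar_second_form ht _ _
  · obtain ⟨Zζ, hZζ⟩ := PCInterp.exists_isOrthogonalMeasureOf hf hζL
    obtain ⟨Zθ, hZθ⟩ := PCInterp.exists_isOrthogonalMeasureOf hg hθL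
    exact ⟨Zζ, Zθ, hZζ, hZθ⟩
  · obtain ⟨X, hX, hXext⟩ := hZζ.exists_blockFunctional hf.isWeight hζL NT KT s
      (PCInterp.coeffVec T α)
    exact hm.exists_optimalEstimate hZζ hZθ hζL hθL (fun n m ν μ => hζθ _ _) hX hXext
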